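/- Let $u,v\in\mathbb C$ and let $W$ be the Weyl group of type $A_{n-1}$ ($n\ge 1$), $B_n$ ($n\ge 2$) or $D_n$ ($n\ge 4$), regarded as the group of all permutations, of all signed permutations, or of all signed permutations with an even number of sign changes, of $n$ letters. The spin Weyl group algebra $\mathbb C W^-$ is the $\mathbb C$-algebra with the following generators and relations. In type $A_{n-1}$: generators $t_1,\dots,t_{n-1}$, with $t_i^2=1$, $t_it_{i+1}t_i=t_{i+1}t_it_{i+1}$, and $(t_it_j)^2=-1$ if $|i-j|>1$. In types $B_n$ and $D_n$ there is a further generator $t_n$ with $t_n^2=1$; in type $B_n$ it satisfies $(t_it_n)^2=-1$ for $i\ne n-1,n$ and $(t_{n-1}t_n)^4=-1$; in type $D_n$ it satisfies $(t_it_n)^2=-1$ for $i\neq n-2,n$ and $t_{n-2}t_nt_{n-2}=t_nt_{n-2}t_n$. For $1\le i<j\le n$ put $[i,j]=(-1)^{j-i-1}t_{j-1}\cdots t_{i+1}t_it_{i+1}\cdots t_{j-1}$ and $[j,i]=-[i,j]$. In types $B_n$, $D_n$ put $$\overline{[i,j]}=\overline{[j,i]}=\varepsilon\,(t_j\cdots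 t_{n-1})(t_i\cdots t_{n-2})\,r\,(t_{n-2}\cdots t_i)(t_{n-1}\cdots t_j),$$ where empty products are $1$, with $\varepsilon=(-1)^{j-i-1}$, $r=t_n$ in type $D_n$ and $\varepsilon=(-1)^{j-i}$, $r=t_nt_{n-1}t_n$ in type $B_n$. In type $B_n$ put $\overline{[i]}=(-1)^{n-i}t_i\cdots t_{n-1}t_nt_{n-1}\cdots t_i$. The rational spin double affine Hecke algebra (sDaHa) $H$ of type $W$ is the $\mathbb C$-algebra generated by $\mathbb C W^-$ and $y_i,\xi_i$ ($1\le i\le n$) subject to: - $y_iy_j=y_jy_i$, and $\xi_i\xi_j=-\xi_j\xi_i$ for $i\ne j$; - for $1\le i\le n-1$: $t_iy_i=y_{i+1}t_i$, $t_i\xi_i=-\xi_{i+1}t_i$, and $t_iy_j=y_jt_i$, $t_i\xi_j=-\xi_jt_i$ for $j\ne i,i+1$; - in type $D_n$: $t_ny_n=-y_{n-1}t_n$, $t_n\xi_n=-\xi_{n-1}t_n$, and $t_ny_j=y_jt_n$, $t_n\xi_j=-\xi_jt_n$ for $j\neq n-1,n$; - in type $B_n$: $t_ny_n=-y_nt_n$,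 $t_n\xi_n=-\xi_nt_n$, and $t_ny_j=y_jt_n$, $t_n\xi_j=-\xi_jt_n$ for $j\ne n$; - for $i\neq j$: $[y_j,\xi_i]=-u[i,j]$ in type $A_{n-1}$, and $[y_j,\xi_i]=-u[i,j]+u\overline{[i,j]}$ in types $B_n$, $D_n$; - $[y_i,\xi_i]=u\sum_{k\ne i}[i,k]$ in type $A_{n-1}$, $[y_i,\xi_i]=u\sum_{k\ne i}([i,k]+\overline{[i,k]})$ in type $D_n$, and $[y_i,\xi_i]=u\sum_{k\neq i}([i,k]+\overline{[i,k]})+v\,\overline{[i]}$ in type $B_n$; here $[a,b]=ab-ba$ on the left-hand sides. $H$ is a superalgebra in which the $y_i$ are even and the $\xi_i$ and $t_i$ are odd; its even center consists of the even elements that are central in $H$. Let $\mathbb C[y_1,\dots,y_n]^W$ be the algebra of polynomials invariant under the action of $W$ by (signed) permutations of the variables, and let $\mathbb C[\xi_1^2,\dots,\xi_n^2]^W$ be the algebra of polynomials $p(\xi_1^2,\dots,\xi_n^2)$ in the pairwise commuting elements $\xi_i^2$ for which the polynomial $p(X_1^2,\dots,X_n^2)$ is $W$-invariant. Then the even center of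 $H$ contains $\mathbb C[y_1,\dots,y_n]^W$ and $\mathbb C[\xi_1^2,\dots,\xi_n^2]^W$ as subalgebras: the evaluation homomorphisms from these algebras of invariant polynomials to $H$ are injective, with image in the even center. Moreover, $H$ is a finitely generated module over its even center. -/

import Mathlib

open MvPolynomial
open scoped IsMulCommutative

noncomputable section

namespace SpinDaHa

/-- The classical types; with parameter `n` they stand for `A_{n-1}`, `B_n`, `D_n`. -/
inductive ClassicalType
  | A
  | B
  | D

/-- The number of simple reflections of the Weyl group of type `A_{n-1}`, `B_n`, `D_n`. -/
def rank : ClassicalType → ℕ → ℕ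
  | .A, n => n - 1
  | .B, n => n
  | .D, n => n

/-- The usual range of `n` for the types `A_{n-1}`, `B_n`, `D_n`. -/
def Admissible : ClassicalType → ℕ → Prop
  | .A, n => 1 ≤ n
  | .B, n => 2 ≤ n
  | .D, n => 4 ≤ n

/-! ### The Weyl groups as groups of signed permutations -/

/-- Signed permutations of `n` letters. The pair `(ε, σ)` is the linear map sending the basis
vector `e_i` to `ε_{σ i} e_{σ i}`. -/
abbrev SignedPerm (n : ℕ) : Type :=
  (Fin n → ℤˣ) ⋊[mulAutArrow (G := Equiv.Perm (Fin n)) (A := Fin n) (M := ℤˣ)]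
    Equiv.Perm (Fin n)

/-- The product of the signs of a signed permutation. -/
def signProd (n : ℕ) : SignedPerm n →* ℤˣ where
  toFun w := ∏ i, w.left i
  map_one' := by simp
  map_mul' a b := by
    have h : ∏ i, (mulAutArrow a.right b.left) i = ∏ i, b.left i :=
      Equiv.prod_comp (a.right⁻¹ : Equiv.Perm (Fin n)) b.left
    simp only [SemidirectProduct.mul_left, Pi.mul_apply, Finset.prod_mul_distrib, h]

/-- The Weyl group: all permutations in type `A_{n-1}`, all signed permutations in type `B_n`,
and the signed permutations with an even number of sign changes in type `D_n`. -/
def weylGroup (X : ClassicalType) (n : ℕ) : Subgroup (SignedPerm n) :=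
  match X with
  | .A => (SemidirectProduct.inr : Equiv.Perm (Fin n) →* SignedPerm n).range
  | .B => ⊤
  | .D => (signProd n).ker

/-- The action of a signed permutation on polynomials, by algebra endomorphisms. -/
def polyAct {n : ℕ} (w : SignedPerm n) :
    MvPolynomial (Fin n) ℂ →ₐ[ℂ] MvPolynomial (Fin n) ℂ :=
  aeval fun i => C ((w.left (w.right i) : ℤ) : ℂ) * X (w.right i)

/-- The algebra `ℂ[X_1, …, X_n]^W` of invariants. -/
def invariants (X : ClassicalType) (n : ℕ) : Subalgebra ℂ (MvPolynomial (Fin n) ℂ) :=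
  ⨅ w ∈ weylGroup X n, AlgHom.equalizer (polyAct w) (AlgHom.id ℂ (MvPolynomial (Fin n) ℂ))

/-- The polynomials `p` in `n` variables such that `p(X_1², …, X_n²)` is `W`-invariant, that is,
the algebra `ℂ[X_1², …, X_n²]^W` written in the variables `Z_i = X_i²`. -/
def squareInvariants (X : ClassicalType) (n : ℕ) : Subalgebra ℂ (MvPolynomial (Fin n) ℂ) :=
  (invariants X n).comap (expand 2)

/-! ### The generators and the odd reflections -/

/-- The generators. Indices start at `0`: `y i`, `xi i`, `t i` stand for `y_{i+1}`, `ξ_{i+1}`,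
`t_{i+1}` in the numbering from `1`. -/
inductive Gen (X : ClassicalType) (n : ℕ)
  | y (i : Fin n)
  | xi (i : Fin n)
  | t (k : Fin (rank X n))

/-- The free algebra on the generators. -/
abbrev Free (X : ClassicalType) (n : ℕ) : Type := FreeAlgebra ℂ (Gen X n)

/-- The generator `y_i` in the free algebra. -/
def fy (X : ClassicalType) {n : ℕ} (i : Fin n) : Free X n := FreeAlgebra.ι ℂ (Gen.y i)

/-- The generator `ξ_i` in the free algebra. -/
def fxi (X : ClassicalType) {n : ℕ} (i : Fin n) : Free X n := FreeAlgebra.ι ℂ (Gen.xi i)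

/-- The generator `t_k` in the free algebra (only used for `k < rank X n`). -/
def ft (X : ClassicalType) (n : ℕ) (k : ℕ) : Free X n :=
  if h : k < rank X n then FreeAlgebra.ι ℂ (Gen.t ⟨k, h⟩) else 0

/-- `t_i t_{i+1} ⋯ t_{m-1}`, which is `1` if `m ≤ i`. -/
def tUp (X : ClassicalType) (n : ℕ) (i m : ℕ) : Free X n :=
  ((List.range' i (m - i)).map (ft X n)).prod

/-- `t_{m-1} t_{m-2} ⋯ t_i`, which is `1` if `m ≤ i`. -/
def tDown (X : ClassicalType) (n : ℕ) (i m : ℕ) : Free X n :=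
  ((List.range' i (m - i)).reverse.map (ft X n)).prod

/-- `(-1)^{j-i-1} t_{j-1} ⋯ t_{i+1} t_i t_{i+1} ⋯ t_{j-1}`, for `i < j`. -/
def braLt (X : ClassicalType) (n : ℕ) (i j : ℕ) : Free X n :=
  (-1) ^ (j - i - 1) * (tDown X n (i + 1) j * ft X n i * tUp X n (i + 1) j)

/-- The element `[i,j]`, with `[j,i] = -[i,j]`. -/
def bra (X : ClassicalType) {n : ℕ} (i j : Fin n) : Free X n :=
  if i < j then braLt X n i j else -braLt X n j i

/-- The element `overline{[i,j]}` for `i < j`, in types `D` and `B`. In the numbering from `0`,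
the last generator is `t_{n-1}`. There is no such element in type `A`. -/
def barLt (X : ClassicalType) (n : ℕ) (i j : ℕ) : Free X n :=
  match X with
  | .A => 0
  | .D => (-1) ^ (j - i - 1) *
      (tUp .D n j (n - 1) * tUp .D n i (n - 2) * ft .D n (n - 1) *
        tDown .D n i (n - 2) * tDown .D n j (n - 1))
  | .B => (-1) ^ (j - i) *
      (tUp .B n j (n - 1) * tUp .B n i (n - 2) *
        (ft .B n (n - 1) * ft .B n (n - 2) * ft .B n (n - 1)) *
        tDown .B n i (n - 2) * tDown .B n j (n - 1))

/-- The element `overline{[i,j]} = overline{[j,i]}`. -/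
def bar (X : ClassicalType) {n : ℕ} (i j : Fin n) : Free X n :=
  if i < j then barLt X n i j else barLt X n j i

/-- The element `overline{[i]}` of type `B`: up to the sign `(-1)^{n-i}` (for `i` numbered
from `1`), it is `t_i ⋯ t_{n-1} t_n t_{n-1} ⋯ t_i`. -/
def barOne {n : ℕ} (i : Fin n) : Free .B n :=
  (-1) ^ (n - (i + 1)) * (tUp .B n i (n - 1) * ft .B n (n - 1) * tDown .B n i (n - 1))

/-! ### The rational spin double affine Hecke algebras -/

/-- The defining relations: those of the spin Weyl group algebra `ℂW⁻` among the `t_k`, followed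
by those that involve the `y_i` and `ξ_i`. The parameter `v` occurs in type `B` only. -/
inductive Rel (u v : ℂ) : (X : ClassicalType) → (n : ℕ) → Free X n → Free X n → Prop
  -- relations of `ℂW⁻`
  | t_sq {X n} (k : ℕ) (hk : k < rank X n) : Rel u v X n (ft X n k ^ 2) 1
  | t_braid {X n} (k : ℕ) (hk : k + 2 < n) :
      Rel u v X n (ft X n k * ft X n (k + 1) * ft X n k)
        (ft X n (k + 1) * ft X n k * ft X n (k + 1))
  | t_far {X n} (k l : ℕ) (hk : k + 1 < n) (hl : l + 1 < n) (hkl : k + 1 < l ∨ l + 1 < k) :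
      Rel u v X n ((ft X n k * ft X n l) ^ 2) (-1)
  | t_far_B {n} (k : ℕ) (hk : k + 2 < n) :
      Rel u v .B n ((ft .B n k * ft .B n (n - 1)) ^ 2) (-1)
  | t_braid_B {n} (hn : 2 ≤ n) :
      Rel u v .B n ((ft .B n (n - 2) * ft .B n (n - 1)) ^ 4) (-1)
  | t_far_D {n} (k : ℕ) (hk : k + 1 < n) (hk' : k + 3 ≠ n) :
      Rel u v .D n ((ft .D n k * ft .D n (n - 1)) ^ 2) (-1)
  | t_braid_D {n} (hn : 3 ≤ n) :
      Rel u v .D n (ft .D n (n - 3) * ft .D n (n - 1) * ft .D n (n - 3))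
        (ft .D n (n - 1) * ft .D n (n - 3) * ft .D n (n - 1))
  -- relations among the `y_i` and among the `ξ_i`
  | y_comm {X n} (i j : Fin n) : Rel u v X n (fy X i * fy X j) (fy X j * fy X i)
  | xi_anti {X n} (i j : Fin n) (hij : i ≠ j) :
      Rel u v X n (fxi X i * fxi X j) (-(fxi X j * fxi X i))
  -- relations between `t_k`, for the transposition of `k` and `k + 1`, and `y_j`, `ξ_j`
  | t_y {X n} (i j : Fin n) (hij : (i : ℕ) + 1 = j) :
      Rel u v X n (ft X n i * fy X i) (fy X j * ft X n i)
  | t_xi {X n} (i j : Fin n) (hij : (i : ℕ) + 1 = j) :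
      Rel u v X n (ft X n i * fxi X i) (-(fxi X j * ft X n i))
  | t_y_far {X n} (k : ℕ) (hk : k + 1 < n) (j : Fin n) (h1 : (j : ℕ) ≠ k) (h2 : (j : ℕ) ≠ k + 1) :
      Rel u v X n (ft X n k * fy X j) (fy X j * ft X n k)
  | t_xi_far {X n} (k : ℕ) (hk : k + 1 < n) (j : Fin n) (h1 : (j : ℕ) ≠ k)
      (h2 : (j : ℕ) ≠ k + 1) :
      Rel u v X n (ft X n k * fxi X j) (-(fxi X j * ft X n k))
  -- relations between the last generator `t_{n-1}` of type `D` and `y_j`, `ξ_j`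
  | tn_y_D {n} (i j : Fin n) (hi : (i : ℕ) + 2 = n) (hj : (j : ℕ) + 1 = n) :
      Rel u v .D n (ft .D n (n - 1) * fy .D j) (-(fy .D i * ft .D n (n - 1)))
  | tn_xi_D {n} (i j : Fin n) (hi : (i : ℕ) + 2 = n) (hj : (j : ℕ) + 1 = n) :
      Rel u v .D n (ft .D n (n - 1) * fxi .D j) (-(fxi .D i * ft .D n (n - 1)))
  | tn_y_far_D {n} (j : Fin n) (hj : (j : ℕ) + 2 < n) :
      Rel u v .D n (ft .D n (n - 1) * fy .D j) (fy .D j * ft .D n (n - 1))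
  | tn_xi_far_D {n} (j : Fin n) (hj : (j : ℕ) + 2 < n) :
      Rel u v .D n (ft .D n (n - 1) * fxi .D j) (-(fxi .D j * ft .D n (n - 1)))
  -- relations between the last generator `t_{n-1}` of type `B` and `y_j`, `ξ_j`
  | tn_y_B {n} (j : Fin n) (hj : (j : ℕ) + 1 = n) :
      Rel u v .B n (ft .B n (n - 1) * fy .B j) (-(fy .B j * ft .B n (n - 1)))
  | tn_xi_B {n} (j : Fin n) (hj : (j : ℕ) + 1 = n) :
      Rel u v .B n (ft .B n (n - 1) * fxi .B j) (-(fxi .B j * ft .B n (n - 1)))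
  | tn_y_far_B {n} (j : Fin n) (hj : (j : ℕ) + 1 < n) :
      Rel u v .B n (ft .B n (n - 1) * fy .B j) (fy .B j * ft .B n (n - 1))
  | tn_xi_far_B {n} (j : Fin n) (hj : (j : ℕ) + 1 < n) :
      Rel u v .B n (ft .B n (n - 1) * fxi .B j) (-(fxi .B j * ft .B n (n - 1)))
  -- the commutators `[y_j, ξ_i]`
  | comm_A {n} (i j : Fin n) (hij : i ≠ j) :
      Rel u v .A n (fy .A j * fxi .A i - fxi .A i * fy .A j) (-(u • bra .A i j))
  | comm_self_A {n} (i : Fin n) :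
      Rel u v .A n (fy .A i * fxi .A i - fxi .A i * fy .A i)
        (u • ∑ k ∈ Finset.univ.erase i, bra .A i k)
  | comm_D {n} (i j : Fin n) (hij : i ≠ j) :
      Rel u v .D n (fy .D j * fxi .D i - fxi .D i * fy .D j)
        (-(u • bra .D i j) + u • bar .D i j)
  | comm_self_D {n} (i : Fin n) :
      Rel u v .D n (fy .D i * fxi .D i - fxi .D i * fy .D i)
        (u • ∑ k ∈ Finset.univ.erase i, (bra .D i k + bar .D i k))
  | comm_B {n} (i j : Fin n) (hij : i ≠ j) :
      Rel u v .B n (fy .B j * fxi .B i - fxi .B i * fy .B j)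
        (-(u • bra .B i j) + u • bar .B i j)
  | comm_self_B {n} (i : Fin n) :
      Rel u v .B n (fy .B i * fxi .B i - fxi .B i * fy .B i)
        ((u • ∑ k ∈ Finset.univ.erase i, (bra .B i k + bar .B i k)) + v • barOne i)

/-- The rational spin double affine Hecke algebra of type `A_{n-1}`, `B_n` or `D_n`. -/
def SDaHa (X : ClassicalType) (n : ℕ) (u v : ℂ) : Type := RingQuot (Rel u v X n)

variable (X : ClassicalType) (n : ℕ) (u v : ℂ)

instance : Ring (SDaHa X n u v) := inferInstanceAs (Ring (RingQuot (Rel u v X n)))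

instance : Algebra ℂ (SDaHa X n u v) := inferInstanceAs (Algebra ℂ (RingQuot (Rel u v X n)))

/-- The quotient homomorphism from the free algebra. -/
def mk : Free X n →ₐ[ℂ] SDaHa X n u v := RingQuot.mkAlgHom ℂ (Rel u v X n)

theorem mk_rel {a b : Free X n} (h : Rel u v X n a b) : mk X n u v a = mk X n u v b :=
  RingQuot.mkAlgHom_rel ℂ h

/-- The image of a generator in the spin double affine Hecke algebra. -/
def gen (g : Gen X n) : SDaHa X n u v :=
  mk X n u v (FreeAlgebra.ι ℂ g)

/-! ### The superalgebra structure and the even center -/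

/-- The parity of a generator: the `y_i` are even, the `ξ_i` and the `t_k` are odd. -/
def parity {X : ClassicalType} {n : ℕ} : Gen X n → ZMod 2
  | .y _ => 0
  | .xi _ => 1
  | .t _ => 1

/-- The component of degree `d` of the superalgebra: the span of the products of generators whose
total parity is `d`. -/
def component (d : ZMod 2) : Submodule ℂ (SDaHa X n u v) :=
  Submodule.span ℂ
    {a | ∃ w : List (Gen X n), (w.map parity).sum = d ∧ (w.map (gen X n u v)).prod = a}

theorem one_mem_component : (1 : SDaHa X n u v) ∈ component X n u v 0 :=
  Submodule.subset_span ⟨[], by simp, by simp⟩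

theorem mul_mem_component {d e : ZMod 2} {a b : SDaHa X n u v} (ha : a ∈ component X n u v d)
    (hb : b ∈ component X n u v e) : a * b ∈ component X n u v (d + e) := by
  have h := Submodule.mul_mem_mul ha hb
  rw [component, component, Submodule.span_mul_span] at h
  refine Submodule.span_mono ?_ h
  rintro _ ⟨_, ⟨w, hw, rfl⟩, _, ⟨w', hw', rfl⟩, rfl⟩
  exact ⟨w ++ w', by simp [hw, hw'], by simp⟩

/-- The even part. -/
def evenPart : Subalgebra ℂ (SDaHa X n u v) :=
  (component X n u v 0).toSubalgebra (one_mem_component X n u v)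
    (fun _ _ ha hb => by simpa using mul_mem_component X n u v ha hb)

/-- The even center: the even central elements. -/
def evenCenter : Subalgebra ℂ (SDaHa X n u v) :=
  evenPart X n u v ⊓ Subalgebra.center ℂ (SDaHa X n u v)

/-! ### Polynomials in the `y_i` and in the `ξ_i²` -/

/-- Evaluation of polynomials at pairwise commuting elements of an algebra. -/
def evalCommuting {R : Type} [Ring R] [Algebra ℂ R] {m : ℕ} (a : Fin m → R)
    (h : ∀ i j, a i * a j = a j * a i) : MvPolynomial (Fin m) ℂ →ₐ[ℂ] R :=
  haveI : IsMulCommutative (Algebra.adjoin ℂ (Set.range a)) :=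
    Algebra.isMulCommutative_adjoin ℂ (by rintro _ ⟨i, rfl⟩ _ ⟨j, rfl⟩; exact h i j)
  (Algebra.adjoin ℂ (Set.range a)).val.comp
    (aeval fun i => ⟨a i, Algebra.subset_adjoin (Set.mem_range_self i)⟩)

theorem y_mul_y (i j : Fin n) :
    gen X n u v (.y i) * gen X n u v (.y j) = gen X n u v (.y j) * gen X n u v (.y i) := by
  have h := mk_rel X n u v (Rel.y_comm (u := u) (v := v) (X := X) i j)
  simp only [map_mul, fy] at h
  exact h

theorem xi_mul_xi {i j : Fin n} (hij : i ≠ j) :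
    gen X n u v (.xi i) * gen X n u v (.xi j) = -(gen X n u v (.xi j) * gen X n u v (.xi i)) := by
  have h := mk_rel X n u v (Rel.xi_anti (u := u) (v := v) (X := X) i j hij)
  simp only [map_mul, map_neg, fxi] at h
  exact h

theorem xiSq_mul_xiSq (i j : Fin n) :
    gen X n u v (.xi i) ^ 2 * gen X n u v (.xi j) ^ 2 =
      gen X n u v (.xi j) ^ 2 * gen X n u v (.xi i) ^ 2 := by
  by_cases hij : i = j
  · rw [hij]
  · have h := xi_mul_xi X n u v hij
    have h1 : Commute (gen X n u v (.xi i)) (gen X n u v (.xi j) ^ 2) := by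
      unfold Commute SemiconjBy
      rw [pow_two, ← mul_assoc, h, neg_mul, mul_assoc, h, mul_neg, neg_neg, mul_assoc]
    exact h1.pow_left 2

/-- The homomorphism `f ↦ f(y_1, …, y_n)`. -/
def yHom : MvPolynomial (Fin n) ℂ →ₐ[ℂ] SDaHa X n u v :=
  evalCommuting (fun i => gen X n u v (.y i)) (y_mul_y X n u v)

/-- The homomorphism `p ↦ p(ξ_1², …, ξ_n²)`. -/
def xiSqHom : MvPolynomial (Fin n) ℂ →ₐ[ℂ] SDaHa X n u v :=
  evalCommuting (fun i => gen X n u v (.xi i) ^ 2) (xiSq_mul_xiSq X n u v)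

end SpinDaHa

end

/-! Three independent facts are needed: the evaluation maps are injective, invariants commute with
every generator, and the algebra is a product of three subalgebras, each finitely generated over the
even center. No PBW basis is used.

Injectivity comes from a Dunkl-type representation on `ℂ[y] ⊗ E` (`SpinModel.rep`). There `y_i` is
multiplication, the odd reflection in `α` is `s_α ⊗ θ_α`, and `ξ_i` is `η_i` minus divided
differences in the roots involving `e_i`, each paired with `θ_α`. The relation that needs an
argument is `ξ_i ξ_j = -ξ_j ξ_i` (`xiOp_mul_xiOp`): the anticommutator commutes with all `y_k` and
kills `1 ⊗ E`, and such an operator is zero. For `E` one takes `End ℂ[x] ⊗ Cl_n`, with `η_i = x_i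
c_i`. Divided differences kill constants, so on `1 ⊗ E` the element `p(ξ_1², …, ξ_n²)` acts through
multiplication by `p(x_1², …, x_n²)`. Hence both evaluation maps are injective even on all
polynomials.

Centrality rests on one formula, `commutator_eq_sum`: if `[Y(X_j), x]` is given on the variables by
divided differences `∂_α` times elements that move past `Y(f)` by `s_α`, then `[Y(f), x] = ∑ Y(∂_α
f) g_α` for all `f`, by the twisted Leibniz rule. It is applied to polynomials in `y` against `ξ_i`,
and to polynomials in the `ξ_i²` against `y_j`. In the second case only the transpositions matter,
since signs are invisible on squares. Divided differences of invariants vanish.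

For finiteness, let `P`, `S`, `Q` be the subalgebras generated over the even center by the `y_i`,
the `t_k` and the `ξ_i`. The commutation relations give `H = P S Q` (`finite_of_triangular`). The
`y_i` and `ξ_i` are integral over the even center, by the polynomials with roots `X_j²`,
respectively `X_j`, evaluated at the `y_j` and the `ξ_j²`; as they commute up to sign, `P` and `Q`
are finitely generated. For `S`, the lines spanned by the `t_k` satisfy the ordinary Coxeter
relations, because a sign does not change a line. So they generate a finite monoid of submodules
(`finite_closure_tLine`), whose sum is `S`. -/

noncomputable section

namespace SpinDaHa

/-! ### Finiteness of monoids generated by Coxeter generators of classical type -/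

section Coxeter

variable {M : Type*} [Monoid M]

/-- The conjugates `s_k ⋯ s_1 s_0 s_1 ⋯ s_k` of the special generator of type `B`. -/
def coxB (s : ℕ → M) : ℕ → M
  | 0 => s 0
  | k + 1 => s (k + 1) * coxB s k * s (k + 1)

/-- The relations of type `B` between `s_0, …, s_{n-1}`, where `s_0` is the special generator. -/
structure CoxeterB (s : ℕ → M) (n : ℕ) : Prop where
  sq : ∀ i < n, s i * s i = 1
  far : ∀ i j, i + 1 < j → j < n → s i * s j = s j * s i
  braid : ∀ i, 1 ≤ i → i + 1 < n → s i * s (i + 1) * s i = s (i + 1) * s i * s (i + 1)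
  special : 1 < n → s 0 * s 1 * s 0 * s 1 = s 1 * s 0 * s 1 * s 0

theorem coxB_mem (s : ℕ → M) (k : ℕ) : coxB s k ∈ Submonoid.closure (s '' Set.Iio (k + 1)) := by
  induction k with
  | zero => exact Submonoid.subset_closure ⟨0, by simp, rfl⟩
  | succ k ih =>
    have h1 : s (k + 1) ∈ Submonoid.closure (s '' Set.Iio (k + 1 + 1)) :=
      Submonoid.subset_closure ⟨k + 1, by simp, rfl⟩
    exact mul_mem (mul_mem h1 (Submonoid.closure_mono (Set.image_mono fun x (hx : x < k + 1) =>
      show x < k + 1 + 1 by omega) ih)) h1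

theorem commute_of_mem_closure {s : ℕ → M} {k : ℕ} {x g : M} (hx : ∀ j < k, Commute (s j) x)
    (hg : g ∈ Submonoid.closure (s '' Set.Iio k)) : Commute g x := by
  induction hg using Submonoid.closure_induction with
  | mem g hg => obtain ⟨j, hj, rfl⟩ := hg; exact hx j hj
  | one => exact Commute.one_left x
  | mul a b _ _ ha hb => exact ha.mul_left hb

namespace CoxeterB

variable {s : ℕ → M} {n : ℕ}

theorem commute_coxB_far (h : CoxeterB s n) {j k : ℕ} (hjk : k + 1 < j) (hj : j < n) :
    Commute (s j) (coxB s k) := by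
  induction k with
  | zero => exact (h.far 0 j hjk hj).symm
  | succ k ih =>
    have h1 : Commute (s j) (s (k + 1)) := (h.far _ _ hjk hj).symm
    exact (h1.mul_right (ih (by omega))).mul_right h1

theorem commute_coxB (h : CoxeterB s n) {j k : ℕ} (hjk : j < k) (hk : k < n) :
    Commute (s j) (coxB s k) := by
  induction k with
  | zero => omega
  | succ k ih =>
    rcases Nat.lt_or_ge j k with hj | hj
    · have h1 : Commute (s j) (s (k + 1)) := h.far _ _ (by omega) hk
      exact (h1.mul_right (ih hj (by omega))).mul_right h1
    · obtain rfl : j = k := by omega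
      rcases j with _ | k
      · have := h.special hk
        simp only [Commute, SemiconjBy, coxB]
        simpa only [mul_assoc] using this
      · have hb := h.braid (k + 1) (by omega) hk
        have hc : s (k + 1 + 1) * coxB s k = coxB s k * s (k + 1 + 1) :=
          h.commute_coxB_far (by omega) hk
        simp only [Commute, SemiconjBy, coxB]
        calc s (k + 1) * (s (k + 1 + 1) * (s (k + 1) * coxB s k * s (k + 1)) * s (k + 1 + 1))
            = (s (k + 1) * s (k + 1 + 1) * s (k + 1)) * coxB s k * s (k + 1) * s (k + 1 + 1) := by
              simp only [mul_assoc]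
          _ = s (k + 1 + 1) * s (k + 1) * (s (k + 1 + 1) * coxB s k) * s (k + 1)
                * s (k + 1 + 1) := by rw [hb]; simp only [mul_assoc]
          _ = s (k + 1 + 1) * s (k + 1) * coxB s k *
                (s (k + 1 + 1) * s (k + 1) * s (k + 1 + 1)) := by rw [hc]; simp only [mul_assoc]
          _ = _ := by rw [← hb]; simp only [mul_assoc]

/-- The three alternatives are the double cosets of `B_k` in `B_{k+1}`: on signed permutations they
say whether the new coordinate vector is fixed, sent to plus or minus another one, or negated. It
suffices that their union is stable under right multiplication by each generator. Since only
relations are used, this works in any monoid. -/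
theorem closure_decomposition (h : CoxeterB s n) {k : ℕ} (hk : k < n) {g : M}
    (hg : g ∈ Submonoid.closure (s '' Set.Iio (k + 1))) :
    g ∈ Submonoid.closure (s '' Set.Iio k) ∨
    (1 ≤ k ∧ ∃ a ∈ Submonoid.closure (s '' Set.Iio k), ∃ b ∈ Submonoid.closure (s '' Set.Iio k),
      g = a * s k * b) ∨
    ∃ a ∈ Submonoid.closure (s '' Set.Iio k), g = a * coxB s k := by
  induction k generalizing g with
  | zero =>
    have h0 : s '' Set.Iio 0 = ∅ := by ext; simp
    rw [h0]
    simp only [Submonoid.closure_empty, Submonoid.mem_bot, coxB]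
    induction hg using Submonoid.closure_induction_right with
    | one => exact Or.inl rfl
    | mul_right x hx y hy ih =>
      obtain ⟨j, hj, rfl⟩ := hy
      obtain rfl : j = 0 := by simpa using hj
      rcases ih with rfl | ⟨h, _⟩ | ⟨a, rfl, rfl⟩
      · exact Or.inr (Or.inr ⟨1, rfl, rfl⟩)
      · omega
      · left; rw [one_mul, h.sq 0 hk]
  | succ k ihk =>
    set K := Submonoid.closure (s '' Set.Iio (k + 1)) with hK
    have hmono : Submonoid.closure (s '' Set.Iio k) ≤ K :=
      Submonoid.closure_mono (Set.image_mono fun x (hx : x < k) => show x < k + 1 by omega)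
    have hmem : ∀ j < k + 1, s j ∈ K := fun j hj => Submonoid.subset_closure ⟨j, hj, rfl⟩
    have hcommb : ∀ g ∈ K, Commute g (coxB s (k + 1)) := fun g hg =>
      commute_of_mem_closure (fun j hj => h.commute_coxB hj hk) hg
    have hcomms : ∀ g ∈ Submonoid.closure (s '' Set.Iio k), Commute g (s (k + 1)) := fun g hg =>
      commute_of_mem_closure (fun j hj => h.far _ _ (by omega) hk) hg
    have hsq := h.sq _ hk
    induction hg using Submonoid.closure_induction_right with
    | one => exact Or.inl (one_mem _)
    | mul_right x hx y hy ih =>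
      obtain ⟨j, hj, rfl⟩ := hy
      rcases Nat.lt_or_ge j (k + 1) with hj' | hj'
      · rcases ih with hx | ⟨h1, a, ha, b, hb, rfl⟩ | ⟨a, ha, rfl⟩
        · exact Or.inl (mul_mem hx (hmem j hj'))
        · exact Or.inr (Or.inl ⟨h1, a, ha, b * s j, mul_mem hb (hmem j hj'), by
            simp only [mul_assoc]⟩)
        · refine Or.inr (Or.inr ⟨a * s j, mul_mem ha (hmem j hj'), ?_⟩)
          rw [mul_assoc, ← (hcommb _ (hmem j hj')).eq, mul_assoc]
      · obtain rfl : j = k + 1 := by have : j < k + 1 + 1 := hj; omega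
        rcases ih with hx | ⟨h1, a, ha, b, hb, rfl⟩ | ⟨a, ha, rfl⟩
        · exact Or.inr (Or.inl ⟨by omega, x, hx, 1, one_mem _, by rw [mul_one]⟩)
        -- To rewrite `s_{k+1} b s_{k+1}`, decompose `b` one level lower. The factors from that
        -- level commute with `s_{k+1}`, which leaves `s_{k+1}² = 1`, a braid relation, or the
        -- definition of `coxB`.
        · rcases ihk (by omega) hb with hb | ⟨h2, c, hc, d, hd, rfl⟩ | ⟨c, hc, rfl⟩
          · left
            rw [mul_assoc, (hcomms b hb).eq, ← mul_assoc, mul_assoc a, hsq, mul_one]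
            exact mul_mem ha (hmono hb)
          · refine Or.inr (Or.inl ⟨h1, a * (c * s k), mul_mem ha (mul_mem (hmono hc)
              (hmem k (by omega))), s k * d, mul_mem (hmem k (by omega)) (hmono hd), ?_⟩)
            calc a * s (k + 1) * (c * s k * d) * s (k + 1)
                = a * (s (k + 1) * c) * s k * (d * s (k + 1)) := by simp only [mul_assoc]
              _ = a * c * (s (k + 1) * s k * s (k + 1)) * d := by
                rw [← (hcomms c hc).eq, (hcomms d hd).eq]; simp only [mul_assoc]
              _ = _ := by rw [← h.braid k h2 hk]; simp only [mul_assoc]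
          · refine Or.inr (Or.inr ⟨a * c, mul_mem ha (hmono hc), ?_⟩)
            calc a * s (k + 1) * (c * coxB s k) * s (k + 1)
                = a * (s (k + 1) * c) * coxB s k * s (k + 1) := by simp only [mul_assoc]
              _ = _ := by rw [← (hcomms c hc).eq]; simp only [mul_assoc, coxB]
        · refine Or.inr (Or.inl ⟨by omega, a, ha, coxB s k, coxB_mem s k, ?_⟩)
          rw [coxB, mul_assoc, mul_assoc, hsq, mul_one, mul_assoc]

theorem finite_closure (h : CoxeterB s n) {k : ℕ} (hk : k ≤ n) :
    (Submonoid.closure (s '' Set.Iio k) : Set M).Finite := by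
  induction k with
  | zero =>
    have h0 : s '' Set.Iio 0 = ∅ := by ext; simp
    rw [h0]
    simp
  | succ k ih =>
    have hK := ih (by omega)
    refine ((hK.union (Set.Finite.image2 (fun a b => a * s k * b) hK hK)).union
      (hK.image fun a => a * coxB s k)).subset fun g hg => ?_
    rcases h.closure_decomposition hk hg with h1 | ⟨_, a, ha, b, hb, rfl⟩ | ⟨a, ha, rfl⟩
    · exact Or.inl (Or.inl h1)
    · exact Or.inl (Or.inr ⟨a, ha, b, hb, rfl⟩)
    · exact Or.inr ⟨a, ha, rfl⟩

end CoxeterB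

/-! ### Reduction of types A and D to type B -/

/-- The relations of type `A` between `t_0, …, t_{m-1}`. -/
structure CoxeterA (t : ℕ → M) (m : ℕ) : Prop where
  sq : ∀ i < m, t i * t i = 1
  far : ∀ i j, i + 1 < j → j < m → t i * t j = t j * t i
  braid : ∀ i, i + 1 < m → t i * t (i + 1) * t i = t (i + 1) * t i * t (i + 1)

/-- Generators of type `A` in reverse order, preceded by an element `x`. -/
def revSeq (x : M) (t : ℕ → M) (m : ℕ) : ℕ → M
  | 0 => x
  | i + 1 => t (m - 1 - i)

/-- Only relations are required, so the special generator may be degenerate: `x = 1` covers type A,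
`x = t m` type B, and the exchange of two summands type D. -/
theorem CoxeterA.coxeterB {t : ℕ → M} {m : ℕ} (h : CoxeterA t m) {x : M} (hx : x * x = 1)
    (hfar : ∀ i, i + 1 < m → x * t i = t i * x)
    (hspecial : 0 < m → x * t (m - 1) * x * t (m - 1) = t (m - 1) * x * t (m - 1) * x) :
    CoxeterB (revSeq x t m) (m + 1) where
  sq i hi := by
    rcases i with _ | i
    · exact hx
    · exact h.sq _ (by omega)
  far i j hij hj := by
    obtain ⟨j, rfl⟩ : ∃ j', j = j' + 1 := ⟨j - 1, by omega⟩
    rcases i with _ | i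
    · exact hfar _ (by omega)
    · exact (h.far _ _ (by omega) (by omega)).symm
  braid i h1 hi := by
    obtain ⟨i, rfl⟩ : ∃ j', i = j' + 1 := ⟨i - 1, by omega⟩
    have := (h.braid (m - 1 - (i + 1)) (by omega)).symm
    rw [show m - 1 - (i + 1) + 1 = m - 1 - i by omega] at this
    exact this
  special hm := hspecial (by omega)

theorem closure_le_revSeq (x : M) (t : ℕ → M) (m : ℕ) {y : M}
    (hy : y = x ∨ ∃ i < m, y = t i) :
    y ∈ Submonoid.closure (revSeq x t m '' Set.Iio (m + 1)) := by
  apply Submonoid.subset_closure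
  rcases hy with rfl | ⟨i, hi, rfl⟩
  · exact ⟨0, by simp, rfl⟩
  · refine ⟨m - 1 - i + 1, by simp; omega, ?_⟩
    simp only [revSeq]
    congr 1
    omega

theorem finite_closure_of_coxeterA {t : ℕ → M} {m : ℕ} (h : CoxeterA t m) :
    (Submonoid.closure (t '' Set.Iio m) : Set M).Finite := by
  refine ((h.coxeterB (x := 1) (one_mul 1) (by simp) (by simp)).finite_closure le_rfl).subset ?_
  refine Submonoid.closure_le.2 ?_
  rintro _ ⟨i, hi, rfl⟩
  exact closure_le_revSeq _ _ _ (Or.inr ⟨i, hi, rfl⟩)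

theorem finite_closure_of_coxeterB {t : ℕ → M} {m : ℕ} (h : CoxeterA t m)
    (hx : t m * t m = 1) (hfar : ∀ i, i + 1 < m → t m * t i = t i * t m)
    (hspecial : 0 < m → t m * t (m - 1) * t m * t (m - 1) = t (m - 1) * t m * t (m - 1) * t m) :
    (Submonoid.closure (t '' Set.Iio (m + 1)) : Set M).Finite := by
  refine ((h.coxeterB hx hfar hspecial).finite_closure le_rfl).subset ?_
  refine Submonoid.closure_le.2 ?_
  rintro _ ⟨i, hi, rfl⟩
  rcases Nat.lt_succ_iff_lt_or_eq.1 hi with hi | rfl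
  · exact closure_le_revSeq _ _ _ (Or.inr ⟨i, hi, rfl⟩)
  · exact closure_le_revSeq _ _ _ (Or.inl rfl)

/-- The left multiplications by `a` and `b` on the two summands of `M ⊕ M`. -/
def sumMul (a b : M) : Function.End (M ⊕ M) := Sum.map (a * ·) (b * ·)

theorem sumMul_mul (a b c d : M) : sumMul a b * sumMul c d = sumMul (a * c) (b * d) := by
  funext z
  rcases z with z | z
  · exact congrArg Sum.inl (mul_assoc a c z).symm
  · exact congrArg Sum.inr (mul_assoc b d z).symm

theorem sumMul_one : sumMul (1 : M) 1 = 1 := by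
  funext z
  rcases z with z | z <;> simp [sumMul, Function.End.one_def]

/-- The exchange of the two summands of `M ⊕ M`. -/
def sumSwap (M : Type*) : Function.End (M ⊕ M) := Sum.swap

theorem sumSwap_mul (a b : M) : sumSwap M * sumMul a b = sumMul b a * sumSwap M := by
  funext z
  rcases z with z | z <;> rfl

theorem sumSwap_sq (N : Type*) : sumSwap N * sumSwap N = 1 := by
  funext z
  rcases z with z | z <;> rfl

/-- In type `D`, the diagram automorphism is realized by exchanging the summands of `M ⊕ M`. -/
theorem finite_closure_of_coxeterD {t : ℕ → M} {m : ℕ} (h : CoxeterA t (m + 1))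
    (hx : t (m + 1) * t (m + 1) = 1) (hfar : ∀ i, i + 1 < m → t i * t (m + 1) = t (m + 1) * t i)
    (hcomm : t m * t (m + 1) = t (m + 1) * t m)
    (hbraid : 0 < m → t (m - 1) * t (m + 1) * t (m - 1) = t (m + 1) * t (m - 1) * t (m + 1)) :
    (Submonoid.closure (t '' Set.Iio (m + 2)) : Set M).Finite := by
  -- The branch generators `t_m` and `t_{m+1}` become the two coordinates of `T_m`; the other
  -- generators act diagonally. Conjugating `T_m` by the exchange `x` swaps the two branches, as in
  -- the embedding of `D_n` in `B_n`.
  let T : ℕ → Function.End (M ⊕ M) := fun i =>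
    if i = m then sumMul (t m) (t (m + 1)) else sumMul (t i) (t i)
  have hT : ∀ i, i ≠ m → T i = sumMul (t i) (t i) := fun i hi => if_neg hi
  have hTm : T m = sumMul (t m) (t (m + 1)) := if_pos rfl
  let x := sumSwap M
  have key := @sumMul_mul M _
  have hone := @sumMul_one M _
  have hxs := @sumSwap_mul M _
  have hxx := @sumSwap_sq M
  have hA : CoxeterA T (m + 1) := by
    refine ⟨fun i hi => ?_, fun i j hij hj => ?_, fun i hi => ?_⟩
    · by_cases him : i = m
      · subst him; rw [hTm, key, h.sq _ hi, hx, hone]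
      · rw [hT i him, key, h.sq _ hi, hone]
    · rw [hT i (by omega)]
      by_cases hjm : j = m
      · subst hjm; rw [hTm, key, key, h.far _ _ hij hj, hfar _ hij]
      · rw [hT j hjm, key, key, h.far _ _ hij hj]
    · rw [hT i (by omega)]
      by_cases hjm : i + 1 = m
      · subst hjm
        rw [hTm]; simp only [key]
        have := hbraid (by omega)
        rw [Nat.add_sub_cancel] at this
        rw [h.braid _ hi, this]
      · rw [hT _ hjm]; simp only [key]; rw [h.braid _ hi]
  -- The special relation says that `T_m` commutes with `x T_m x`, which has the coordinates of
  -- `T_m` exchanged; this is `hcomm` in both coordinates.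
  have hfin := (hA.coxeterB hxx (fun i hi => by rw [hT i (by omega), hxs]) (fun _ => by
    rw [Nat.add_sub_cancel, hTm, hxs, mul_assoc _ x x, hxx, mul_one, key, mul_assoc _ x, hxs,
      ← mul_assoc, key, mul_assoc _ x x, hxx, mul_one, hcomm])).finite_closure le_rfl
  have hinj : ∀ g ∈ Submonoid.closure (t '' Set.Iio (m + 2)),
      g ∈ (fun f : Function.End (M ⊕ M) => Sum.elim id id (f (Sum.inl 1))) ''
        (Submonoid.closure (revSeq x T (m + 1) '' Set.Iio (m + 1 + 1)) : Set _) := by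
    -- Only the first coordinate has to be `g`; it is recovered by evaluating at `inl 1`.
    intro g hg
    suffices hs : ∃ g', sumMul (g) (g') ∈
        Submonoid.closure (revSeq x T (m + 1) '' Set.Iio (m + 1 + 1)) by
      obtain ⟨g', hg'⟩ := hs
      exact ⟨_, hg', by simp [sumMul]⟩
    induction hg using Submonoid.closure_induction with
    | mem g hg =>
      obtain ⟨i, hi, rfl⟩ := hg
      by_cases him : i = m
      · subst him
        exact ⟨t (i + 1), by rw [← hTm]; exact closure_le_revSeq _ _ _ (Or.inr ⟨i, by omega, rfl⟩)⟩
      by_cases him' : i = m + 1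
      · subst him'
        refine ⟨t m, ?_⟩
        have : sumMul (t (m + 1)) (t m) = x * T m * x := by
          rw [hTm, hxs, mul_assoc, hxx, mul_one]
        rw [this]
        have h1 := closure_le_revSeq x T (m + 1) (Or.inl rfl)
        exact mul_mem (mul_mem h1 (closure_le_revSeq _ _ _ (Or.inr ⟨m, by omega, rfl⟩))) h1
      · refine ⟨t i, ?_⟩
        rw [← hT i him]
        exact closure_le_revSeq _ _ _ (Or.inr ⟨i, by have : i < m + 2 := hi; omega, rfl⟩)
    | one => exact ⟨1, by rw [hone]; exact one_mem _⟩
    | mul a b _ _ ha hb =>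
      obtain ⟨a', ha⟩ := ha
      obtain ⟨b', hb⟩ := hb
      exact ⟨a' * b', by rw [← key]; exact mul_mem ha hb⟩
  exact (hfin.image _).subset hinj

end Coxeter

end SpinDaHa

namespace SpinDaHa

/-! ### Reflections and divided differences -/

section Reflections

variable {n : ℕ}

/-- The reflection of `ℂⁿ` in the hyperplane orthogonal to a vector `α` with `α ⬝ α = 1`. -/
def refl (α v : Fin n → ℂ) : Fin n → ℂ := v - (2 * (v ⬝ᵥ α)) • α

theorem refl_add (α v w : Fin n → ℂ) : refl α (v + w) = refl α v + refl α w := by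
  ext i; simp [refl, add_dotProduct]; ring

theorem refl_smul (α : Fin n → ℂ) (c : ℂ) (v : Fin n → ℂ) : refl α (c • v) = c • refl α v := by
  ext i; simp [refl, smul_dotProduct]; ring

theorem refl_sub (α v w : Fin n → ℂ) : refl α (v - w) = refl α v - refl α w := by
  ext i; simp [refl, sub_dotProduct]; ring

theorem refl_neg_left (α v : Fin n → ℂ) : refl (-α) v = refl α v := by
  ext i; simp [refl, dotProduct_neg]

theorem refl_of_orthogonal {α v : Fin n → ℂ} (h : v ⬝ᵥ α = 0) : refl α v = v := by
  ext i; simp [refl, h]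

theorem refl_dotProduct_refl {α : Fin n → ℂ} (h : α ⬝ᵥ α = 1) (v w : Fin n → ℂ) :
    refl α v ⬝ᵥ refl α w = v ⬝ᵥ w := by
  simp only [refl, sub_dotProduct, dotProduct_sub, smul_dotProduct, dotProduct_smul, h, smul_eq_mul,
    dotProduct_comm α w]
  ring

theorem refl_refl {α : Fin n → ℂ} (h : α ⬝ᵥ α = 1) (v : Fin n → ℂ) : refl α (refl α v) = v := by
  ext i; simp [refl, sub_dotProduct, smul_dotProduct, h]; ring

theorem refl_conj {β : Fin n → ℂ} (h : β ⬝ᵥ β = 1) (α v : Fin n → ℂ) :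
    refl (refl β α) (refl β v) = refl β (refl α v) := by
  rw [refl, refl_dotProduct_refl h, refl.eq_1 α v, refl_sub, refl_smul]

/-- The linear form `∑ v_i X_i`. -/
def lin : (Fin n → ℂ) →ₗ[ℂ] MvPolynomial (Fin n) ℂ := Fintype.linearCombination ℂ X

theorem lin_single (i : Fin n) : lin (Pi.single i 1) = (X i : MvPolynomial (Fin n) ℂ) := by
  simp [lin, Fintype.linearCombination_apply_single]

theorem lin_apply (v : Fin n → ℂ) : lin v = ∑ i, v i • (X i : MvPolynomial (Fin n) ℂ) := rfl

theorem eq_sum_single (v : Fin n → ℂ) : v = ∑ i, v i • Pi.single i (1 : ℂ) := by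
  ext j; simp [Finset.sum_apply, Pi.single_apply]

theorem lin_ne_zero {v : Fin n → ℂ} (hv : v ≠ 0) : lin v ≠ 0 := by
  intro h
  refine hv (funext fun i => ?_)
  have := congrArg (coeff (Finsupp.single i 1)) h
  simpa [lin_apply, coeff_sum, coeff_X, Finsupp.single_left_inj] using this

theorem ne_zero_of_unit {α : Fin n → ℂ} (h : α ⬝ᵥ α = 1) : α ≠ 0 := by
  rintro rfl; simp at h

/-- The action of a reflection on polynomials. -/
def polyRefl (α : Fin n → ℂ) : MvPolynomial (Fin n) ℂ →ₐ[ℂ] MvPolynomial (Fin n) ℂ :=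
  aeval fun i => lin (refl α (Pi.single i 1))

theorem polyRefl_X (α : Fin n → ℂ) (i : Fin n) :
    polyRefl α (X i) = lin (refl α (Pi.single i 1)) := by simp [polyRefl]

theorem polyRefl_lin (α v : Fin n → ℂ) : polyRefl α (lin v) = lin (refl α v) := by
  have h1 : refl α v = ∑ i, v i • refl α (Pi.single i 1) := by
    let L : (Fin n → ℂ) →ₗ[ℂ] (Fin n → ℂ) := ⟨⟨refl α, refl_add α⟩, refl_smul α⟩
    have := congrArg L (eq_sum_single v)
    simp only [map_sum, map_smul] at this
    exact this
  rw [h1, lin_apply]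
  simp only [map_sum, map_smul, polyRefl_X]

theorem polyRefl_neg (α : Fin n → ℂ) : polyRefl (-α) = polyRefl α := by
  ext1 i; simp only [polyRefl_X, refl_neg_left]

theorem polyRefl_polyRefl {α : Fin n → ℂ} (h : α ⬝ᵥ α = 1) (f : MvPolynomial (Fin n) ℂ) :
    polyRefl α (polyRefl α f) = f := by
  have : (polyRefl α).comp (polyRefl α) = AlgHom.id ℂ _ := by
    ext1 i; simp only [AlgHom.comp_apply, polyRefl_X, polyRefl_lin, refl_refl h, lin_single,
      AlgHom.id_apply]
  exact DFunLike.congr_fun this f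

theorem polyRefl_conj {β : Fin n → ℂ} (h : β ⬝ᵥ β = 1) (α : Fin n → ℂ)
    (f : MvPolynomial (Fin n) ℂ) :
    polyRefl (refl β α) (polyRefl β f) = polyRefl β (polyRefl α f) := by
  have : (polyRefl (refl β α)).comp (polyRefl β) = (polyRefl β).comp (polyRefl α) := by
    ext1 i; simp only [AlgHom.comp_apply, polyRefl_X, polyRefl_lin, refl_conj h]
  exact DFunLike.congr_fun this f

/-- On a linear form, `v - s_α v` is a multiple of `α`; the general case follows since `f ↦ f - s_α
f` satisfies a twisted Leibniz rule. -/
theorem lin_dvd_sub_polyRefl (α : Fin n → ℂ) (f : MvPolynomial (Fin n) ℂ) :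
    lin α ∣ f - polyRefl α f := by
  induction f using MvPolynomial.induction_on with
  | C a => simp [polyRefl]
  | add p q hp hq =>
    rw [map_add, add_sub_add_comm]; exact dvd_add hp hq
  | mul_X p i hp =>
    have h1 : lin α ∣ X i - polyRefl α (X i) := by
      rw [← lin_single, polyRefl_lin, refl, map_sub, sub_sub_cancel, map_smul]
      exact dvd_smul_of_dvd _ dvd_rfl
    have : p * X i - polyRefl α (p * X i) =
        p * (X i - polyRefl α (X i)) + (p - polyRefl α p) * polyRefl α (X i) := by
      rw [map_mul]; ring
    rw [this]
    exact dvd_add (h1.mul_left _) (hp.mul_right _)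

/-- The divided difference operator `f ↦ (f - s_α f) / α`, and `0` if `α = 0`. -/
def divDiff (α : Fin n → ℂ) : MvPolynomial (Fin n) ℂ →ₗ[ℂ] MvPolynomial (Fin n) ℂ :=
  open Classical in
  if h : α = 0 then 0 else
    { toFun := fun f => (lin_dvd_sub_polyRefl α f).choose
      map_add' := fun f g => mul_left_cancel₀ (lin_ne_zero h) (by
        rw [mul_add, ← (lin_dvd_sub_polyRefl α f).choose_spec,
          ← (lin_dvd_sub_polyRefl α g).choose_spec,
          ← (lin_dvd_sub_polyRefl α (f + g)).choose_spec, map_add]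
        ring)
      map_smul' := fun c f => mul_left_cancel₀ (lin_ne_zero h) (by
        rw [RingHom.id_apply, mul_smul_comm, ← (lin_dvd_sub_polyRefl α f).choose_spec,
          ← (lin_dvd_sub_polyRefl α (c • f)).choose_spec, map_smul, smul_sub]) }

theorem lin_mul_divDiff {α : Fin n → ℂ} (h : α ≠ 0) (f : MvPolynomial (Fin n) ℂ) :
    lin α * divDiff α f = f - polyRefl α f := by
  rw [divDiff, dif_neg h]
  exact (lin_dvd_sub_polyRefl α f).choose_spec.symm

theorem divDiff_eq_of_mul {α : Fin n → ℂ} (h : α ≠ 0) {f g : MvPolynomial (Fin n) ℂ}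
    (hg : lin α * g = f - polyRefl α f) : divDiff α f = g :=
  mul_left_cancel₀ (lin_ne_zero h) (by rw [lin_mul_divDiff h, hg])

theorem divDiff_of_invariant {α : Fin n → ℂ} (h : α ≠ 0) {f : MvPolynomial (Fin n) ℂ}
    (hf : polyRefl α f = f) : divDiff α f = 0 :=
  divDiff_eq_of_mul h (by rw [hf]; simp)

theorem divDiff_C {α : Fin n → ℂ} (h : α ≠ 0) (c : ℂ) : divDiff α (C c) = 0 :=
  divDiff_of_invariant h (AlgHom.commutes (polyRefl α) c)

theorem divDiff_mul {α : Fin n → ℂ} (h : α ≠ 0) (f g : MvPolynomial (Fin n) ℂ) :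
    divDiff α (f * g) = f * divDiff α g + divDiff α f * polyRefl α g := by
  refine divDiff_eq_of_mul h ?_
  have h1 := lin_mul_divDiff h f
  have h2 := lin_mul_divDiff h g
  rw [mul_add, ← mul_assoc, ← mul_assoc, h1, mul_comm _ f, mul_assoc, h2, map_mul]
  ring

theorem divDiff_lin {α : Fin n → ℂ} (h : α ≠ 0) (v : Fin n → ℂ) :
    divDiff α (lin v) = C (2 * (v ⬝ᵥ α)) := by
  refine divDiff_eq_of_mul h ?_
  rw [polyRefl_lin, refl, map_sub, sub_sub_cancel, map_smul, smul_eq_C_mul, mul_comm]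

theorem divDiff_conj {β : Fin n → ℂ} (h : β ⬝ᵥ β = 1) {α : Fin n → ℂ} (hα : α ≠ 0)
    (f : MvPolynomial (Fin n) ℂ) :
    divDiff (refl β α) (polyRefl β f) = polyRefl β (divDiff α f) := by
  refine divDiff_eq_of_mul ?_ ?_
  · intro h0
    apply hα
    rw [← refl_refl h α, h0]
    simp [refl]
  · rw [← polyRefl_lin, ← map_mul, lin_mul_divDiff hα, map_sub, polyRefl_conj h]

theorem divDiff_neg {α : Fin n → ℂ} (hα : α ≠ 0) (f : MvPolynomial (Fin n) ℂ) :
    divDiff (-α) f = -divDiff α f := by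
  refine divDiff_eq_of_mul (neg_ne_zero.2 hα) ?_
  rw [map_neg, neg_mul_neg, lin_mul_divDiff hα, polyRefl_neg]

/-! ### Reflections that permute the coordinates up to sign -/

/-- The reflection in `α` permutes the coordinate vectors up to signs. -/
structure IsSigned (α : Fin n → ℂ) (σ : Equiv.Perm (Fin n)) (ε : Fin n → ℂ) : Prop where
  unit : α ⬝ᵥ α = 1
  sq : ∀ k, ε k * ε k = 1
  refl_single : ∀ k, refl α (Pi.single k 1) = ε k • Pi.single (σ k) 1

theorem IsSigned.polyRefl_X {α : Fin n → ℂ} {σ : Equiv.Perm (Fin n)} {ε : Fin n → ℂ}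
    (h : IsSigned α σ ε) (k : Fin n) : polyRefl α (X k) = ε k • X (σ k) := by
  rw [SpinDaHa.polyRefl_X, h.refl_single, map_smul, lin_single]

/-- Applying the reflection twice to `e_k` returns `e_k`; compare coordinates. -/
theorem IsSigned.apply_apply {α : Fin n → ℂ} {σ : Equiv.Perm (Fin n)} {ε : Fin n → ℂ}
    (h : IsSigned α σ ε) (k : Fin n) : σ (σ k) = k ∧ ε (σ k) * ε k = 1 := by
  have h1 := refl_refl h.unit (Pi.single k 1)
  rw [h.refl_single, refl_smul, h.refl_single, smul_smul] at h1
  have h2 := congrFun h1 k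
  have h3 := congrFun h1 (σ (σ k))
  have h4 : σ (σ k) = k := by
    by_contra hne
    simp [hne] at h3
    have := h.sq k
    have h5 := h.sq (σ k)
    rcases h3 with h3 | h3 <;> simp [h3] at this h5
  refine ⟨h4, ?_⟩
  rw [h4] at h2
  simpa [mul_comm] using h2

theorem IsSigned.neg {α : Fin n → ℂ} {σ : Equiv.Perm (Fin n)} {ε : Fin n → ℂ}
    (h : IsSigned α σ ε) : IsSigned (-α) σ ε :=
  ⟨by simp [h.unit], h.sq, fun k => by rw [refl_neg_left, h.refl_single]⟩

theorem IsSigned.conj {α β : Fin n → ℂ} {σ τ : Equiv.Perm (Fin n)} {ε δ : Fin n → ℂ}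
    (hβ : IsSigned β τ δ) (h : IsSigned α σ ε) :
    IsSigned (refl β α) (τ * σ * τ) (fun k => δ k * ε (τ k) * δ (σ (τ k))) := by
  refine ⟨by rw [refl_dotProduct_refl hβ.unit, h.unit], fun k => ?_, fun k => ?_⟩
  · linear_combination (ε (τ k) * ε (τ k) * (δ (σ (τ k)) * δ (σ (τ k)))) * hβ.sq k +
      (δ (σ (τ k)) * δ (σ (τ k))) * h.sq (τ k) + hβ.sq (σ (τ k))
  · have h1 := refl_conj hβ.unit α (refl β (Pi.single k 1))
    rw [refl_refl hβ.unit] at h1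
    rw [h1, hβ.refl_single, refl_smul, h.refl_single, refl_smul, refl_smul, hβ.refl_single,
      smul_smul, smul_smul, mul_assoc]
    rfl

/-- `1 / √2`. -/
def rt : ℂ := ((Real.sqrt 2)⁻¹ : ℝ)

theorem rt_mul_rt : rt * rt = 1 / 2 := by
  rw [rt, ← Complex.ofReal_mul, ← mul_inv, Real.mul_self_sqrt (by norm_num)]
  norm_num

/-- The unit vector `(e_i - e_j) / √2`. -/
def minusRoot (i j : Fin n) : Fin n → ℂ := rt • (Pi.single i 1 - Pi.single j 1)

/-- The unit vector `(e_i + e_j) / √2`. -/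
def plusRoot (i j : Fin n) : Fin n → ℂ := rt • (Pi.single i 1 + Pi.single j 1)

/-- The unit vector `e_i`. -/
def shortRoot (i : Fin n) : Fin n → ℂ := Pi.single i 1

theorem minusRoot_swap (i j : Fin n) : minusRoot j i = -minusRoot i j := by
  rw [minusRoot, minusRoot, ← smul_neg, neg_sub]

theorem plusRoot_swap (i j : Fin n) : plusRoot j i = plusRoot i j := by
  rw [plusRoot, plusRoot, add_comm]

/-- The signs of the reflection in `e_i + e_j`, or in `e_i` if `i = j`. -/
def sgn (i j k : Fin n) : ℂ := if k = i ∨ k = j then -1 else 1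

theorem sgn_sq (i j k : Fin n) : sgn i j k * sgn i j k = 1 := by
  unfold sgn; split_ifs <;> norm_num

theorem isSigned_minusRoot {i j : Fin n} (hij : i ≠ j) :
    IsSigned (minusRoot i j) (Equiv.swap i j) 1 := by
  refine ⟨?_, by simp, fun k => ?_⟩
  · simp [minusRoot, hij, hij.symm]
    linear_combination 2 * rt_mul_rt
  · by_cases hi : k = i
    · subst hi
      ext l
      simp [refl, minusRoot, hij]
      linear_combination (-2 * ((Pi.single k 1 : Fin n → ℂ) l - (Pi.single j 1 : Fin n → ℂ) l)) *
        rt_mul_rt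
    · by_cases hj : k = j
      · subst hj
        ext l
        simp [refl, minusRoot, hij]
        linear_combination (2 * ((Pi.single i 1 : Fin n → ℂ) l - (Pi.single k 1 : Fin n → ℂ) l)) *
          rt_mul_rt
      · rw [Equiv.swap_apply_of_ne_of_ne hi hj]
        ext l
        simp [refl, minusRoot, hi, hj]

theorem isSigned_plusRoot {i j : Fin n} (hij : i ≠ j) :
    IsSigned (plusRoot i j) (Equiv.swap i j) (sgn i j) := by
  refine ⟨?_, sgn_sq i j, fun k => ?_⟩
  · simp [plusRoot, hij, hij.symm]
    linear_combination 2 * rt_mul_rt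
  · by_cases hi : k = i
    · subst hi
      ext l
      simp [refl, plusRoot, hij, sgn]
      linear_combination (-2 * ((Pi.single k 1 : Fin n → ℂ) l + (Pi.single j 1 : Fin n → ℂ) l)) *
        rt_mul_rt
    · by_cases hj : k = j
      · subst hj
        ext l
        simp [refl, plusRoot, hij, sgn]
        linear_combination (-2 * ((Pi.single i 1 : Fin n → ℂ) l + (Pi.single k 1 : Fin n → ℂ) l)) *
          rt_mul_rt
      · rw [Equiv.swap_apply_of_ne_of_ne hi hj]
        ext l
        simp [refl, plusRoot, hi, hj, sgn]

theorem isSigned_shortRoot (i : Fin n) : IsSigned (shortRoot i) 1 (sgn i i) := by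
  refine ⟨by simp [shortRoot], sgn_sq i i, fun k => ?_⟩
  by_cases hi : k = i
  · subst hi
    ext l
    simp [refl, shortRoot, sgn]
    ring
  · ext l
    simp [refl, shortRoot, hi, sgn]

end Reflections

end SpinDaHa

namespace SpinDaHa

/-! ### Dunkl operators -/

open scoped TensorProduct

/-- Odd reflections `θ_α` and anticommuting elements `η_i` permuted by them up to sign: a model of
the spin double affine Hecke algebra without the `y_i`, at parameters `0`. -/
structure SpinModel (n : ℕ) (E : Type) [Ring E] [Algebra ℂ E] where
  θ : (Fin n → ℂ) → E
  η : Fin n → E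
  θ_neg : ∀ α, θ (-α) = -θ α
  θ_sq : ∀ α, α ⬝ᵥ α = 1 → θ α * θ α = 1
  θ_mul : ∀ α β, α ⬝ᵥ α = 1 → θ α * θ β = -(θ (refl α β) * θ α)
  θ_η : ∀ α σ ε, IsSigned α σ ε → ∀ k, θ α * η k = -(η (σ k) * θ α)
  η_mul : ∀ i j, i ≠ j → η i * η j = -(η j * η i)

section Operators

variable {n : ℕ} {E : Type} [Ring E] [Algebra ℂ E]

/-- The algebra of operators on `ℂ[y] ⊗ E`. -/
def Op (n : ℕ) (E : Type) [Ring E] [Algebra ℂ E] : Type :=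
  Module.End ℂ (MvPolynomial (Fin n) ℂ ⊗[ℂ] E)

instance : Ring (Op n E) := inferInstanceAs (Ring (Module.End ℂ (MvPolynomial (Fin n) ℂ ⊗[ℂ] E)))

instance : Algebra ℂ (Op n E) :=
  inferInstanceAs (Algebra ℂ (Module.End ℂ (MvPolynomial (Fin n) ℂ ⊗[ℂ] E)))

/-- The evaluation of operators at a vector. -/
def Op.eval (x : MvPolynomial (Fin n) ℂ ⊗[ℂ] E) : Op n E →ₗ[ℂ] MvPolynomial (Fin n) ℂ ⊗[ℂ] E :=
  LinearMap.applyₗ (R := ℂ) (M := MvPolynomial (Fin n) ℂ ⊗[ℂ] E)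
    (M₂ := MvPolynomial (Fin n) ℂ ⊗[ℂ] E) x

theorem Op.eval_mul (x : MvPolynomial (Fin n) ℂ ⊗[ℂ] E) (f g : Op n E) :
    Op.eval x (f * g) = Op.eval (Op.eval x g) f := rfl

theorem Op.eval_add (x y : MvPolynomial (Fin n) ℂ ⊗[ℂ] E) (f : Op n E) :
    Op.eval (x + y) f = Op.eval x f + Op.eval y f :=
  LinearMap.map_add (f : MvPolynomial (Fin n) ℂ ⊗[ℂ] E →ₗ[ℂ] _) x y

theorem Op.eval_zero (f : Op n E) : Op.eval 0 f = 0 :=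
  LinearMap.map_zero (f : MvPolynomial (Fin n) ℂ ⊗[ℂ] E →ₗ[ℂ] _)

theorem Op.ext {f g : Op n E} (h : ∀ p e, Op.eval (p ⊗ₜ[ℂ] e) f = Op.eval (p ⊗ₜ[ℂ] e) g) : f = g :=
  TensorProduct.ext' h

/-- The operator on `ℂ[y] ⊗ E` given by an operator on `ℂ[y]` and a left multiplication. -/
def op (f : Module.End ℂ (MvPolynomial (Fin n) ℂ)) (e : E) : Op n E :=
  TensorProduct.map f (LinearMap.mulLeft ℂ e)

theorem op_tmul (f : Module.End ℂ (MvPolynomial (Fin n) ℂ)) (e : E) (p : MvPolynomial (Fin n) ℂ)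
    (e' : E) : Op.eval (p ⊗ₜ[ℂ] e') (op f e) = f p ⊗ₜ[ℂ] (e * e') := rfl

theorem op_mul_op (f g : Module.End ℂ (MvPolynomial (Fin n) ℂ)) (e e' : E) :
    op f e * op g e' = op (f * g) (e * e') := by
  refine Op.ext fun p x => ?_
  simp only [Op.eval_mul, op_tmul, mul_assoc, Module.End.mul_apply]

theorem Op.eval_one (x : MvPolynomial (Fin n) ℂ ⊗[ℂ] E) : Op.eval x 1 = x := rfl

theorem op_one : op (1 : Module.End ℂ (MvPolynomial (Fin n) ℂ)) (1 : E) = 1 := by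
  refine Op.ext fun p x => ?_
  simp [op_tmul, Op.eval_one]

theorem op_smul_right (c : ℂ) (f : Module.End ℂ (MvPolynomial (Fin n) ℂ)) (e : E) :
    op f (c • e) = c • op f e := by
  refine Op.ext fun p x => ?_
  rw [op_tmul, map_smul, op_tmul, smul_mul_assoc, TensorProduct.tmul_smul]

theorem op_smul_left (c : ℂ) (f : Module.End ℂ (MvPolynomial (Fin n) ℂ)) (e : E) :
    op (c • f) e = c • op f e := by
  refine Op.ext fun p x => ?_
  rw [op_tmul, map_smul, op_tmul, LinearMap.smul_apply, TensorProduct.smul_tmul']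

theorem op_neg_right (f : Module.End ℂ (MvPolynomial (Fin n) ℂ)) (e : E) :
    op f (-e) = -op f e := by
  rw [← neg_one_smul ℂ e, op_smul_right, neg_one_smul]

theorem op_neg_left (f : Module.End ℂ (MvPolynomial (Fin n) ℂ)) (e : E) :
    op (-f) e = -op f e := by
  rw [← neg_one_smul ℂ f, op_smul_left, neg_one_smul]

theorem op_add_left (f g : Module.End ℂ (MvPolynomial (Fin n) ℂ)) (e : E) :
    op (f + g) e = op f e + op g e := by
  refine Op.ext fun p x => ?_
  rw [op_tmul, map_add, op_tmul, op_tmul, LinearMap.add_apply, TensorProduct.add_tmul]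

theorem op_sub_left (f g : Module.End ℂ (MvPolynomial (Fin n) ℂ)) (e : E) :
    op (f - g) e = op f e - op g e := by
  rw [sub_eq_add_neg, op_add_left, op_neg_left, ← sub_eq_add_neg]

/-! ### Multiplication, reflection and divided difference operators -/

/-- Multiplication by a polynomial. -/
def yOp (E : Type) [Ring E] [Algebra ℂ E] (p : MvPolynomial (Fin n) ℂ) :
    Op n E :=
  op (LinearMap.mulLeft ℂ p) 1

theorem yOp_comm (p q : MvPolynomial (Fin n) ℂ) : yOp E p * yOp E q = yOp E q * yOp E p := by
  simp only [yOp, op_mul_op]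
  congr 1
  refine LinearMap.ext fun r => ?_
  simp [mul_left_comm]

theorem yOp_smul (c : ℂ) (p : MvPolynomial (Fin n) ℂ) : yOp E (c • p) = c • yOp E p := by
  rw [yOp, yOp, ← op_smul_left]
  congr 1
  refine LinearMap.ext fun r => ?_
  simp

namespace SpinModel

variable (M : SpinModel n E)

/-- The operator of the odd reflection in `α`. -/
def reflOp (α : Fin n → ℂ) : Op n E :=
  op (polyRefl α).toLinearMap (M.θ α)

/-- The divided difference operator of `α`, combined with the odd reflection `θ_α`. -/
def diffOp (α : Fin n → ℂ) : Op n E :=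
  op (divDiff α) (M.θ α)

theorem reflOp_neg (α : Fin n → ℂ) : M.reflOp (-α) = -M.reflOp α := by
  rw [reflOp, reflOp, polyRefl_neg, M.θ_neg, op_neg_right]

/-- Both `divDiff α` and `θ α` are odd in `α`, so the signs cancel. Hence the Dunkl operators do not
depend on a choice of positive roots. -/
theorem diffOp_neg {α : Fin n → ℂ} (h : α ≠ 0) : M.diffOp (-α) = M.diffOp α := by
  have : divDiff (-α) = -divDiff α := LinearMap.ext (divDiff_neg h)
  rw [diffOp, diffOp, this, M.θ_neg, op_neg_right, op_neg_left, neg_neg]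

theorem diffOp_sign_smul {α : Fin n → ℂ} (h : α ≠ 0) {c : ℂ} (hc : c * c = 1) :
    M.diffOp (c • α) = M.diffOp α := by
  rcases mul_self_eq_one_iff.1 hc with rfl | rfl
  · rw [one_smul]
  · rw [neg_one_smul, M.diffOp_neg h]

theorem reflOp_sq {α : Fin n → ℂ} (h : α ⬝ᵥ α = 1) : M.reflOp α * M.reflOp α = 1 := by
  rw [reflOp, op_mul_op, M.θ_sq α h, ← op_one]
  congr 1
  refine LinearMap.ext fun f => ?_
  simp [polyRefl_polyRefl h]

theorem reflOp_mul {α : Fin n → ℂ} (h : α ⬝ᵥ α = 1) (β : Fin n → ℂ) :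
    M.reflOp α * M.reflOp β = -(M.reflOp (refl α β) * M.reflOp α) := by
  have e : (polyRefl α).toLinearMap * (polyRefl β).toLinearMap =
      (polyRefl (refl α β)).toLinearMap * (polyRefl α).toLinearMap :=
    LinearMap.ext fun f => (polyRefl_conj h β f).symm
  rw [reflOp, reflOp, reflOp, op_mul_op, op_mul_op, M.θ_mul α β h, op_neg_right, e]

theorem reflOp_conj {α : Fin n → ℂ} (h : α ⬝ᵥ α = 1) (β : Fin n → ℂ) :
    M.reflOp α * M.reflOp β * M.reflOp α = -M.reflOp (refl α β) := by
  rw [M.reflOp_mul h, neg_mul, mul_assoc, M.reflOp_sq h, mul_one]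

theorem reflOp_mul_yOp {α : Fin n → ℂ} (p : MvPolynomial (Fin n) ℂ) :
    M.reflOp α * yOp E p = yOp E (polyRefl α p) * M.reflOp α := by
  rw [reflOp, yOp, yOp, op_mul_op, op_mul_op, mul_one, one_mul]
  congr 1
  refine LinearMap.ext fun f => ?_
  simp

theorem reflOp_mul_diffOp {α : Fin n → ℂ} (h : α ⬝ᵥ α = 1) {β : Fin n → ℂ} (hβ : β ≠ 0) :
    M.reflOp α * M.diffOp β = -(M.diffOp (refl α β) * M.reflOp α) := by
  have e : (polyRefl α).toLinearMap * divDiff β =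
      divDiff (refl α β) * (polyRefl α).toLinearMap :=
    LinearMap.ext fun f => (divDiff_conj h hβ f).symm
  rw [reflOp, diffOp, diffOp, op_mul_op, op_mul_op, M.θ_mul α β h, op_neg_right, e]

/-- By the twisted Leibniz rule the commutator is `-∂_α(v) s_α`, and `∂_α(v) = 2 (v ⬝ α)` is a
constant. -/
theorem yOp_mul_diffOp {α : Fin n → ℂ} (h : α ≠ 0) (v : Fin n → ℂ) :
    yOp E (lin v) * M.diffOp α - M.diffOp α * yOp E (lin v) = -((2 * (v ⬝ᵥ α)) • M.reflOp α) := by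
  rw [yOp, diffOp, reflOp, op_mul_op, op_mul_op, mul_one, one_mul, ← op_sub_left, ← op_smul_left,
    ← op_neg_left]
  congr 1
  refine LinearMap.ext fun f => ?_
  simp [divDiff_mul h, divDiff_lin h, smul_eq_C_mul]

/-- Multiplication by `η_i`. -/
def etaOp (i : Fin n) : Op n E := op 1 (M.η i)

theorem reflOp_mul_etaOp {α : Fin n → ℂ} {σ : Equiv.Perm (Fin n)} {ε : Fin n → ℂ}
    (h : IsSigned α σ ε) (k : Fin n) :
    M.reflOp α * M.etaOp k = -(M.etaOp (σ k) * M.reflOp α) := by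
  rw [reflOp, etaOp, etaOp, op_mul_op, op_mul_op, M.θ_η α σ ε h, op_neg_right, mul_one, one_mul]

theorem yOp_mul_etaOp (p : MvPolynomial (Fin n) ℂ) (i : Fin n) :
    yOp E p * M.etaOp i = M.etaOp i * yOp E p := by
  rw [yOp, etaOp, op_mul_op, op_mul_op, mul_one, one_mul, mul_one, one_mul]

variable (u a b : ℂ)

/-- The contribution of the roots `e_i ± e_k` to the Dunkl operator of `i`. -/
def pairOp (i k : Fin n) : Op n E :=
  (u * rt) • M.diffOp (minusRoot i k) + (a * rt) • M.diffOp (plusRoot i k)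

/-- The Dunkl operator of `i`, with parameters `u`, `a`, `b` for the roots `e_i - e_k`, `e_i + e_k`
and `e_i`. -/
def xiOp (i : Fin n) : Op n E :=
  M.etaOp i - ∑ k ∈ Finset.univ.erase i, M.pairOp u a i k - (b / 2) • M.diffOp (shortRoot i)

/-- A signed permutation with `ε i = -ε k` carries `e_i - e_k` to a root of the form `e_i + e_k` and
conversely. The parameters `u` and `a` must then agree, unless the signs are trivial; this is the
hypothesis `hε`. -/
theorem reflOp_mul_pairOp {α : Fin n → ℂ} {σ : Equiv.Perm (Fin n)} {ε : Fin n → ℂ}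
    (h : IsSigned α σ ε) (hε : a = u ∨ ∀ k, ε k = 1) {i k : Fin n} (hik : i ≠ k) :
    M.reflOp α * M.pairOp u a i k = -(M.pairOp u a (σ i) (σ k) * M.reflOp α) := by
  have hσ : σ i ≠ σ k := fun e => hik (σ.injective e)
  have hm := ne_zero_of_unit (isSigned_minusRoot hik).unit
  have hp := ne_zero_of_unit (isSigned_plusRoot hik).unit
  have hm' := ne_zero_of_unit (isSigned_minusRoot hσ).unit
  have hp' := ne_zero_of_unit (isSigned_plusRoot hσ).unit
  rw [pairOp, pairOp, mul_add, mul_smul_comm, mul_smul_comm, M.reflOp_mul_diffOp h.unit hm,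
    M.reflOp_mul_diffOp h.unit hp, add_mul, smul_mul_assoc, smul_mul_assoc, smul_neg, smul_neg,
    ← neg_add]
  congr 1
  have e1 : refl α (minusRoot i k) = rt • (ε i • Pi.single (σ i) 1 - ε k • Pi.single (σ k) 1) := by
    rw [minusRoot, refl_smul, refl_sub, h.refl_single, h.refl_single]
  have e2 : refl α (plusRoot i k) = rt • (ε i • Pi.single (σ i) 1 + ε k • Pi.single (σ k) 1) := by
    rw [plusRoot, refl_smul, refl_add, h.refl_single, h.refl_single]
  have hcase : ε k = ε i ∨ (ε k = -ε i ∧ a = u) := by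
    rcases hε with hε | hε
    · rcases mul_self_eq_one_iff.1 (h.sq i) with h1 | h1 <;>
      rcases mul_self_eq_one_iff.1 (h.sq k) with h2 | h2 <;> simp [h1, h2, hε]
    · exact Or.inl (by rw [hε, hε])
  rcases hcase with hk | ⟨hk, rfl⟩
  · have e1' : refl α (minusRoot i k) = ε i • minusRoot (σ i) (σ k) := by
      rw [e1, hk, minusRoot, smul_comm (ε i), smul_sub (ε i)]
    have e2' : refl α (plusRoot i k) = ε i • plusRoot (σ i) (σ k) := by
      rw [e2, hk, plusRoot, smul_comm (ε i), smul_add (ε i)]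
    rw [e1', e2', M.diffOp_sign_smul hm' (h.sq i), M.diffOp_sign_smul hp' (h.sq i)]
  · have e1' : refl α (minusRoot i k) = ε i • plusRoot (σ i) (σ k) := by
      rw [e1, hk, plusRoot, smul_comm (ε i), smul_add (ε i), neg_smul, sub_neg_eq_add]
    have e2' : refl α (plusRoot i k) = ε i • minusRoot (σ i) (σ k) := by
      rw [e2, hk, minusRoot, smul_comm (ε i), smul_sub (ε i), neg_smul, sub_eq_add_neg]
    rw [e1', e2', M.diffOp_sign_smul hm' (h.sq i), M.diffOp_sign_smul hp' (h.sq i), add_comm]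

theorem reflOp_mul_xiOp {α : Fin n → ℂ} {σ : Equiv.Perm (Fin n)} {ε : Fin n → ℂ}
    (h : IsSigned α σ ε) (hε : a = u ∨ ∀ k, ε k = 1) (i : Fin n) :
    M.reflOp α * M.xiOp u a b i = -(M.xiOp u a b (σ i) * M.reflOp α) := by
  have hs := ne_zero_of_unit (isSigned_shortRoot i).unit
  have hs' := ne_zero_of_unit (isSigned_shortRoot (σ i)).unit
  have e1 : refl α (shortRoot i) = ε i • shortRoot (σ i) := h.refl_single i
  have e2 : ∑ k ∈ Finset.univ.erase (σ i), M.pairOp u a (σ i) k =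
      ∑ k ∈ Finset.univ.erase i, M.pairOp u a (σ i) (σ k) := by
    symm
    refine Finset.sum_equiv σ (fun k => ?_) (fun k _ => rfl)
    simp
  have e3 : ∑ k ∈ Finset.univ.erase i, M.reflOp α * M.pairOp u a i k =
      ∑ k ∈ Finset.univ.erase i, -(M.pairOp u a (σ i) (σ k) * M.reflOp α) :=
    Finset.sum_congr rfl fun k hk =>
      M.reflOp_mul_pairOp u a h hε (Finset.ne_of_mem_erase hk).symm
  rw [xiOp, xiOp, e2, mul_sub, mul_sub, sub_mul, sub_mul, Finset.mul_sum, Finset.sum_mul, e3,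
    M.reflOp_mul_etaOp h, mul_smul_comm, M.reflOp_mul_diffOp h.unit hs, e1,
    M.diffOp_sign_smul hs' (h.sq i), smul_mul_assoc, Finset.sum_neg_distrib, smul_neg]
  abel

theorem yOp_mul_xiOp (v : Fin n → ℂ) (i : Fin n) :
    yOp E (lin v) * M.xiOp u a b i - M.xiOp u a b i * yOp E (lin v) =
      ∑ k ∈ Finset.univ.erase i, ((u * (v i - v k)) • M.reflOp (minusRoot i k) +
        (a * (v i + v k)) • M.reflOp (plusRoot i k)) + (b * v i) • M.reflOp (shortRoot i) := by
  have hs := ne_zero_of_unit (isSigned_shortRoot i).unit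
  have h1 : ∀ k ∈ Finset.univ.erase i,
      yOp E (lin v) * M.pairOp u a i k - M.pairOp u a i k * yOp E (lin v) =
      -((u * (v i - v k)) • M.reflOp (minusRoot i k) +
        (a * (v i + v k)) • M.reflOp (plusRoot i k)) := by
    intro k hk
    have hik : i ≠ k := (Finset.ne_of_mem_erase hk).symm
    have hm := M.yOp_mul_diffOp (ne_zero_of_unit (isSigned_minusRoot hik).unit) v
    have hp := M.yOp_mul_diffOp (ne_zero_of_unit (isSigned_plusRoot hik).unit) v
    -- The weights `u * rt` and `a * rt` compensate for unit roots: the commutator with `v` brings a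
    -- factor `2 * rt`, and `2 * rt * rt = 1`. For `e_i` the factor is `2`, whence `b / 2`.
    have c1 : u * (v i - v k) = (u * rt) * (2 * (v ⬝ᵥ minusRoot i k)) := by
      simp [minusRoot]
      linear_combination (-2 * u * (v i - v k)) * rt_mul_rt
    have c2 : a * (v i + v k) = (a * rt) * (2 * (v ⬝ᵥ plusRoot i k)) := by
      simp [plusRoot, dotProduct_add]
      linear_combination (-2 * a * (v i + v k)) * rt_mul_rt
    rw [c1, c2, mul_smul (u * rt), mul_smul (a * rt), neg_add, ← smul_neg (u * rt),
      ← smul_neg (a * rt), ← hm, ← hp, pairOp]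
    simp only [mul_add, add_mul, mul_smul_comm, smul_mul_assoc, smul_sub]
    abel
  have h2 := M.yOp_mul_diffOp hs v
  have c3 : b * v i = (b / 2) * (2 * (v ⬝ᵥ shortRoot i)) := by
    simp [shortRoot]; ring
  have h3 := Finset.sum_congr rfl h1
  rw [Finset.sum_neg_distrib, ← neg_eq_iff_eq_neg] at h3
  rw [c3, mul_smul, ← h3, ← neg_neg ((2 * _) • _), ← h2, xiOp, mul_sub, mul_sub, sub_mul, sub_mul,
    Finset.sum_sub_distrib, Finset.mul_sum, Finset.sum_mul, M.yOp_mul_etaOp, smul_neg, smul_sub,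
    mul_smul_comm, smul_mul_assoc]
  abel

theorem reflOp_anticommutator {α : Fin n → ℂ} {σ : Equiv.Perm (Fin n)} {ε : Fin n → ℂ}
    (h : IsSigned α σ ε) (hε : a = u ∨ ∀ k, ε k = 1) (i : Fin n) :
    M.reflOp α * M.xiOp u a b i + M.xiOp u a b i * M.reflOp α =
      (M.xiOp u a b i - M.xiOp u a b (σ i)) * M.reflOp α := by
  rw [M.reflOp_mul_xiOp u a b h hε, sub_mul]
  abel

/-- The bracket `[v, ξ_i]` is a sum of odd reflections. An odd reflection with permutation `σ` has
anticommutator `(ξ_j - ξ_{σ j}) θ` with `ξ_j`, so only those with `σ j ≠ j` survive, namely those in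
`e_i - e_j` and `e_i + e_j`. -/
theorem anticommutator_xiOp (hab : a = u ∨ (a = 0 ∧ b = 0)) (v : Fin n → ℂ) {i j : Fin n}
    (hij : i ≠ j) :
    (yOp E (lin v) * M.xiOp u a b i - M.xiOp u a b i * yOp E (lin v)) * M.xiOp u a b j +
      M.xiOp u a b j * (yOp E (lin v) * M.xiOp u a b i - M.xiOp u a b i * yOp E (lin v)) =
    (M.xiOp u a b j - M.xiOp u a b i) * ((u * (v i - v j)) • M.reflOp (minusRoot i j) +
        (a * (v i + v j)) • M.reflOp (plusRoot i j)) := by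
  have hm : ∀ k ≠ i, M.reflOp (minusRoot i k) * M.xiOp u a b j +
      M.xiOp u a b j * M.reflOp (minusRoot i k) =
      (M.xiOp u a b j - M.xiOp u a b (Equiv.swap i k j)) * M.reflOp (minusRoot i k) := fun k hk =>
    M.reflOp_anticommutator u a b (isSigned_minusRoot hk.symm) (Or.inr fun _ => rfl) j
  -- The coefficient is kept because in the case `a = 0` the reflection in `e_i + e_k` is not known
  -- to permute the `ξ_j`.
  have hp : ∀ (c : ℂ), ∀ k ≠ i, (a * c) • (M.reflOp (plusRoot i k) * M.xiOp u a b j) +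
      (a * c) • (M.xiOp u a b j * M.reflOp (plusRoot i k)) =
      (a * c) • ((M.xiOp u a b j - M.xiOp u a b (Equiv.swap i k j)) *
        M.reflOp (plusRoot i k)) := by
    intro c k hk
    rcases hab with h | ⟨h, -⟩
    · rw [← smul_add, M.reflOp_anticommutator u a b (isSigned_plusRoot hk.symm) (Or.inl h) j]
    · simp [h]
  have hs : (b * v i) • (M.reflOp (shortRoot i) * M.xiOp u a b j) +
      (b * v i) • (M.xiOp u a b j * M.reflOp (shortRoot i)) = 0 := by
    rcases hab with h | ⟨-, h⟩
    · rw [← smul_add, M.reflOp_anticommutator u a b (isSigned_shortRoot i) (Or.inl h) j]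
      simp
    · simp [h]
  have hterm : ∀ k ∈ Finset.univ.erase i,
      ((u * (v i - v k)) • M.reflOp (minusRoot i k) +
        (a * (v i + v k)) • M.reflOp (plusRoot i k)) * M.xiOp u a b j +
      M.xiOp u a b j * ((u * (v i - v k)) • M.reflOp (minusRoot i k) +
        (a * (v i + v k)) • M.reflOp (plusRoot i k)) =
      (M.xiOp u a b j - M.xiOp u a b (Equiv.swap i k j)) *
        ((u * (v i - v k)) • M.reflOp (minusRoot i k) +
        (a * (v i + v k)) • M.reflOp (plusRoot i k)) := by
    intro k hk
    have hki := Finset.ne_of_mem_erase hk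
    have hp' := hp (v i + v k) k hki
    generalize a * (v i + v k) = c at hp' ⊢
    simp only [mul_add, add_mul, mul_smul_comm, smul_mul_assoc]
    rw [add_add_add_comm, ← smul_add, hm k hki, hp']
  rw [M.yOp_mul_xiOp, add_mul, mul_add, add_add_add_comm, smul_mul_assoc, mul_smul_comm, hs,
    add_zero, Finset.sum_mul, Finset.mul_sum, ← Finset.sum_add_distrib, Finset.sum_congr rfl hterm,
    Finset.sum_eq_single j]
  · rw [Equiv.swap_apply_right]
  · intro k hk hkj
    rw [Equiv.swap_apply_of_ne_of_ne hij.symm hkj.symm, sub_self, zero_mul]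
  · intro hj
    exact absurd (Finset.mem_erase.2 ⟨hij.symm, Finset.mem_univ j⟩) hj

/-- Divided differences kill the constant `1`, so only `η_i` remains. -/
theorem eval_xiOp (i : Fin n) (e : E) :
    Op.eval ((1 : MvPolynomial (Fin n) ℂ) ⊗ₜ[ℂ] e) (M.xiOp u a b i) = 1 ⊗ₜ[ℂ] (M.η i * e) := by
  have h : ∀ α : Fin n → ℂ, α ≠ 0 →
      Op.eval ((1 : MvPolynomial (Fin n) ℂ) ⊗ₜ[ℂ] e) (M.diffOp α) = 0 := by
    intro α hα
    rw [diffOp, op_tmul, ← C_1, divDiff_C hα, TensorProduct.zero_tmul]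
  have h1 : ∀ k ∈ Finset.univ.erase i,
      Op.eval ((1 : MvPolynomial (Fin n) ℂ) ⊗ₜ[ℂ] e) (M.pairOp u a i k) = 0 := by
    intro k hk
    have hki := (Finset.ne_of_mem_erase hk).symm
    rw [pairOp, map_add, map_smul, map_smul, h _ (ne_zero_of_unit (isSigned_minusRoot hki).unit),
      h _ (ne_zero_of_unit (isSigned_plusRoot hki).unit), smul_zero, smul_zero, add_zero]
  rw [xiOp, map_sub, map_sub, map_sum, Finset.sum_eq_zero h1, map_smul,
    h _ (ne_zero_of_unit (isSigned_shortRoot i).unit), smul_zero, sub_zero, sub_zero, etaOp,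
      op_tmul]
  rfl

/-- An operator that commutes with the `y_i` and kills `1 ⊗ E` is zero. -/
theorem _root_.SpinDaHa.Op.eq_zero {D : Op n E}
    (hy : ∀ i, yOp E (X i) * D = D * yOp E (X i))
    (h1 : ∀ e, Op.eval ((1 : MvPolynomial (Fin n) ℂ) ⊗ₜ[ℂ] e) D = 0) : D = 0 := by
  refine Op.ext fun p e => ?_
  rw [map_zero]
  induction p using MvPolynomial.induction_on with
  | C c =>
    rw [← mul_one (C c), ← smul_eq_C_mul, TensorProduct.smul_tmul, h1]
  | add p q hp hq =>
    rw [TensorProduct.add_tmul]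
    rw [Op.eval_add, hp, hq, add_zero]
  | mul_X p i hp =>
    have e1 : (p * X i) ⊗ₜ[ℂ] e = Op.eval (p ⊗ₜ[ℂ] e) (yOp E (X i)) := by
      rw [yOp, op_tmul, one_mul, LinearMap.mulLeft_apply, mul_comm]
    rw [e1, ← Op.eval_mul, ← hy, Op.eval_mul, hp]
    exact Op.eval_zero _

/-- The anticommutator of `ξ_i` and `ξ_j` commutes with every `y_k`: its two contributions from
`anticommutator_xiOp` have the same reflection factor and opposite factors `ξ_j - ξ_i` and `ξ_i -
ξ_j`. On `1 ⊗ E` it is the anticommutator of `η_i` and `η_j`, which is zero. -/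
theorem xiOp_mul_xiOp (hab : a = u ∨ (a = 0 ∧ b = 0)) {i j : Fin n} (hij : i ≠ j) :
    M.xiOp u a b i * M.xiOp u a b j = -(M.xiOp u a b j * M.xiOp u a b i) := by
  rw [eq_neg_iff_add_eq_zero]
  refine Op.eq_zero (fun k => ?_) fun e => ?_
  · have h1 := M.anticommutator_xiOp u a b hab (Pi.single k 1) hij
    have h2 := M.anticommutator_xiOp u a b hab (Pi.single k 1) hij.symm
    rw [minusRoot_swap i j, plusRoot_swap i j, M.reflOp_neg] at h2
    rw [lin_single] at h1 h2
    set A := M.xiOp u a b i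
    set B := M.xiOp u a b j
    set Y := yOp E (X k)
    -- The commutator with `Y` is a derivation.
    have h3 : Y * (A * B + B * A) - (A * B + B * A) * Y =
        ((Y * A - A * Y) * B + B * (Y * A - A * Y)) +
        ((Y * B - B * Y) * A + A * (Y * B - B * Y)) := by noncomm_ring
    rw [← sub_eq_zero, h3, h1, h2, ← neg_sub B A, neg_mul, ← sub_eq_add_neg, ← mul_sub]
    convert mul_zero (B - A) using 2
    module
  · rw [map_add, Op.eval_mul, Op.eval_mul, M.eval_xiOp, M.eval_xiOp, M.eval_xiOp, M.eval_xiOp,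
      ← mul_assoc, ← mul_assoc, M.η_mul i j hij, neg_mul, TensorProduct.tmul_neg, neg_add_cancel]

end SpinModel

end Operators

end SpinDaHa

namespace SpinDaHa

/-! ### The odd reflections as words in the generators -/

section OddReflections

variable {X : ClassicalType} {n : ℕ} {R : Type} [Ring R] [Algebra ℂ R]

/-- The root `e_k - e_{k+1}`, normalized. -/
def stepRoot (n k : ℕ) (hk : k + 1 < n) : Fin n → ℂ :=
  minusRoot ⟨k, by omega⟩ ⟨k + 1, hk⟩

/-- A relation between roots and elements of an algebra, closed under sign changes and, up to sign,
under conjugation by the generators `t_k`, and satisfied by these. -/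
structure IsReflFamily (φ : Free X n →ₐ[ℂ] R) (P : (Fin n → ℂ) → R → Prop) : Prop where
  step : ∀ k hk, P (stepRoot n k hk) (φ (ft X n k))
  conj : ∀ k hk α g, P α g → P (refl (stepRoot n k hk) α) (-(φ (ft X n k) * g * φ (ft X n k)))
  neg : ∀ α g, P α g → P (-α) (-g)

theorem refl_stepRoot_left {k : ℕ} (hk : k + 1 < n) :
    refl (stepRoot n k hk) (Pi.single ⟨k, by omega⟩ 1) = Pi.single ⟨k + 1, hk⟩ 1 := by
  rw [stepRoot, (isSigned_minusRoot (by simp)).refl_single, Equiv.swap_apply_left]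
  simp

theorem refl_stepRoot_right {k : ℕ} (hk : k + 1 < n) :
    refl (stepRoot n k hk) (Pi.single ⟨k + 1, hk⟩ 1) = Pi.single ⟨k, by omega⟩ 1 := by
  rw [stepRoot, (isSigned_minusRoot (by simp)).refl_single, Equiv.swap_apply_right]
  simp

theorem refl_stepRoot_of_ne {k : ℕ} (hk : k + 1 < n) {i : Fin n} (h1 : (i : ℕ) ≠ k)
    (h2 : (i : ℕ) ≠ k + 1) :
    refl (stepRoot n k hk) (Pi.single i 1) = Pi.single i 1 := by
  rw [stepRoot, (isSigned_minusRoot (by simp)).refl_single, Equiv.swap_apply_of_ne_of_ne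
    (fun h => h1 (by rw [h])) (fun h => h2 (by rw [h]))]
  simp

theorem tUp_self (i : ℕ) : tUp X n i i = 1 := by simp [tUp]

theorem tDown_self (i : ℕ) : tDown X n i i = 1 := by simp [tDown]

theorem tUp_succ {i m : ℕ} (h : i ≤ m) : tUp X n i (m + 1) = tUp X n i m * ft X n m := by
  rw [tUp, tUp, show m + 1 - i = m - i + 1 by omega, List.range'_concat]
  simp [show i + (m - i) = m by omega]

theorem tDown_succ {i m : ℕ} (h : i ≤ m) : tDown X n i (m + 1) = ft X n m * tDown X n i m := by
  rw [tDown, tDown, show m + 1 - i = m - i + 1 by omega, List.range'_concat]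
  simp [show i + (m - i) = m by omega]

theorem tUp_eq_mul {i m : ℕ} (h : i < m) : tUp X n i m = ft X n i * tUp X n (i + 1) m := by
  rw [tUp, tUp, show m - i = m - (i + 1) + 1 by omega, List.range'_succ]
  simp

theorem tDown_eq_mul {i m : ℕ} (h : i < m) : tDown X n i m = tDown X n (i + 1) m * ft X n i := by
  rw [tDown, tDown, show m - i = m - (i + 1) + 1 by omega, List.range'_succ]
  simp

theorem neg_one_pow_eq_of_mod_two {R : Type*} [Ring R] {a b : ℕ} (h : a % 2 = b % 2) :
    (-1 : R) ^ a = (-1) ^ b := by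
  rw [neg_one_pow_eq_pow_mod_two, h, ← neg_one_pow_eq_pow_mod_two]

namespace IsReflFamily

variable {φ : Free X n →ₐ[ℂ] R} {P : (Fin n → ℂ) → R → Prop} (h : IsReflFamily φ P)
include h

/-- Recursion `[i, j+1] = -t_j [i, j] t_j`, which matches `conj` and sends `e_i - e_j` to `e_i -
e_{j+1}`. -/
theorem braLt {i j : ℕ} (hij : i < j) (hj : j < n) :
    P (minusRoot ⟨i, by omega⟩ ⟨j, hj⟩) (φ (braLt X n i j)) := by
  induction j, hij using Nat.le_induction with
  | base =>
    have := h.step i hj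
    simpa [SpinDaHa.braLt, tUp_self, tDown_self, stepRoot] using this
  | succ j hij ih =>
    have hij : i < j := hij
    have h1 := h.conj j hj _ _ (ih (by omega))
    rw [minusRoot, refl_smul, refl_sub, refl_stepRoot_left,
      refl_stepRoot_of_ne hj (by simp; omega) (by simp; omega)] at h1
    refine cast (congrArg (P _) (Eq.symm ?_)) h1
    rw [SpinDaHa.braLt.eq_1, SpinDaHa.braLt.eq_1, tUp_succ (by omega), tDown_succ (by omega),
      show j + 1 - i - 1 = j - i - 1 + 1 by omega, pow_succ]
    simp only [map_mul, map_pow, map_neg, map_one]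
    rw [← mul_assoc (φ (ft X n j)) ((-1) ^ (j - i - 1)),
      ← ((Commute.neg_one_left (φ (ft X n j))).pow_left _).eq]
    noncomm_ring

theorem bra {i j : Fin n} (hij : i ≠ j) : P (minusRoot i j) (φ (bra X i j)) := by
  rw [SpinDaHa.bra]
  rcases lt_or_gt_of_ne hij with h1 | h1
  · rw [if_pos h1]
    exact h.braLt h1 j.2
  · rw [if_neg h1.asymm, map_neg, minusRoot_swap j i]
    exact h.neg _ _ (h.braLt h1 i.2)

/-- Each `t_l` with `a ≤ l < m` carries `e_{l+1}` to `e_l`, fixes `β`, and contributes one sign; so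
`e_m` is moved down to `e_a`. -/
theorem conj_tUp {a m : ℕ} (ha : a ≤ m) (hm : m < n) (c : ℂ) (β : Fin n → ℂ) (g : R)
    (hβ : ∀ l, a ≤ l → ∀ hl : l < m, refl (stepRoot n l (by omega)) β = β)
    (hg : P (c • Pi.single ⟨m, hm⟩ 1 + β) g) :
    P (c • Pi.single ⟨a, by omega⟩ 1 + β)
      ((-1) ^ (m - a) * (φ (tUp X n a m) * g * φ (tDown X n a m))) := by
  induction hd : m - a generalizing a with
  | zero =>
    obtain rfl : a = m := by omega
    simpa [tUp_self, tDown_self] using hg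
  | succ d ih =>
    have ha : a < m := by omega
    have h1 := h.conj a (by omega) _ _ (ih (a := a + 1) ha (fun l hl => hβ l (by omega)) (by omega))
    rw [refl_add, refl_smul, refl_stepRoot_right, hβ a le_rfl ha] at h1
    refine cast (congrArg (P _) (Eq.symm ?_)) h1
    rw [tUp_eq_mul ha, tDown_eq_mul ha, pow_succ]
    simp only [map_mul]
    rw [← mul_assoc (φ (ft X n a)), ← ((Commute.neg_one_left (φ (ft X n a))).pow_left _).eq]
    noncomm_ring

/-- Start from the root of the last two coordinates; move the lower one to `i`, then the upper one
to `j`. In each move the other summand is fixed by the generators used. -/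
theorem conj_bar {i j : ℕ} (hij : i < j) (hj : j < n) {g : R}
    (hg : P (plusRoot ⟨n - 2, by omega⟩ ⟨n - 1, by omega⟩) g) :
    P (plusRoot ⟨i, by omega⟩ ⟨j, hj⟩) ((-1) ^ (j - i - 1) * (φ (tUp X n j (n - 1)) *
      φ (tUp X n i (n - 2)) * g * φ (tDown X n i (n - 2)) * φ (tDown X n j (n - 1)))) := by
  have hn : n - 1 < n := by omega
  have h1 := h.conj_tUp (a := i) (m := n - 2) (by omega) (by omega) rt
    (rt • Pi.single ⟨n - 1, hn⟩ 1) g (fun l hl hl' => by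
      rw [refl_smul, refl_stepRoot_of_ne _ (by simp only []; omega) (by simp only []; omega)])
    (by rw [← smul_add]; exact hg)
  rw [add_comm] at h1
  have h2 := h.conj_tUp (a := j) (m := n - 1) (by omega) (by omega) rt
    (rt • Pi.single ⟨i, by omega⟩ 1) _ (fun l hl hl' => by
      rw [refl_smul, refl_stepRoot_of_ne _ (by simp only []; omega) (by simp only []; omega)]) h1
  rw [add_comm, ← smul_add] at h2
  refine cast (congrArg (P _) (Eq.symm ?_)) h2
  -- The two moves produce the signs with exponents `n - 1 - j` and `n - 2 - i`, whose sum has the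
  -- parity of `j - i - 1`.
  rw [neg_one_pow_eq_of_mod_two (a := j - i - 1) (b := (n - 1 - j) + (n - 2 - i)) (by omega),
    pow_add,
    mul_assoc]
  congr 1
  rw [← mul_assoc (φ (tUp X n j (n - 1))),
    ← ((Commute.neg_one_left (φ (tUp X n j (n - 1)))).pow_left _).eq]
  simp only [mul_assoc]

end IsReflFamily

theorem IsReflFamily.bar_D {φ : Free .D n →ₐ[ℂ] R} {P : (Fin n → ℂ) → R → Prop}
    (h : IsReflFamily φ P) (hn : 2 ≤ n)
    (hg : P (plusRoot ⟨n - 2, by omega⟩ ⟨n - 1, by omega⟩) (φ (ft .D n (n - 1))))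
    {i j : Fin n} (hij : i ≠ j) : P (plusRoot i j) (φ (bar .D i j)) := by
  have key : ∀ i j : Fin n, i < j → P (plusRoot i j) (φ (barLt .D n i j)) := by
    intro i j hij
    have := h.conj_bar hij j.2 hg
    simpa only [barLt, map_mul, map_pow, map_neg, map_one] using this
  rw [bar]
  rcases lt_or_gt_of_ne hij with h1 | h1
  · rw [if_pos h1]
    exact key i j h1
  · rw [if_neg h1.asymm, plusRoot_swap j i]
    exact key j i h1

/-- In type B the reflection in the last plus root is the negative of the word `t_n t_{n-1} t_n`
(numbered from `1`); this accounts for the extra sign compared with type D. -/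
theorem IsReflFamily.bar_B {φ : Free .B n →ₐ[ℂ] R} {P : (Fin n → ℂ) → R → Prop}
    (h : IsReflFamily φ P) (hn : 2 ≤ n)
    (hg : P (plusRoot ⟨n - 2, by omega⟩ ⟨n - 1, by omega⟩)
      (-(φ (ft .B n (n - 1)) * φ (ft .B n (n - 2)) * φ (ft .B n (n - 1)))))
    {i j : Fin n} (hij : i ≠ j) : P (plusRoot i j) (φ (bar .B i j)) := by
  have key : ∀ i j : Fin n, i < j → P (plusRoot i j) (φ (barLt .B n i j)) := by
    intro i j hij
    have := h.conj_bar hij j.2 hg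
    have hij' : (i : ℕ) < j := hij
    simp only [barLt, map_mul, map_pow, map_neg, map_one]
    rw [show (j : ℕ) - i = j - i - 1 + 1 by omega, pow_succ]
    refine cast (congrArg (P _) (Eq.symm ?_)) this
    noncomm_ring
  rw [bar]
  rcases lt_or_gt_of_ne hij with h1 | h1
  · rw [if_pos h1]
    exact key i j h1
  · rw [if_neg h1.asymm, plusRoot_swap j i]
    exact key j i h1

theorem IsReflFamily.barOne {φ : Free .B n →ₐ[ℂ] R} {P : (Fin n → ℂ) → R → Prop}
    (h : IsReflFamily φ P) (hn : 0 < n)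
    (hg : P (shortRoot ⟨n - 1, by omega⟩) (φ (ft .B n (n - 1)))) (i : Fin n) :
    P (shortRoot i) (φ (barOne i)) := by
  have h1 := h.conj_tUp (a := i) (m := n - 1) (by omega) (by omega) 1 0 _
    (fun l _ _ => by simp [refl]) (by rw [one_smul, add_zero]; exact hg)
  rw [one_smul, add_zero] at h1
  simp only [SpinDaHa.barOne, map_mul, map_pow, map_neg, map_one]
  rw [show n - (i + 1) = n - 1 - i by omega]
  exact h1

end OddReflections

end SpinDaHa

namespace SpinDaHa

/-! ### The polynomial representation -/

section Representation

/-- The parameter of the roots `e_i + e_j`. -/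
def plusCoeff (u : ℂ) : ClassicalType → ℂ
  | .A => 0
  | .B => u
  | .D => u

/-- The parameter of the roots `e_i`. -/
def shortCoeff (v : ℂ) : ClassicalType → ℂ
  | .A => 0
  | .B => v
  | .D => 0

theorem plusCoeff_shortCoeff (X : ClassicalType) (u v : ℂ) :
    plusCoeff u X = u ∨ (plusCoeff u X = 0 ∧ shortCoeff v X = 0) := by
  cases X <;> simp [plusCoeff, shortCoeff]

/-- The normalized simple roots. -/
def simpleRoot (X : ClassicalType) (n k : ℕ) : Fin n → ℂ :=
  if hk : k + 1 < n then stepRoot n k hk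
  else match X with
    -- The zero values are defaults: for an admissible `n`, an index `k < rank X n` never meets
    -- them.
    | .A => 0
    | .B => if h : 0 < n then shortRoot ⟨n - 1, by omega⟩ else 0
    | .D => if h : 2 ≤ n then plusRoot ⟨n - 2, by omega⟩ ⟨n - 1, by omega⟩ else 0

theorem simpleRoot_of_lt (X : ClassicalType) {n k : ℕ} (hk : k + 1 < n) :
    simpleRoot X n k = stepRoot n k hk := dif_pos hk

theorem simpleRoot_B {n : ℕ} (h : 0 < n) :
    simpleRoot .B n (n - 1) = shortRoot ⟨n - 1, by omega⟩ := by
  rw [simpleRoot, dif_neg (by omega)]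
  exact dif_pos h

theorem simpleRoot_D {n : ℕ} (h : 2 ≤ n) :
    simpleRoot .D n (n - 1) = plusRoot ⟨n - 2, by omega⟩ ⟨n - 1, by omega⟩ := by
  rw [simpleRoot, dif_neg (by omega)]
  exact dif_pos h

theorem isSigned_stepRoot {n k : ℕ} (hk : k + 1 < n) :
    IsSigned (stepRoot n k hk) (Equiv.swap ⟨k, by omega⟩ ⟨k + 1, hk⟩) 1 :=
  isSigned_minusRoot (by simp)

theorem refl_lastRoot_B {n : ℕ} (hn : 2 ≤ n) :
    refl (shortRoot ⟨n - 1, by omega⟩) (stepRoot n (n - 2) (by omega)) =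
      plusRoot ⟨n - 2, by omega⟩ ⟨n - 1, by omega⟩ := by
  have e : (⟨n - 2 + 1, by omega⟩ : Fin n) = ⟨n - 1, by omega⟩ := by simp; omega
  rw [stepRoot, e, minusRoot, plusRoot, refl_smul, refl_sub, (isSigned_shortRoot _).refl_single,
    (isSigned_shortRoot _).refl_single]
  have h2 : n - 2 ≠ n - 1 := by omega
  simp [sgn, h2]

theorem isSigned_lastRoot_D {n : ℕ} (h : 2 ≤ n) :
    IsSigned (plusRoot (⟨n - 2, by omega⟩ : Fin n) ⟨n - 1, by omega⟩)
      (Equiv.swap ⟨n - 2, by omega⟩ ⟨n - 1, by omega⟩)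
      (sgn ⟨n - 2, by omega⟩ ⟨n - 1, by omega⟩) :=
  isSigned_plusRoot (by simp; omega)

theorem lt_of_lt_rank {X : ClassicalType} {n k : ℕ} (hn : Admissible X n) (hk : k < rank X n) :
    k + 1 < n ∨ (k = n - 1 ∧ ((X = .B ∧ 2 ≤ n) ∨ (X = .D ∧ 4 ≤ n))) := by
  cases X <;> simp only [rank, Admissible] at hk hn <;> simp <;> omega

theorem simpleRoot_unit {X : ClassicalType} {n k : ℕ} (hn : Admissible X n) (hk : k < rank X n) :
    simpleRoot X n k ⬝ᵥ simpleRoot X n k = 1 := by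
  rcases lt_of_lt_rank hn hk with h | ⟨rfl, ⟨rfl, h⟩ | ⟨rfl, h⟩⟩
  · rw [simpleRoot_of_lt X h]; exact (isSigned_stepRoot h).unit
  · rw [simpleRoot_B (by omega)]; exact (isSigned_shortRoot _).unit
  · rw [simpleRoot_D (by omega)]; exact (isSigned_lastRoot_D (by omega)).unit

theorem lt_rank {X : ClassicalType} {n k : ℕ} (hk : k + 1 < n) : k < rank X n := by
  cases X <;> simp [rank] <;> omega

theorem refl_stepRoot_stepRoot {n k : ℕ} (hk : k + 1 < n) {l : ℕ} (hl : l + 1 < n)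
    (hkl : k + 1 < l ∨ l + 1 < k) : refl (stepRoot n k hk) (stepRoot n l hl) = stepRoot n l hl := by
  rw [stepRoot.eq_1 n l, minusRoot, refl_smul, refl_sub,
    refl_stepRoot_of_ne hk (by simp only []; omega) (by simp only []; omega),
    refl_stepRoot_of_ne hk (by simp only []; omega) (by simp only []; omega)]

variable {X : ClassicalType} {n : ℕ} {E : Type} [Ring E] [Algebra ℂ E] (M : SpinModel n E) (u v : ℂ)

namespace SpinModel

/-- The images of the generators in the polynomial representation. -/
def genOp (X : ClassicalType) : Gen X n → Op n E
  | .y i => yOp E (MvPolynomial.X i)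
  | .xi i => M.xiOp u (plusCoeff u X) (shortCoeff v X) i
  | .t k => M.reflOp (simpleRoot X n k)

/-- The polynomial representation of the free algebra. -/
def freeRep (X : ClassicalType) : Free X n →ₐ[ℂ] Op n E := FreeAlgebra.lift ℂ (M.genOp u v X)

theorem freeRep_fy (i : Fin n) : M.freeRep u v X (fy X i) = yOp E (MvPolynomial.X i) := by
  simp [freeRep, fy, genOp]

theorem freeRep_fxi (i : Fin n) :
    M.freeRep u v X (fxi X i) = M.xiOp u (plusCoeff u X) (shortCoeff v X) i := by
  simp [freeRep, fxi, genOp]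

theorem freeRep_ft {k : ℕ} (hk : k < rank X n) :
    M.freeRep u v X (ft X n k) = M.reflOp (simpleRoot X n k) := by
  simp [freeRep, ft, hk, genOp]

theorem freeRep_ft_of_lt {k : ℕ} (hk : k + 1 < n) :
    M.freeRep u v X (ft X n k) = M.reflOp (stepRoot n k hk) := by
  rw [M.freeRep_ft u v (lt_rank hk), simpleRoot_of_lt X hk]

theorem freeRep_ft_B (hn : 2 ≤ n) :
    M.freeRep u v .B (ft .B n (n - 1)) = M.reflOp (shortRoot ⟨n - 1, by omega⟩) := by
  rw [M.freeRep_ft u v (by simp [rank]; omega), simpleRoot_B (by omega)]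

theorem freeRep_ft_D (hn : 2 ≤ n) :
    M.freeRep u v .D (ft .D n (n - 1)) =
      M.reflOp (plusRoot ⟨n - 2, by omega⟩ ⟨n - 1, by omega⟩) := by
  rw [M.freeRep_ft u v (by simp [rank]; omega), simpleRoot_D hn]

theorem isReflFamily : IsReflFamily (M.freeRep u v X) fun α g => g = M.reflOp α where
  step k hk := M.freeRep_ft_of_lt u v hk
  conj k hk α g hg := by
    rw [hg, M.freeRep_ft_of_lt u v hk, M.reflOp_conj (isSigned_stepRoot hk).unit, neg_neg]
  neg α g hg := by rw [hg, M.reflOp_neg]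

theorem freeRep_bra {i j : Fin n} (hij : i ≠ j) :
    M.freeRep u v X (bra X i j) = M.reflOp (minusRoot i j) :=
  (M.isReflFamily u v).bra hij

theorem freeRep_bar_D (hn : 2 ≤ n) {i j : Fin n} (hij : i ≠ j) :
    M.freeRep u v .D (bar .D i j) = M.reflOp (plusRoot i j) :=
  (M.isReflFamily u v).bar_D hn (M.freeRep_ft_D u v hn) hij

theorem freeRep_bar_B (hn : 2 ≤ n) {i j : Fin n} (hij : i ≠ j) :
    M.freeRep u v .B (bar .B i j) = M.reflOp (plusRoot i j) := by
  refine (M.isReflFamily u v).bar_B hn ?_ hij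
  rw [M.freeRep_ft_B u v hn, M.freeRep_ft_of_lt u v (show n - 2 + 1 < n by omega),
    M.reflOp_conj (isSigned_shortRoot _).unit, neg_neg, refl_lastRoot_B hn]

theorem freeRep_barOne (hn : 2 ≤ n) (i : Fin n) :
    M.freeRep u v .B (barOne i) = M.reflOp (shortRoot i) :=
  (M.isReflFamily u v).barOne (by omega) (M.freeRep_ft_B u v hn) i

/-- Since `θ_α θ_β θ_α = -θ_{s_α β}` on operators, relations among the `t_k` become identities
between roots; a root fixed by `s_α` gives the square `-1`. -/
theorem reflOp_mul_sq {α β : Fin n → ℂ} (hα : α ⬝ᵥ α = 1) (hβ : β ⬝ᵥ β = 1)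
    (h : refl α β = β) : (M.reflOp α * M.reflOp β) ^ 2 = -1 := by
  have h1 := M.reflOp_conj hα β
  rw [h] at h1
  rw [pow_two, ← mul_assoc, h1, neg_mul, M.reflOp_sq hβ]

theorem reflOp_braid {α β : Fin n → ℂ} (hα : α ⬝ᵥ α = 1) (hβ : β ⬝ᵥ β = 1)
    (h : refl α β = refl β α) :
    M.reflOp α * M.reflOp β * M.reflOp α = M.reflOp β * M.reflOp α * M.reflOp β := by
  rw [M.reflOp_conj hα, M.reflOp_conj hβ, h]

theorem reflOp_mul_y {α : Fin n → ℂ} {σ : Equiv.Perm (Fin n)} {ε : Fin n → ℂ}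
    (h : IsSigned α σ ε) (k : Fin n) :
    M.reflOp α * yOp E (MvPolynomial.X k) = ε k • (yOp E (MvPolynomial.X (σ k)) * M.reflOp α) := by
  rw [M.reflOp_mul_yOp, h.polyRefl_X, yOp_smul, smul_mul_assoc]

theorem freeRep_comm {i j : Fin n} (hij : i ≠ j) (a b : ℂ) :
    yOp E (MvPolynomial.X j) * M.xiOp u a b i - M.xiOp u a b i * yOp E (MvPolynomial.X j) =
      -(u • M.reflOp (minusRoot i j)) + a • M.reflOp (plusRoot i j) := by
  have h := M.yOp_mul_xiOp u a b (Pi.single j 1) i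
  rw [lin_single] at h
  rw [h, Finset.sum_eq_single j]
  · simp [hij]
  · intro k hk hkj
    simp [hij, hkj]
  · intro hj
    exact absurd (Finset.mem_erase.2 ⟨hij.symm, Finset.mem_univ j⟩) hj

theorem freeRep_comm_self (i : Fin n) (a b : ℂ) :
    yOp E (MvPolynomial.X i) * M.xiOp u a b i - M.xiOp u a b i * yOp E (MvPolynomial.X i) =
      ∑ k ∈ Finset.univ.erase i, (u • M.reflOp (minusRoot i k) + a • M.reflOp (plusRoot i k)) +
        b • M.reflOp (shortRoot i) := by
  have h := M.yOp_mul_xiOp u a b (Pi.single i 1) i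
  rw [lin_single] at h
  rw [h, Pi.single_eq_same, mul_one]
  congr 1
  refine Finset.sum_congr rfl fun k hk => ?_
  have := (Finset.ne_of_mem_erase hk)
  simp [this]

theorem freeRep_rel (hn : Admissible X n) {a b : Free X n} (h : Rel u v X n a b) :
    M.freeRep u v X a = M.freeRep u v X b := by
  cases h with
  | t_sq k hk =>
    rw [map_pow, M.freeRep_ft u v hk, pow_two, M.reflOp_sq (simpleRoot_unit hn hk), map_one]
  | t_braid k hk =>
    simp only [map_mul]
    rw [M.freeRep_ft_of_lt u v (show k + 1 < n by omega),
      M.freeRep_ft_of_lt u v (show k + 1 + 1 < n by omega)]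
    refine M.reflOp_braid (isSigned_stepRoot _).unit (isSigned_stepRoot _).unit ?_
    have e1 : refl (stepRoot n k (by omega)) (stepRoot n (k + 1) hk) =
        minusRoot ⟨k, by omega⟩ ⟨k + 1 + 1, hk⟩ := by
      rw [stepRoot.eq_1 n (k + 1), minusRoot, refl_smul, refl_sub, refl_stepRoot_right,
        refl_stepRoot_of_ne _ (by simp only []; omega) (by simp only []; omega), minusRoot]
    have e2 : refl (stepRoot n (k + 1) hk) (stepRoot n k (by omega)) =
        minusRoot ⟨k, by omega⟩ ⟨k + 1 + 1, hk⟩ := by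
      rw [stepRoot.eq_1 n k, minusRoot, refl_smul, refl_sub, refl_stepRoot_left,
        refl_stepRoot_of_ne _ (by simp only []; omega) (by simp only []; omega), minusRoot]
    rw [e1, e2]
  | t_far k l hk hl hkl =>
    simp only [map_mul, map_pow, map_neg, map_one]
    rw [M.freeRep_ft_of_lt u v hk, M.freeRep_ft_of_lt u v hl]
    exact M.reflOp_mul_sq (isSigned_stepRoot _).unit (isSigned_stepRoot _).unit
      (refl_stepRoot_stepRoot hk hl hkl)
  | t_far_B k hk =>
    simp only [map_mul, map_pow, map_neg, map_one]
    rw [M.freeRep_ft_of_lt u v (show k + 1 < n by omega), M.freeRep_ft_B u v hn]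
    exact M.reflOp_mul_sq (isSigned_stepRoot _).unit (isSigned_shortRoot _).unit
      (refl_stepRoot_of_ne _ (by simp only []; omega) (by simp only []; omega))
  | t_braid_B hn2 =>
    simp only [map_mul, map_pow, map_neg, map_one]
    rw [M.freeRep_ft_of_lt u v (show n - 2 + 1 < n by omega), M.freeRep_ft_B u v hn]
    have e : (⟨n - 1, by omega⟩ : Fin n) = ⟨n - 2 + 1, by omega⟩ := by simp; omega
    -- Group `(t t')^4` as `((t t' t) t')^2`. The conjugate `t t' t` is, up to sign, the odd
    -- reflection in the penultimate coordinate vector, which is orthogonal to the last one.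
    rw [e, show 4 = 2 * 2 from rfl, pow_mul, pow_two (_ * _), ← mul_assoc,
      M.reflOp_conj (isSigned_stepRoot _).unit, shortRoot, refl_stepRoot_right, neg_mul, neg_sq]
    refine M.reflOp_mul_sq (isSigned_shortRoot _).unit (isSigned_shortRoot _).unit ?_
    rw [← shortRoot, (isSigned_shortRoot _).refl_single]
    simp [sgn]
  | t_far_D k hk hk' =>
    have hn4 : 4 ≤ n := hn
    simp only [map_mul, map_pow, map_neg, map_one]
    rw [M.freeRep_ft_of_lt u v (show k + 1 < n by omega), M.freeRep_ft_D u v (by omega)]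
    refine M.reflOp_mul_sq (isSigned_stepRoot _).unit (isSigned_lastRoot_D (by omega)).unit ?_
    rw [plusRoot, refl_smul, refl_add]
    -- The step root at `n - 2` involves the same two coordinates as the last root: its reflection
    -- exchanges the two summands.
    by_cases h2 : k = n - 2
    · subst h2
      have e : (⟨n - 1, by omega⟩ : Fin n) = ⟨n - 2 + 1, by omega⟩ := by simp; omega
      rw [e, refl_stepRoot_left, refl_stepRoot_right, add_comm]
    · rw [refl_stepRoot_of_ne _ (by simp only []; omega) (by simp only []; omega),
        refl_stepRoot_of_ne _ (by simp only []; omega) (by simp only []; omega)]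
  | t_braid_D hn3 =>
    simp only [map_mul]
    rw [M.freeRep_ft_of_lt u v (show n - 3 + 1 < n by omega), M.freeRep_ft_D u v (by omega)]
    refine M.reflOp_braid (isSigned_stepRoot _).unit (isSigned_lastRoot_D (by omega)).unit ?_
    have hS := isSigned_lastRoot_D (n := n) (by omega)
    have e : (⟨n - 2, by omega⟩ : Fin n) = ⟨n - 3 + 1, by omega⟩ := by simp; omega
    -- Both sides are the normalized root `e_{n-3} + e_{n-1}`.
    rw [stepRoot.eq_1 n (n - 3), minusRoot.eq_1 ⟨n - 3, _⟩, refl_smul, refl_sub, hS.refl_single,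
      hS.refl_single, ← minusRoot.eq_1 ⟨n - 3, _⟩, ← stepRoot.eq_1, plusRoot, refl_smul, refl_add,
      refl_stepRoot_of_ne (i := ⟨n - 1, _⟩) _ (by simp only []; omega) (by simp only []; omega), e,
      refl_stepRoot_right, Equiv.swap_apply_left, Equiv.swap_apply_of_ne_of_ne]
    · have h1 : n - 3 ≠ n - 1 := by omega
      simp [sgn, h1]
    · simp
    · simp; omega
  | y_comm i j => rw [map_mul, map_mul, M.freeRep_fy, M.freeRep_fy, yOp_comm]
  | xi_anti i j hij =>
    rw [map_neg, map_mul, map_mul, M.freeRep_fxi, M.freeRep_fxi,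
      M.xiOp_mul_xiOp _ _ _ (plusCoeff_shortCoeff X u v) hij]
  | t_y i j hij =>
    have hi : (i : ℕ) + 1 < n := by omega
    obtain rfl : j = ⟨i + 1, hi⟩ := by ext; exact hij.symm
    have := M.reflOp_mul_y (isSigned_stepRoot hi) i
    rw [Equiv.swap_apply_left, Pi.one_apply, one_smul] at this
    rw [map_mul, map_mul, M.freeRep_ft_of_lt u v hi, M.freeRep_fy, M.freeRep_fy, this]
  | t_xi i j hij =>
    have hi : (i : ℕ) + 1 < n := by omega
    obtain rfl : j = ⟨i + 1, hi⟩ := by ext; exact hij.symm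
    have := M.reflOp_mul_xiOp u (plusCoeff u X) (shortCoeff v X) (isSigned_stepRoot hi)
      (Or.inr fun _ => rfl) i
    rw [Equiv.swap_apply_left] at this
    rw [map_neg, map_mul, map_mul, M.freeRep_ft_of_lt u v hi, M.freeRep_fxi, M.freeRep_fxi, this]
  | t_y_far k hk j h1 h2 =>
    have := M.reflOp_mul_y (isSigned_stepRoot hk) j
    rw [Equiv.swap_apply_of_ne_of_ne (fun h => h1 (by rw [h])) (fun h => h2 (by rw [h])),
      Pi.one_apply, one_smul] at this
    rw [map_mul, map_mul, M.freeRep_ft_of_lt u v hk, M.freeRep_fy, this]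
  | t_xi_far k hk j h1 h2 =>
    have := M.reflOp_mul_xiOp u (plusCoeff u X) (shortCoeff v X) (isSigned_stepRoot hk)
      (Or.inr fun _ => rfl) j
    rw [Equiv.swap_apply_of_ne_of_ne (fun h => h1 (by rw [h])) (fun h => h2 (by rw [h]))] at this
    rw [map_neg, map_mul, map_mul, M.freeRep_ft_of_lt u v hk, M.freeRep_fxi, this]
  | tn_y_D i j hi hj =>
    have hn4 : 4 ≤ n := hn
    have hn1 : n - 1 < n := by omega
    have hn2 : n - 2 < n := by omega
    obtain rfl : i = ⟨n - 2, hn2⟩ := by ext; simp only []; omega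
    obtain rfl : j = ⟨n - 1, hn1⟩ := by ext; simp only []; omega
    have := M.reflOp_mul_y (isSigned_lastRoot_D (n := n) (by omega)) ⟨n - 1, by omega⟩
    rw [Equiv.swap_apply_right] at this
    rw [map_neg, map_mul, map_mul, M.freeRep_ft_D u v (by omega), M.freeRep_fy, M.freeRep_fy, this]
    simp [sgn]
  | tn_xi_D i j hi hj =>
    have hn4 : 4 ≤ n := hn
    have hn1 : n - 1 < n := by omega
    have hn2 : n - 2 < n := by omega
    obtain rfl : i = ⟨n - 2, hn2⟩ := by ext; simp only []; omega
    obtain rfl : j = ⟨n - 1, hn1⟩ := by ext; simp only []; omega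
    have := M.reflOp_mul_xiOp u (plusCoeff u .D) (shortCoeff v .D)
      (isSigned_lastRoot_D (n := n) (by omega)) (Or.inl rfl) ⟨n - 1, by omega⟩
    rw [Equiv.swap_apply_right] at this
    rw [map_neg, map_mul, map_mul, M.freeRep_ft_D u v (by omega), M.freeRep_fxi, M.freeRep_fxi,
      this]
  | tn_y_far_D j hj =>
    have := M.reflOp_mul_y (isSigned_lastRoot_D (n := n) (by omega)) j
    have h1 : j ≠ ⟨n - 2, by omega⟩ := by rw [Ne, Fin.ext_iff]; simp only []; omega
    have h2 : j ≠ ⟨n - 1, by omega⟩ := by rw [Ne, Fin.ext_iff]; simp only []; omega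
    rw [Equiv.swap_apply_of_ne_of_ne h1 h2, sgn, if_neg (by simp [h1, h2]), one_smul] at this
    rw [map_mul, map_mul, M.freeRep_ft_D u v (by omega), M.freeRep_fy, this]
  | tn_xi_far_D j hj =>
    have := M.reflOp_mul_xiOp u (plusCoeff u .D) (shortCoeff v .D)
      (isSigned_lastRoot_D (n := n) (by omega)) (Or.inl rfl) j
    have h1 : j ≠ ⟨n - 2, by omega⟩ := by rw [Ne, Fin.ext_iff]; simp only []; omega
    have h2 : j ≠ ⟨n - 1, by omega⟩ := by rw [Ne, Fin.ext_iff]; simp only []; omega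
    rw [Equiv.swap_apply_of_ne_of_ne h1 h2] at this
    rw [map_neg, map_mul, map_mul, M.freeRep_ft_D u v (by omega), M.freeRep_fxi, this]
  | tn_y_B j hj =>
    have hn2 : 2 ≤ n := hn
    have hn1 : n - 1 < n := by omega
    obtain rfl : j = ⟨n - 1, hn1⟩ := by ext; simp only []; omega
    have := M.reflOp_mul_y (isSigned_shortRoot ⟨n - 1, by omega⟩) ⟨n - 1, by omega⟩
    rw [map_neg, map_mul, map_mul, M.freeRep_ft_B u v hn, M.freeRep_fy, this]
    simp [sgn]
  | tn_xi_B j hj =>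
    have hn2 : 2 ≤ n := hn
    have hn1 : n - 1 < n := by omega
    obtain rfl : j = ⟨n - 1, hn1⟩ := by ext; simp only []; omega
    have := M.reflOp_mul_xiOp u (plusCoeff u .B) (shortCoeff v .B)
      (isSigned_shortRoot ⟨n - 1, by omega⟩) (Or.inl rfl) ⟨n - 1, by omega⟩
    rw [map_neg, map_mul, map_mul, M.freeRep_ft_B u v hn, M.freeRep_fxi, this]
    simp
  | tn_y_far_B j hj =>
    have := M.reflOp_mul_y (isSigned_shortRoot ⟨n - 1, by omega⟩) j
    have h2 : j ≠ ⟨n - 1, by omega⟩ := by rw [Ne, Fin.ext_iff]; simp only []; omega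
    rw [sgn, if_neg (by simp [h2]), one_smul] at this
    rw [map_mul, map_mul, M.freeRep_ft_B u v hn, M.freeRep_fy, this]
    simp
  | tn_xi_far_B j hj =>
    have := M.reflOp_mul_xiOp u (plusCoeff u .B) (shortCoeff v .B)
      (isSigned_shortRoot ⟨n - 1, by omega⟩) (Or.inl rfl) j
    rw [map_neg, map_mul, map_mul, M.freeRep_ft_B u v hn, M.freeRep_fxi, this]
    simp
  | comm_A i j hij =>
    simp only [map_sub, map_mul, map_neg, map_smul, M.freeRep_fy, M.freeRep_fxi,
      M.freeRep_comm u hij, M.freeRep_bra u v hij]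
    simp [plusCoeff]
  | comm_self_A i =>
    simp only [map_sub, map_mul, map_smul, map_sum, M.freeRep_fy, M.freeRep_fxi,
      M.freeRep_comm_self]
    simp only [plusCoeff, shortCoeff, zero_smul, add_zero, Finset.smul_sum]
    exact Finset.sum_congr rfl fun k hk => by
      rw [M.freeRep_bra u v (Finset.ne_of_mem_erase hk).symm]
  | comm_D i j hij =>
    have hn4 : 4 ≤ n := hn
    simp only [map_sub, map_mul, map_neg, map_smul, map_add, M.freeRep_fy, M.freeRep_fxi,
      M.freeRep_comm u hij, M.freeRep_bra u v hij, M.freeRep_bar_D u v (by omega) hij]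
    simp [plusCoeff]
  | comm_self_D i =>
    have hn4 : 4 ≤ n := hn
    simp only [map_sub, map_mul, map_smul, map_sum, map_add, M.freeRep_fy, M.freeRep_fxi,
      M.freeRep_comm_self]
    simp only [plusCoeff, shortCoeff, zero_smul, add_zero, Finset.smul_sum, smul_add]
    exact Finset.sum_congr rfl fun k hk => by
      rw [M.freeRep_bra u v (Finset.ne_of_mem_erase hk).symm,
        M.freeRep_bar_D u v (by omega) (Finset.ne_of_mem_erase hk).symm]
  | comm_B i j hij =>
    simp only [map_sub, map_mul, map_neg, map_smul, map_add, M.freeRep_fy, M.freeRep_fxi,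
      M.freeRep_comm u hij, M.freeRep_bra u v hij, M.freeRep_bar_B u v hn hij]
    simp [plusCoeff]
  | comm_self_B i =>
    simp only [map_sub, map_mul, map_smul, map_sum, map_add, M.freeRep_fy, M.freeRep_fxi,
      M.freeRep_comm_self, M.freeRep_barOne u v hn]
    simp only [plusCoeff, shortCoeff, Finset.smul_sum, smul_add]
    congr 1
    exact Finset.sum_congr rfl fun k hk => by
      rw [M.freeRep_bra u v (Finset.ne_of_mem_erase hk).symm,
        M.freeRep_bar_B u v hn (Finset.ne_of_mem_erase hk).symm]

/-- The polynomial representation of the spin double affine Hecke algebra. -/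
def rep (hn : Admissible X n) : SDaHa X n u v →ₐ[ℂ] Op n E :=
  RingQuot.liftAlgHom ℂ ⟨M.freeRep u v X, fun _ _ h => M.freeRep_rel u v hn h⟩

theorem rep_mk (hn : Admissible X n) (a : Free X n) :
    M.rep u v hn (SpinDaHa.mk X n u v a) = M.freeRep u v X a :=
  RingQuot.liftAlgHom_mkAlgHom_apply ℂ _ _ _

end SpinModel

end Representation

end SpinDaHa

namespace SpinDaHa

/-! ### The Clifford model and injectivity -/

section Injectivity

open scoped TensorProduct

variable {n : ℕ}

/-- The quadratic form `∑ v_i²`. -/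
def dotForm (n : ℕ) : QuadraticForm ℂ (Fin n → ℂ) :=
  LinearMap.BilinMap.toQuadraticMap (dotProductBilin ℂ ℂ)

theorem polar_dotForm (v w : Fin n → ℂ) : QuadraticMap.polar (dotForm n) v w = 2 * (v ⬝ᵥ w) := by
  rw [dotForm, LinearMap.BilinMap.polar_toQuadraticMap]
  simp only [dotProductBilin_apply_apply, dotProduct_comm w v]
  ring

/-- The Clifford algebra on `n` anticommuting generators of square `1`. -/
abbrev Cl (n : ℕ) : Type := CliffordAlgebra (dotForm n)

/-- The inclusion of `ℂⁿ` in the Clifford algebra. -/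
def cl : (Fin n → ℂ) →ₗ[ℂ] Cl n := CliffordAlgebra.ι (dotForm n)

theorem cl_sq (v : Fin n → ℂ) : cl v * cl v = algebraMap ℂ _ (v ⬝ᵥ v) :=
  CliffordAlgebra.ι_sq_scalar _ v

/-- Rewriting of the Clifford relation `α v + v α = 2 (α ⬝ v)` by means of `α² = 1`. -/
theorem cl_mul {α : Fin n → ℂ} (h : α ⬝ᵥ α = 1) (v : Fin n → ℂ) :
    cl α * cl v = -(cl (refl α v) * cl α) := by
  have h1 := CliffordAlgebra.ι_mul_ι_add_swap (Q := dotForm n) α v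
  rw [polar_dotForm] at h1
  change cl α * cl v + cl v * cl α = _ at h1
  rw [refl, map_sub, map_smul, sub_mul, smul_mul_assoc, cl_sq, h, map_one, eq_sub_of_add_eq h1,
    Algebra.algebraMap_eq_smul_one, dotProduct_comm]
  abel

/-- The algebra of operators on `ℂ[x]`, tensored with the Clifford algebra. -/
abbrev SpinAlg (n : ℕ) : Type := Module.End ℂ (MvPolynomial (Fin n) ℂ) ⊗[ℂ] Cl n

/-- The model on `ℂ[x] ⊗ Cl` with `η_i = x_i c_i` and `θ_α = s_α ⊗ α`. -/
def cliffordModel (n : ℕ) : SpinModel n (SpinAlg n) where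
  θ α := (polyRefl α).toLinearMap ⊗ₜ[ℂ] cl α
  η i := LinearMap.mulLeft ℂ (X i) ⊗ₜ[ℂ] cl (Pi.single i 1)
  θ_neg α := by rw [polyRefl_neg, map_neg]; exact TensorProduct.tmul_neg _ _
  θ_sq α h := by
    rw [Algebra.TensorProduct.tmul_mul_tmul, cl_sq, h, map_one, Algebra.TensorProduct.one_def]
    congr 1
    exact LinearMap.ext (polyRefl_polyRefl h)
  θ_mul α β h := by
    have e : (polyRefl α).toLinearMap * (polyRefl β).toLinearMap =
        (polyRefl (refl α β)).toLinearMap * (polyRefl α).toLinearMap :=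
      LinearMap.ext fun f => (polyRefl_conj h β f).symm
    rw [Algebra.TensorProduct.tmul_mul_tmul, Algebra.TensorProduct.tmul_mul_tmul, cl_mul h, e]
    exact TensorProduct.tmul_neg _ _
  θ_η α σ ε h k := by
    have e : (polyRefl α).toLinearMap * LinearMap.mulLeft ℂ (X k) =
        ε k • (LinearMap.mulLeft ℂ (X (σ k)) * (polyRefl α).toLinearMap) :=
      LinearMap.ext fun f => by simp [h.polyRefl_X]
    -- The sign `ε k` occurs twice, from `x_k` and from the Clifford generator `c_k`, and cancels.
    -- This is why `η` transforms without signs other than the odd one.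
    rw [Algebra.TensorProduct.tmul_mul_tmul, Algebra.TensorProduct.tmul_mul_tmul, cl_mul h.unit, e,
      h.refl_single, map_smul, smul_mul_assoc, ← smul_neg, TensorProduct.smul_tmul, smul_smul,
      h.sq k, one_smul]
    exact TensorProduct.tmul_neg _ _
  η_mul i j hij := by
    have e : LinearMap.mulLeft ℂ (X i : MvPolynomial (Fin n) ℂ) * LinearMap.mulLeft ℂ (X j) =
        LinearMap.mulLeft ℂ (X j) * LinearMap.mulLeft ℂ (X i) :=
      LinearMap.ext fun f => by simp [mul_left_comm]
    rw [Algebra.TensorProduct.tmul_mul_tmul, Algebra.TensorProduct.tmul_mul_tmul,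
      cl_mul (by simp), refl_of_orthogonal (by simp [hij]), e]
    exact TensorProduct.tmul_neg _ _

theorem evalCommuting_X {R : Type} [Ring R] [Algebra ℂ R] {m : ℕ} (a : Fin m → R)
    (h : ∀ i j, a i * a j = a j * a i) (i : Fin m) : evalCommuting a h (X i) = a i := by
  simp [evalCommuting]

variable (X : ClassicalType) (u v : ℂ)

theorem yHom_X (i : Fin n) : yHom X n u v (MvPolynomial.X i) = gen X n u v (.y i) :=
  evalCommuting_X _ _ i

theorem xiSqHom_X (i : Fin n) : xiSqHom X n u v (MvPolynomial.X i) = gen X n u v (.xi i) ^ 2 :=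
  evalCommuting_X _ _ i

instance : Nontrivial (Cl n) := by
  have : Invertible (2 : ℂ) := invertibleOfNonzero two_ne_zero
  infer_instance

theorem endTensor_injective : Function.Injective
    (fun f : Module.End ℂ (MvPolynomial (Fin n) ℂ) => (f ⊗ₜ[ℂ] 1 : SpinAlg n)) :=
  Algebra.TensorProduct.includeLeft_injective (S := ℂ) (algebraMap ℂ (Cl n)).injective

instance : Nontrivial (SpinAlg n) :=
  endTensor_injective.nontrivial

theorem Op.eval_algebraMap {E : Type} [Ring E] [Algebra ℂ E] (c : ℂ)
    (x : MvPolynomial (Fin n) ℂ ⊗[ℂ] E) : Op.eval x (algebraMap ℂ (Op n E) c) = c • x := rfl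

theorem eq_zero_of_tmul_one {E : Type} [Ring E] [Algebra ℂ E] [Nontrivial E]
    {p : MvPolynomial (Fin n) ℂ} (h : p ⊗ₜ[ℂ] (1 : E) = 0) : p = 0 :=
  Algebra.TensorProduct.includeLeft_injective (S := ℂ) (algebraMap ℂ E).injective
    (h.trans (TensorProduct.zero_tmul _ _).symm)

theorem eq_zero_of_one_tmul {E : Type} [Ring E] [Algebra ℂ E] {e : E}
    (h : (1 : MvPolynomial (Fin n) ℂ) ⊗ₜ[ℂ] e = 0) : e = 0 :=
  Algebra.TensorProduct.includeRight_injective (algebraMap ℂ (MvPolynomial (Fin n) ℂ)).injective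
    (h.trans (TensorProduct.tmul_zero _ _).symm)

theorem eval_rep_yHom (hn : Admissible X n) (p q : MvPolynomial (Fin n) ℂ) (e : SpinAlg n) :
    Op.eval (q ⊗ₜ[ℂ] e) ((cliffordModel n).rep u v hn (yHom X n u v p)) = (p * q) ⊗ₜ[ℂ] e := by
  induction p using MvPolynomial.induction_on generalizing q with
  | C c =>
    rw [← algebraMap_eq, AlgHom.commutes, AlgHom.commutes, Op.eval_algebraMap,
      TensorProduct.smul_tmul', Algebra.smul_def]
  | add p p' hp hp' =>
    rw [map_add, map_add, map_add, hp, hp', add_mul, TensorProduct.add_tmul]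
  | mul_X p i hp =>
    have e1 : (cliffordModel n).rep u v hn (yHom X n u v (MvPolynomial.X i)) =
        yOp (SpinAlg n) (MvPolynomial.X i) := by
      rw [yHom_X]
      exact ((cliffordModel n).rep_mk u v hn _).trans ((cliffordModel n).freeRep_fy u v i)
    rw [map_mul, map_mul, Op.eval_mul, e1, yOp, op_tmul, one_mul, hp, LinearMap.mulLeft_apply,
      mul_assoc]

theorem yHom_injective (hn : Admissible X n) : Function.Injective (yHom X n u v) := by
  rw [injective_iff_map_eq_zero]
  intro p hp
  have h := eval_rep_yHom X u v hn p 1 1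
  rw [hp, map_zero, map_zero, mul_one] at h
  exact eq_zero_of_tmul_one (E := SpinAlg n) h.symm

/-- The subspace `1 ⊗ E` is stable under `ξ_i`, which acts there by `η_i`, and `η_i² = x_i² ⊗ 1`.
The vector `e` stays general since the induction replaces it by `η_i² e`. -/
theorem eval_rep_xiSqHom (hn : Admissible X n) (p : MvPolynomial (Fin n) ℂ) (e : SpinAlg n) :
    Op.eval (1 ⊗ₜ[ℂ] e) ((cliffordModel n).rep u v hn (xiSqHom X n u v p)) =
      1 ⊗ₜ[ℂ] ((LinearMap.mulLeft ℂ (expand 2 p) ⊗ₜ[ℂ] 1 : SpinAlg n) * e) := by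
  induction p using MvPolynomial.induction_on generalizing e with
  | C c =>
    have e1 : (LinearMap.mulLeft ℂ (C c : MvPolynomial (Fin n) ℂ)) = c • 1 :=
      LinearMap.ext fun f => by simp [smul_eq_C_mul]
    rw [← algebraMap_eq, AlgHom.commutes, AlgHom.commutes, AlgHom.commutes, Op.eval_algebraMap,
      algebraMap_eq, e1, ← TensorProduct.smul_tmul', ← Algebra.TensorProduct.one_def,
      smul_mul_assoc, one_mul, TensorProduct.tmul_smul]
  | add p p' hp hp' =>
    have e1 : (LinearMap.mulLeft ℂ (expand 2 p + expand 2 p' : MvPolynomial (Fin n) ℂ)) =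
        LinearMap.mulLeft ℂ (expand 2 p) + LinearMap.mulLeft ℂ (expand 2 p') :=
      LinearMap.ext fun f => by simp [add_mul]
    rw [map_add, map_add, map_add, hp, hp', map_add (expand 2), e1, TensorProduct.add_tmul, add_mul,
      TensorProduct.tmul_add]
  | mul_X p i hp =>
    have e1 : (cliffordModel n).rep u v hn (xiSqHom X n u v (MvPolynomial.X i)) =
        (cliffordModel n).xiOp u (plusCoeff u X) (shortCoeff v X) i ^ 2 := by
      rw [xiSqHom_X, map_pow]
      exact congrArg (· ^ 2)
        (((cliffordModel n).rep_mk u v hn _).trans ((cliffordModel n).freeRep_fxi u v i))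
    have e2 : (LinearMap.mulLeft ℂ (expand 2 (p * MvPolynomial.X i))) =
        LinearMap.mulLeft ℂ (expand 2 p) *
          (LinearMap.mulLeft ℂ (MvPolynomial.X i) * LinearMap.mulLeft ℂ (MvPolynomial.X i)) :=
      LinearMap.ext fun f => by simp [pow_two]
    have e3 : (cliffordModel n).η i * (cliffordModel n).η i =
        (LinearMap.mulLeft ℂ (MvPolynomial.X i) * LinearMap.mulLeft ℂ (MvPolynomial.X i)) ⊗ₜ[ℂ]
          (1 : Cl n) := by
      rw [cliffordModel, Algebra.TensorProduct.tmul_mul_tmul, cl_sq]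
      simp
    rw [map_mul, map_mul, Op.eval_mul, e1, pow_two, Op.eval_mul, SpinModel.eval_xiOp,
      SpinModel.eval_xiOp, hp, e2, ← mul_assoc, ← mul_assoc, mul_assoc _ _ ((cliffordModel n).η i),
      e3, Algebra.TensorProduct.tmul_mul_tmul, one_mul]

theorem xiSqHom_injective (hn : Admissible X n) : Function.Injective (xiSqHom X n u v) := by
  rw [injective_iff_map_eq_zero]
  intro p hp
  have h := eval_rep_xiSqHom X u v hn p 1
  rw [hp, map_zero, map_zero, mul_one] at h
  have h1 := eq_zero_of_one_tmul (E := SpinAlg n) h.symm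
  have h2 := endTensor_injective (h1.trans (TensorProduct.zero_tmul _ _).symm)
  have h3 := LinearMap.congr_fun h2 1
  rw [LinearMap.mulLeft_apply, mul_one, LinearMap.zero_apply] at h3
  exact (expand_eq_zero two_pos).1 h3

end Injectivity

end SpinDaHa

namespace SpinDaHa

/-! ### Odd reflections in the algebra, and commutators -/

section Commutators

/-- Allows `OddRefl` to hide the permutation and the signs in an existential: they are determined by
`α`. -/
theorem IsSigned.unique {n : ℕ} {α : Fin n → ℂ} {σ σ' : Equiv.Perm (Fin n)} {ε ε' : Fin n → ℂ}
    (h : IsSigned α σ ε) (h' : IsSigned α σ' ε') : σ = σ' ∧ ε = ε' := by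
  have key : ∀ k, σ k = σ' k ∧ ε k = ε' k := by
    intro k
    have h1 := congrFun ((h.refl_single k).symm.trans (h'.refl_single k)) (σ k)
    have h0 : ε k ≠ 0 := fun h0 => by simpa [h0] using h.sq k
    by_cases hk : σ k = σ' k
    · refine ⟨hk, ?_⟩
      rw [hk] at h1
      simpa using h1
    · simp [hk, h0] at h1
  exact ⟨Equiv.ext fun k => (key k).1, funext fun k => (key k).2⟩

variable (X : ClassicalType) (n : ℕ) (u v : ℂ)

/-- The image of `ℂW⁻`. -/
def tAlg : Subalgebra ℂ (SDaHa X n u v) := Algebra.adjoin ℂ (Set.range fun k => gen X n u v (.t k))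

theorem mk_ft_mem (k : ℕ) : mk X n u v (ft X n k) ∈ tAlg X n u v := by
  by_cases hk : k < rank X n
  · rw [ft, dif_pos hk]
    exact Algebra.subset_adjoin ⟨⟨k, hk⟩, rfl⟩
  · rw [ft, dif_neg hk, map_zero]
    exact zero_mem _

variable {X n}

/-- `g` behaves like the odd reflection in `α`. -/
structure OddRefl (α : Fin n → ℂ) (g : SDaHa X n u v) : Prop where
  exists_signed : ∃ σ ε, IsSigned α σ ε ∧ ∀ k,
    g * gen X n u v (.y k) = ε k • (gen X n u v (.y (σ k)) * g) ∧
    g * gen X n u v (.xi k) = -(gen X n u v (.xi (σ k)) * g)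
  mem : g ∈ tAlg X n u v

variable {u v}

theorem OddRefl.mul_xi {α : Fin n → ℂ} {g : SDaHa X n u v} (h : OddRefl u v α g)
    {σ : Equiv.Perm (Fin n)} {ε : Fin n → ℂ} (hα : IsSigned α σ ε) (k : Fin n) :
    g * gen X n u v (.xi k) = -(gen X n u v (.xi (σ k)) * g) := by
  obtain ⟨σ', ε', h1, h2⟩ := h.exists_signed
  obtain ⟨rfl, rfl⟩ := hα.unique h1
  exact (h2 k).2

/-- The defining conditions are linear in `g`. Putting `0` at the vectors that are not roots of the
given type makes the commutator formulas uniform in the three types. -/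
theorem IsSigned.oddRefl_zero {α : Fin n → ℂ} {σ : Equiv.Perm (Fin n)} {ε : Fin n → ℂ}
    (hα : IsSigned α σ ε) : OddRefl u v α (0 : SDaHa X n u v) :=
  ⟨⟨σ, ε, hα, fun k => by simp⟩, zero_mem _⟩

theorem mul_eq_of_involution {R : Type} [Ring R] {t a b : R} (ht : t * t = 1)
    (h : t * a = b * t) : t * b = a * t := by
  calc t * b = t * (b * t) * t := by rw [mul_assoc, mul_assoc, ht, mul_one]
    _ = a * t := by rw [← h, ← mul_assoc, ht, one_mul]

theorem mk_ft_sq {k : ℕ} (hk : k < rank X n) :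
    mk X n u v (ft X n k) * mk X n u v (ft X n k) = 1 := by
  have := mk_rel X n u v (Rel.t_sq k hk)
  rwa [pow_two, map_mul, map_one] at this

theorem oddRefl_step {k : ℕ} (hk : k + 1 < n) :
    OddRefl u v (stepRoot n k hk) (mk X n u v (ft X n k)) := by
  refine ⟨⟨_, _, isSigned_stepRoot hk, fun j => ?_⟩, mk_ft_mem X n u v k⟩
  have hy := mk_rel X n u v (Rel.t_y (X := X) ⟨k, by omega⟩ ⟨k + 1, hk⟩ rfl)
  have hx := mk_rel X n u v (Rel.t_xi (X := X) ⟨k, by omega⟩ ⟨k + 1, hk⟩ rfl)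
  simp only [map_mul, map_neg] at hy hx
  have ht := mk_ft_sq (u := u) (v := v) (lt_rank (X := X) hk)
  have hx' := mul_eq_of_involution ht (hx.trans (neg_mul _ _).symm)
  rw [Pi.one_apply, one_smul]
  by_cases h1 : j = ⟨k, by omega⟩
  · subst h1
    rw [Equiv.swap_apply_left]
    exact ⟨hy, hx⟩
  · by_cases h2 : j = ⟨k + 1, hk⟩
    · subst h2
      rw [Equiv.swap_apply_right]
      refine ⟨mul_eq_of_involution ht hy, ?_⟩
      rw [mul_neg, neg_eq_iff_eq_neg] at hx'
      exact hx'
    · rw [Equiv.swap_apply_of_ne_of_ne h1 h2]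
      have h1' : (j : ℕ) ≠ k := fun h => h1 (Fin.ext h)
      have h2' : (j : ℕ) ≠ k + 1 := fun h => h2 (Fin.ext h)
      have hy := mk_rel X n u v (Rel.t_y_far (X := X) k hk j h1' h2')
      have hx := mk_rel X n u v (Rel.t_xi_far (X := X) k hk j h1' h2')
      simp only [map_mul, map_neg] at hy hx
      exact ⟨hy, hx⟩

theorem oddRefl_last_B (hn : 2 ≤ n) :
    OddRefl u v (shortRoot ⟨n - 1, by omega⟩) (mk .B n u v (ft .B n (n - 1))) := by
  refine ⟨⟨_, _, isSigned_shortRoot _, fun j => ?_⟩, mk_ft_mem .B n u v _⟩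
  rw [Equiv.Perm.one_apply]
  by_cases h1 : (j : ℕ) + 1 = n
  · have hy := mk_rel .B n u v (Rel.tn_y_B j h1)
    have hx := mk_rel .B n u v (Rel.tn_xi_B j h1)
    simp only [map_mul, map_neg] at hy hx
    have e : sgn ⟨n - 1, by omega⟩ ⟨n - 1, by omega⟩ j = -1 :=
      if_pos (Or.inl (by ext; simp only []; omega))
    rw [e, neg_one_smul]
    exact ⟨hy, hx⟩
  · have hy := mk_rel .B n u v (Rel.tn_y_far_B j (by omega))
    have hx := mk_rel .B n u v (Rel.tn_xi_far_B j (by omega))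
    simp only [map_mul, map_neg] at hy hx
    have e : sgn ⟨n - 1, by omega⟩ ⟨n - 1, by omega⟩ j = 1 :=
      if_neg (by rw [or_self, Fin.ext_iff]; simp only []; omega)
    rw [e, one_smul]
    exact ⟨hy, hx⟩

theorem oddRefl_last_D (hn : 2 ≤ n) :
    OddRefl u v (plusRoot ⟨n - 2, by omega⟩ ⟨n - 1, by omega⟩)
      (mk .D n u v (ft .D n (n - 1))) := by
  refine ⟨⟨_, _, isSigned_lastRoot_D hn, fun j => ?_⟩, mk_ft_mem .D n u v _⟩
  have hy := mk_rel .D n u v (Rel.tn_y_D ⟨n - 2, by omega⟩ ⟨n - 1, by omega⟩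
    (by simp only []; omega) (by simp only []; omega))
  have hx := mk_rel .D n u v (Rel.tn_xi_D ⟨n - 2, by omega⟩ ⟨n - 1, by omega⟩
    (by simp only []; omega) (by simp only []; omega))
  simp only [map_mul, map_neg] at hy hx
  have ht := mk_ft_sq (u := u) (v := v) (X := .D) (n := n) (k := n - 1) (by simp [rank]; omega)
  have hy' := mul_eq_of_involution ht (hy.trans (neg_mul _ _).symm)
  have hx' := mul_eq_of_involution ht (hx.trans (neg_mul _ _).symm)
  rw [mul_neg, neg_eq_iff_eq_neg] at hx' hy'
  by_cases h1 : j = ⟨n - 2, by omega⟩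
  · rw [h1, Equiv.swap_apply_left, sgn, if_pos (Or.inl rfl), neg_one_smul]
    exact ⟨hy', hx'⟩
  · by_cases h2 : j = ⟨n - 1, by omega⟩
    · rw [h2, Equiv.swap_apply_right, sgn, if_pos (Or.inr rfl), neg_one_smul]
      exact ⟨hy, hx⟩
    · rw [Equiv.swap_apply_of_ne_of_ne h1 h2, sgn, if_neg (by simp [h1, h2]), one_smul]
      rw [Fin.ext_iff] at h1 h2
      simp only [] at h1 h2
      have hy := mk_rel .D n u v (Rel.tn_y_far_D j (by omega))
      have hx := mk_rel .D n u v (Rel.tn_xi_far_D j (by omega))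
      simp only [map_mul, map_neg] at hy hx
      exact ⟨hy, hx⟩

theorem OddRefl.neg {α : Fin n → ℂ} {g : SDaHa X n u v} (h : OddRefl u v α g) :
    OddRefl u v (-α) (-g) := by
  obtain ⟨σ, ε, hα, hg⟩ := h.exists_signed
  refine ⟨⟨σ, ε, hα.neg, fun k => ?_⟩, neg_mem h.mem⟩
  rw [neg_mul, neg_mul, (hg k).1, (hg k).2, mul_neg, mul_neg, smul_neg]
  exact ⟨rfl, rfl⟩

theorem OddRefl.conj {α β : Fin n → ℂ} {g t : SDaHa X n u v} (ht : OddRefl u v β t)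
    (h : OddRefl u v α g) : OddRefl u v (refl β α) (-(t * g * t)) := by
  obtain ⟨σ, ε, hα, hg⟩ := h.exists_signed
  obtain ⟨τ, δ, hβ, ht'⟩ := ht.exists_signed
  refine ⟨⟨_, _, hβ.conj hα, fun k => ?_⟩, neg_mem (mul_mem (mul_mem ht.mem h.mem) ht.mem)⟩
  constructor
  · calc -(t * g * t) * gen X n u v (.y k) = -(t * g * (t * gen X n u v (.y k))) := by noncomm_ring
      _ = -(δ k • (t * (g * gen X n u v (.y (τ k))) * t)) := by
        rw [(ht' k).1, mul_smul_comm]; simp only [mul_assoc]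
      _ = -((δ k * ε (τ k)) • ((t * gen X n u v (.y (σ (τ k)))) * g * t)) := by
        rw [(hg (τ k)).1, mul_smul_comm, smul_mul_assoc, smul_smul]; simp only [mul_assoc]
      _ = _ := by
        rw [(ht' (σ (τ k))).1, smul_mul_assoc, smul_mul_assoc, smul_smul, mul_neg, smul_neg]
        simp only [mul_assoc]
        rfl
  · calc -(t * g * t) * gen X n u v (.xi k)
        = -(t * g * (t * gen X n u v (.xi k))) := by noncomm_ring
      _ = t * (g * gen X n u v (.xi (τ k))) * t := by
        rw [(ht' k).2]; noncomm_ring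
      _ = -((t * gen X n u v (.xi (σ (τ k)))) * g * t) := by
        rw [(hg (τ k)).2]; noncomm_ring
      _ = _ := by
        rw [(ht' (σ (τ k))).2, Equiv.Perm.mul_apply, Equiv.Perm.mul_apply]
        noncomm_ring

theorem isReflFamily_oddRefl : IsReflFamily (mk X n u v) (OddRefl u v) where
  step _ hk := oddRefl_step hk
  conj _ hk _ _ hg := (oddRefl_step hk).conj hg
  neg _ _ hg := hg.neg

theorem oddRefl_bra {i j : Fin n} (hij : i ≠ j) :
    OddRefl u v (minusRoot i j) (mk X n u v (bra X i j)) :=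
  isReflFamily_oddRefl.bra hij

theorem bar_A {n : ℕ} (i j : Fin n) : bar .A i j = 0 := by simp [bar, barLt]

theorem oddRefl_bar (hn : Admissible X n) {i j : Fin n} (hij : i ≠ j) :
    OddRefl u v (plusRoot i j) (mk X n u v (bar X i j)) := by
  cases X with
  | A => rw [bar_A, map_zero]; exact (isSigned_plusRoot hij).oddRefl_zero
  | B =>
    refine isReflFamily_oddRefl.bar_B hn ?_ hij
    rw [← refl_lastRoot_B hn]
    exact (oddRefl_last_B hn).conj (oddRefl_step _)
  | D =>
    have hn4 : 4 ≤ n := hn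
    exact isReflFamily_oddRefl.bar_D (by omega) (oddRefl_last_D (by omega)) hij

variable (X u v)

/-- The element `overline{[i]}` in type `B`, and `0` otherwise. -/
def shortElt (i : Fin n) : SDaHa X n u v :=
  match X with
  | .A => 0
  | .B => mk .B n u v (barOne i)
  | .D => 0

variable {X u v}

theorem oddRefl_shortElt (hn : Admissible X n) (i : Fin n) :
    OddRefl u v (shortRoot i) (shortElt X u v i) := by
  cases X with
  | A => exact (isSigned_shortRoot i).oddRefl_zero
  | B =>
    have hn2 : 2 ≤ n := hn
    exact isReflFamily_oddRefl.barOne (by omega) (oddRefl_last_B hn) i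
  | D => exact (isSigned_shortRoot i).oddRefl_zero

theorem bra_swap {i j : Fin n} (hij : i ≠ j) : bra X j i = -bra X i j := by
  rcases lt_or_gt_of_ne hij with h | h
  · rw [bra, bra, if_pos h, if_neg h.asymm]
  · rw [bra, bra, if_pos h, if_neg h.asymm, neg_neg]

theorem bar_swap {i j : Fin n} (hij : i ≠ j) : bar X j i = bar X i j := by
  rcases lt_or_gt_of_ne hij with h | h
  · rw [bar, bar, if_pos h, if_neg h.asymm]
  · rw [bar, bar, if_pos h, if_neg h.asymm]

theorem y_mul_xi {i j : Fin n} (hij : i ≠ j) :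
    gen X n u v (.y j) * gen X n u v (.xi i) - gen X n u v (.xi i) * gen X n u v (.y j) =
      -(u • mk X n u v (bra X i j)) + u • mk X n u v (bar X i j) := by
  cases X with
  | A =>
    have h := mk_rel .A n u v (Rel.comm_A i j hij)
    simp only [map_sub, map_mul, map_neg, map_smul] at h
    rw [bar_A, map_zero, smul_zero, add_zero]
    exact h
  | B =>
    have h := mk_rel .B n u v (Rel.comm_B i j hij)
    simp only [map_sub, map_mul, map_neg, map_smul, map_add] at h
    exact h
  | D =>
    have h := mk_rel .D n u v (Rel.comm_D i j hij)
    simp only [map_sub, map_mul, map_neg, map_smul, map_add] at h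
    exact h

theorem y_mul_xi_self (i : Fin n) :
    gen X n u v (.y i) * gen X n u v (.xi i) - gen X n u v (.xi i) * gen X n u v (.y i) =
      ∑ k ∈ Finset.univ.erase i, (u • mk X n u v (bra X i k) + u • mk X n u v (bar X i k)) +
        v • shortElt X u v i := by
  cases X with
  | A =>
    have h := mk_rel .A n u v (Rel.comm_self_A i)
    simp only [map_sub, map_mul, map_smul, map_sum, Finset.smul_sum] at h
    simp only [bar_A, map_zero, smul_zero, add_zero, shortElt]
    exact h
  | B =>
    have h := mk_rel .B n u v (Rel.comm_self_B i)
    simp only [map_sub, map_mul, map_smul, map_sum, map_add, Finset.smul_sum, smul_add] at h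
    exact h
  | D =>
    have h := mk_rel .D n u v (Rel.comm_self_D i)
    simp only [map_sub, map_mul, map_smul, map_sum, map_add, Finset.smul_sum, smul_add] at h
    simp only [shortElt, smul_zero, add_zero]
    exact h

/-! ### Commutators expressed by divided differences -/

/-- Commutators with an element that is a twisted derivation on the variables. -/
theorem commutator_eq_sum {A R : Type} [Ring R] [Algebra ℂ R] (s : Finset A) (α : A → Fin n → ℂ)
    (g : A → R) (Y : MvPolynomial (Fin n) ℂ →ₐ[ℂ] R) (x : R) (hα : ∀ a ∈ s, α a ≠ 0)
    (hg : ∀ a ∈ s, ∀ f, g a * Y f = Y (polyRefl (α a) f) * g a)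
    (hX : ∀ j, Y (MvPolynomial.X j) * x - x * Y (MvPolynomial.X j) =
      ∑ a ∈ s, Y (divDiff (α a) (MvPolynomial.X j)) * g a) (f : MvPolynomial (Fin n) ℂ) :
    Y f * x - x * Y f = ∑ a ∈ s, Y (divDiff (α a) f) * g a := by
  induction f using MvPolynomial.induction_on with
  | C c =>
    rw [Finset.sum_eq_zero fun a ha => by rw [divDiff_C (hα a ha), map_zero, zero_mul],
      ← algebraMap_eq, AlgHom.commutes, Algebra.commutes, sub_self]
  | add p q hp hq =>
    simp only [map_add, add_mul, mul_add, Finset.sum_add_distrib, ← hp, ← hq]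
    abel
  | mul_X p i hp =>
    have h1 : Y (p * MvPolynomial.X i) * x - x * Y (p * MvPolynomial.X i) =
        Y p * (Y (MvPolynomial.X i) * x - x * Y (MvPolynomial.X i)) +
          (Y p * x - x * Y p) * Y (MvPolynomial.X i) := by
      rw [map_mul]; noncomm_ring
    rw [h1, hp, hX, Finset.mul_sum, Finset.sum_mul, ← Finset.sum_add_distrib]
    refine Finset.sum_congr rfl fun a ha => ?_
    -- Moving `g a` past `Y (X i)` produces exactly the reflected factor in the twisted Leibniz rule
    -- of `divDiff`.
    rw [divDiff_mul (hα a ha), map_add, map_mul, map_mul, mul_assoc (Y _) (g a), hg a ha]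
    noncomm_ring

theorem commute_of_invariant {A R : Type} [Ring R] [Algebra ℂ R] (s : Finset A)
    (α : A → Fin n → ℂ) (g : A → R) (Y : MvPolynomial (Fin n) ℂ →ₐ[ℂ] R) (x : R)
    (hα : ∀ a ∈ s, α a ≠ 0) (hg : ∀ a ∈ s, ∀ f, g a * Y f = Y (polyRefl (α a) f) * g a)
    (hX : ∀ j, Y (MvPolynomial.X j) * x - x * Y (MvPolynomial.X j) =
      ∑ a ∈ s, Y (divDiff (α a) (MvPolynomial.X j)) * g a) (f : MvPolynomial (Fin n) ℂ)
    (hf : ∀ a ∈ s, polyRefl (α a) f = f ∨ g a = 0) : Commute (Y f) x := by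
  have h := commutator_eq_sum s α g Y x hα hg hX f
  rw [Finset.sum_eq_zero, sub_eq_zero] at h
  · exact h
  · intro a ha
    rcases hf a ha with h1 | h1
    · rw [divDiff_of_invariant (hα a ha) h1, map_zero, zero_mul]
    · rw [h1, mul_zero]

theorem OddRefl.mul_yHom {α : Fin n → ℂ} {g : SDaHa X n u v} (h : OddRefl u v α g)
    (f : MvPolynomial (Fin n) ℂ) :
    g * yHom X n u v f = yHom X n u v (polyRefl α f) * g := by
  obtain ⟨σ, ε, hα, hg⟩ := h.exists_signed
  induction f using MvPolynomial.induction_on with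
  | C c => rw [← algebraMap_eq, AlgHom.commutes, AlgHom.commutes, AlgHom.commutes, Algebra.commutes]
  | add p q hp hq => simp only [map_add, add_mul, mul_add, hp, hq]
  | mul_X p i hp =>
    rw [map_mul, map_mul, map_mul, ← mul_assoc, hp, mul_assoc, yHom_X, (hg i).1, hα.polyRefl_X,
      map_smul, yHom_X, mul_assoc, smul_mul_assoc]

/-- Passing `ξ_k` costs a sign, hence passing `ξ_k²` costs none; the signs `ε` play no role. -/
theorem OddRefl.mul_xiSqHom {α : Fin n → ℂ} {g : SDaHa X n u v} (h : OddRefl u v α g)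
    {σ : Equiv.Perm (Fin n)} {ε : Fin n → ℂ} (hα : IsSigned α σ ε) (f : MvPolynomial (Fin n) ℂ) :
    g * xiSqHom X n u v f = xiSqHom X n u v (rename σ f) * g := by
  induction f using MvPolynomial.induction_on with
  | C c => rw [rename_C, ← algebraMap_eq, AlgHom.commutes, Algebra.commutes]
  | add p q hp hq => simp only [map_add, add_mul, mul_add, hp, hq]
  | mul_X p i hp =>
    have e : g * gen X n u v (.xi i) ^ 2 = gen X n u v (.xi (σ i)) ^ 2 * g := by
      rw [pow_two, ← mul_assoc, h.mul_xi hα, neg_mul, mul_assoc, h.mul_xi hα, mul_neg, neg_neg,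
        ← mul_assoc, pow_two]
    rw [map_mul, map_mul, map_mul, ← mul_assoc, hp, mul_assoc, xiSqHom_X, e, rename_X, xiSqHom_X,
      mul_assoc]

theorem commute_xi_xiSqHom (i : Fin n) (f : MvPolynomial (Fin n) ℂ) :
    Commute (gen X n u v (.xi i)) (xiSqHom X n u v f) := by
  induction f using MvPolynomial.induction_on with
  | C c => rw [← algebraMap_eq, AlgHom.commutes]; exact (Algebra.commutes c _).symm
  | add p q hp hq => rw [map_add]; exact hp.add_right hq
  | mul_X p k hp =>
    rw [map_mul, xiSqHom_X]
    refine hp.mul_right ?_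
    by_cases hik : i = k
    · rw [hik]; exact (Commute.refl _).pow_right 2
    · have h := xi_mul_xi X n u v hik
      unfold Commute SemiconjBy
      rw [pow_two, ← mul_assoc, h, neg_mul, mul_assoc, h, mul_neg, neg_neg, mul_assoc]

theorem polyRefl_minusRoot {i j : Fin n} (hij : i ≠ j) :
    polyRefl (minusRoot i j) = rename (Equiv.swap i j) := by
  ext1 k
  rw [(isSigned_minusRoot hij).polyRefl_X, rename_X, Pi.one_apply, one_smul]

end Commutators

end SpinDaHa

namespace SpinDaHa

/-! ### Invariants are central -/

section Center

variable {X : ClassicalType} {n : ℕ} {u v : ℂ}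

theorem polyAct_of_mem {f : MvPolynomial (Fin n) ℂ} (hf : f ∈ invariants X n) {w : SignedPerm n}
    (hw : w ∈ weylGroup X n) : polyAct w f = f := by
  simp only [invariants, Algebra.mem_iInf] at hf
  exact hf w hw

theorem mem_invariants {f : MvPolynomial (Fin n) ℂ} (h : ∀ w : SignedPerm n, polyAct w f = f) :
    f ∈ invariants X n := by
  simp only [invariants, Algebra.mem_iInf]
  exact fun w _ => h w

theorem inr_mem_weylGroup (σ : Equiv.Perm (Fin n)) :
    (SemidirectProduct.inr σ : SignedPerm n) ∈ weylGroup X n := by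
  cases X with
  | A => exact ⟨σ, rfl⟩
  | B => exact Subgroup.mem_top _
  | D => simp [weylGroup, MonoidHom.mem_ker, signProd]

theorem polyAct_inr (σ : Equiv.Perm (Fin n)) :
    polyAct (SemidirectProduct.inr σ : SignedPerm n) = rename σ := by
  ext1 i
  simp [polyAct]

theorem polyRefl_minusRoot_of_mem {f : MvPolynomial (Fin n) ℂ} (hf : f ∈ invariants X n)
    {i j : Fin n} (hij : i ≠ j) : polyRefl (minusRoot i j) f = f := by
  rw [polyRefl_minusRoot hij, ← polyAct_inr]
  exact polyAct_of_mem hf (inr_mem_weylGroup _)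

/-- The signed permutation that is the reflection in `e_i + e_j`, or in `e_i` if `i = j`. -/
def signedSwap (i j : Fin n) : SignedPerm n :=
  ⟨fun k => if k = i ∨ k = j then -1 else 1, Equiv.swap i j⟩

theorem polyAct_signedSwap (i j k : Fin n) :
    polyAct (signedSwap i j) (MvPolynomial.X k) =
      sgn i j k • MvPolynomial.X (Equiv.swap i j k) := by
  -- `polyAct` reads the sign at the image of `k`, while `sgn` reads it at `k`; the set `{i, j}` is
  -- stable under the swap.
  have h : (Equiv.swap i j k = i ∨ Equiv.swap i j k = j) ↔ (k = i ∨ k = j) := by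
    rw [← Equiv.eq_symm_apply, ← Equiv.eq_symm_apply]
    simp [or_comm]
  simp only [polyAct, signedSwap, aeval_X, h, sgn, smul_eq_C_mul]
  split_ifs <;> simp

theorem signedSwap_mem_D {i j : Fin n} (hij : i ≠ j) : signedSwap i j ∈ weylGroup .D n := by
  have h : (Finset.univ.filter fun k => k = i ∨ k = j) = {i, j} := by ext; simp
  simp [weylGroup, MonoidHom.mem_ker, signProd, signedSwap, Finset.prod_ite, h,
    Finset.card_pair hij]

theorem polyRefl_plusRoot {i j : Fin n} (hij : i ≠ j) :
    polyRefl (plusRoot i j) = polyAct (signedSwap i j) := by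
  ext1 k
  rw [(isSigned_plusRoot hij).polyRefl_X, polyAct_signedSwap]

theorem polyRefl_shortRoot (i : Fin n) :
    polyRefl (shortRoot i) = polyAct (signedSwap i i) := by
  ext1 k
  rw [(isSigned_shortRoot i).polyRefl_X, polyAct_signedSwap]
  simp

theorem polyRefl_plusRoot_of_mem {f : MvPolynomial (Fin n) ℂ} (hf : f ∈ invariants X n)
    {i j : Fin n} (hij : i ≠ j) : polyRefl (plusRoot i j) f = f ∨ X = .A := by
  rw [polyRefl_plusRoot hij]
  cases X with
  | A => exact Or.inr rfl
  | B => exact Or.inl (polyAct_of_mem hf (Subgroup.mem_top _))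
  | D => exact Or.inl (polyAct_of_mem hf (signedSwap_mem_D hij))

theorem polyRefl_shortRoot_of_mem {f : MvPolynomial (Fin n) ℂ} (hf : f ∈ invariants X n)
    (i : Fin n) : polyRefl (shortRoot i) f = f ∨ shortElt X u v i = 0 := by
  rw [polyRefl_shortRoot]
  cases X with
  | A => exact Or.inr rfl
  | B => exact Or.inl (polyAct_of_mem hf (Subgroup.mem_top _))
  | D => exact Or.inr rfl

/-- The indices of the roots not orthogonal to `e_i`: `e_i - e_k`, `e_i + e_k` and `e_i`. -/
def rootIndex (i : Fin n) : Finset ((Fin n ⊕ Fin n) ⊕ Unit) :=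
  ((Finset.univ.erase i).disjSum (Finset.univ.erase i)).disjSum Finset.univ

/-- The roots not orthogonal to `e_i`. -/
def rootVec (i : Fin n) : (Fin n ⊕ Fin n) ⊕ Unit → Fin n → ℂ :=
  Sum.elim (Sum.elim (minusRoot i) (plusRoot i)) fun _ => shortRoot i

theorem mem_rootIndex {i : Fin n} {P : (Fin n ⊕ Fin n) ⊕ Unit → Prop}
    (h1 : ∀ k, i ≠ k → P (.inl (.inl k))) (h2 : ∀ k, i ≠ k → P (.inl (.inr k)))
    (h3 : P (.inr ())) : ∀ a ∈ rootIndex i, P a := by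
  rintro ((k | k) | k) ha
  · exact h1 k (by simpa [rootIndex, eq_comm] using ha)
  · exact h2 k (by simpa [rootIndex, eq_comm] using ha)
  · exact h3

variable (X u v)

/-- The odd reflections that occur in the commutators of `ξ_i` with polynomials in the `y_j`. -/
def rootElt (i : Fin n) : (Fin n ⊕ Fin n) ⊕ Unit → SDaHa X n u v :=
  Sum.elim (Sum.elim (fun k => (u * rt) • mk X n u v (bra X i k))
    fun k => (u * rt) • mk X n u v (bar X i k)) fun _ => (v / 2) • shortElt X u v i

variable {X u v}

/-- On variables divided differences are constants, `∂_α X_j = 2 α_j`, so this is a rewriting of the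
defining commutators. The weights `u * rt` and `v / 2` are the same as for the Dunkl operators. -/
theorem y_mul_xi_eq_sum (i j : Fin n) :
    yHom X n u v (MvPolynomial.X j) * gen X n u v (.xi i) -
      gen X n u v (.xi i) * yHom X n u v (MvPolynomial.X j) =
    ∑ a ∈ rootIndex i, yHom X n u v (divDiff (rootVec i a) (MvPolynomial.X j)) *
      rootElt X u v i a := by
  have hd : ∀ a ∈ rootIndex i, yHom X n u v (divDiff (rootVec i a) (MvPolynomial.X j)) *
      rootElt X u v i a = (2 * (rootVec i a j)) • rootElt X u v i a := by
    intro a ha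
    have h0 : rootVec i a ≠ 0 := by
      revert a
      exact mem_rootIndex (fun k hk => ne_zero_of_unit (isSigned_minusRoot hk).unit)
        (fun k hk => ne_zero_of_unit (isSigned_plusRoot hk).unit)
        (ne_zero_of_unit (isSigned_shortRoot i).unit)
    rw [← lin_single, divDiff_lin h0, ← algebraMap_eq, AlgHom.commutes, ← Algebra.smul_def]
    simp
  have hu : 2 * rt * (u * rt) = u := by linear_combination 2 * u * rt_mul_rt
  rw [Finset.sum_congr rfl hd, rootIndex, Finset.sum_disjSum, Finset.sum_disjSum, yHom_X]
  simp only [rootVec, rootElt, Sum.elim_inl, Sum.elim_inr, Finset.univ_unique, Finset.sum_singleton,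
    smul_smul]
  rw [← Finset.sum_add_distrib]
  by_cases hij : i = j
  · subst hij
    rw [y_mul_xi_self]
    congr 1
    · refine Finset.sum_congr rfl fun k hk => ?_
      have hk := Finset.ne_of_mem_erase hk
      simp [minusRoot, plusRoot, hk.symm, hu]
    · simp [shortRoot]
      congr 1
      ring
  · rw [y_mul_xi hij, Finset.sum_eq_single j]
    · simp [minusRoot, plusRoot, shortRoot, Ne.symm hij, hu]
    · intro k hk hkj
      simp [minusRoot, plusRoot, Ne.symm hij, Ne.symm hkj]
    · intro hj
      exact absurd (Finset.mem_erase.2 ⟨Ne.symm hij, Finset.mem_univ j⟩) hj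

theorem commute_yHom_xi (hn : Admissible X n) {f : MvPolynomial (Fin n) ℂ}
    (hf : f ∈ invariants X n) (i : Fin n) :
    Commute (yHom X n u v f) (gen X n u v (.xi i)) := by
  refine commute_of_invariant (rootIndex i) (rootVec i) (rootElt X u v i) _ _ ?_ ?_
    (y_mul_xi_eq_sum i) f ?_
  · exact mem_rootIndex (fun k hk => ne_zero_of_unit (isSigned_minusRoot hk).unit)
        (fun k hk => ne_zero_of_unit (isSigned_plusRoot hk).unit)
        (ne_zero_of_unit (isSigned_shortRoot i).unit)
  · refine mem_rootIndex (fun k hk f => ?_) (fun k hk f => ?_) (fun f => ?_) <;>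
    simp only [rootElt, rootVec, Sum.elim_inl, Sum.elim_inr, smul_mul_assoc, mul_smul_comm]
    · rw [(oddRefl_bra hk).mul_yHom]
    · rw [(oddRefl_bar hn hk).mul_yHom]
    · rw [(oddRefl_shortElt hn i).mul_yHom]
  · refine mem_rootIndex (fun k hk => Or.inl (polyRefl_minusRoot_of_mem hf hk)) (fun k hk => ?_) ?_
    · refine (polyRefl_plusRoot_of_mem hf hk).imp id ?_
      rintro rfl
      simp [rootElt, bar_A]
    · refine (polyRefl_shortRoot_of_mem (u := u) (v := v) hf i).imp id fun h => ?_
      simp [rootElt, h]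

theorem gen_t_eq (k : Fin (rank X n)) : gen X n u v (.t k) = mk X n u v (ft X n k) := by
  rw [ft, dif_pos k.2]; rfl

theorem oddRefl_t (hn : Admissible X n) (k : Fin (rank X n)) :
    ∃ α, OddRefl u v α (gen X n u v (.t k)) ∧ (∀ f ∈ invariants X n, polyRefl α f = f) := by
  rw [gen_t_eq]
  rcases lt_of_lt_rank hn k.2 with h | ⟨h, ⟨rfl, h2⟩ | ⟨rfl, h4⟩⟩
  · exact ⟨_, oddRefl_step h, fun f hf => polyRefl_minusRoot_of_mem hf (by simp)⟩
  · rw [h]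
    refine ⟨_, oddRefl_last_B h2, fun f hf => ?_⟩
    rw [polyRefl_shortRoot]
    exact polyAct_of_mem hf (Subgroup.mem_top _)
  · rw [h]
    refine ⟨_, oddRefl_last_D (by omega), fun f hf => ?_⟩
    exact (polyRefl_plusRoot_of_mem hf (by simp; omega)).resolve_right (by simp)

theorem adjoin_gen : Algebra.adjoin ℂ (Set.range (gen X n u v)) = ⊤ := by
  have h : Function.Surjective (mk X n u v) := RingQuot.mkAlgHom_surjective ℂ _
  have h1 := congrArg (Subalgebra.map (mk X n u v)) (FreeAlgebra.adjoin_range_ι ℂ (Gen X n))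
  rw [AlgHom.map_adjoin, Algebra.map_top, (AlgHom.range_eq_top _).2 h, ← Set.range_comp] at h1
  exact h1

theorem mem_center_of_commute {z : SDaHa X n u v} (h : ∀ g, Commute z (gen X n u v g)) :
    z ∈ Subalgebra.center ℂ (SDaHa X n u v) := by
  rw [Subalgebra.mem_center_iff]
  intro b
  have hb : b ∈ Algebra.adjoin ℂ (Set.range (gen X n u v)) := by rw [adjoin_gen]; trivial
  induction hb using Algebra.adjoin_induction with
  | mem x hx => obtain ⟨g, rfl⟩ := hx; exact (h g).symm.eq
  | algebraMap r => exact Algebra.commutes r z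
  | add x y _ _ hx hy => rw [add_mul, mul_add, hx, hy]
  | mul x y _ _ hx hy => rw [mul_assoc, hy, ← mul_assoc, hx, mul_assoc]

theorem yHom_mem_evenPart (f : MvPolynomial (Fin n) ℂ) :
    yHom X n u v f ∈ evenPart X n u v := by
  induction f using MvPolynomial.induction_on with
  | C c => rw [← algebraMap_eq, AlgHom.commutes]; exact algebraMap_mem _ c
  | add p q hp hq => rw [map_add]; exact add_mem hp hq
  | mul_X p i hp =>
    rw [map_mul, yHom_X]
    exact mul_mem hp (Submodule.subset_span ⟨[.y i], by simp [parity], by simp⟩)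

theorem xiSqHom_mem_evenPart (f : MvPolynomial (Fin n) ℂ) :
    xiSqHom X n u v f ∈ evenPart X n u v := by
  induction f using MvPolynomial.induction_on with
  | C c => rw [← algebraMap_eq, AlgHom.commutes]; exact algebraMap_mem _ c
  | add p q hp hq => rw [map_add]; exact add_mem hp hq
  | mul_X p i hp =>
    rw [map_mul, xiSqHom_X]
    exact mul_mem hp (Submodule.subset_span ⟨[.xi i, .xi i], by simp [parity]; decide,
      by simp [pow_two]⟩)

theorem commute_y_yHom (i : Fin n) (f : MvPolynomial (Fin n) ℂ) :
    Commute (yHom X n u v f) (gen X n u v (.y i)) := by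
  rw [← yHom_X]
  exact (Commute.all f (MvPolynomial.X i)).map (yHom X n u v)

theorem yHom_mem_evenCenter (hn : Admissible X n) {f : MvPolynomial (Fin n) ℂ}
    (hf : f ∈ invariants X n) : yHom X n u v f ∈ evenCenter X n u v := by
  refine ⟨yHom_mem_evenPart f, mem_center_of_commute fun g => ?_⟩
  cases g with
  | y i => exact commute_y_yHom i f
  | xi i => exact commute_yHom_xi hn hf i
  | t k =>
    obtain ⟨α, h, hα⟩ := oddRefl_t (u := u) (v := v) hn k
    have := h.mul_yHom f
    rw [hα f hf] at this
    exact this.symm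

/-- The Weyl group of each type contains all permutations, and `expand 2` is injective and commutes
with them. -/
theorem rename_of_mem {f : MvPolynomial (Fin n) ℂ} (hf : f ∈ squareInvariants X n)
    (σ : Equiv.Perm (Fin n)) : rename σ f = f := by
  have h := polyAct_of_mem hf (inr_mem_weylGroup σ)
  rw [polyAct_inr] at h
  refine expand_injective (n := 2) two_pos (Eq.trans ?_ h)
  have : (expand 2).comp (rename σ) =
      (rename σ : MvPolynomial (Fin n) ℂ →ₐ[ℂ] _).comp (expand 2) := by
    ext1 i; simp
  exact DFunLike.congr_fun this f

/-- The elements that occur in the commutators of `y_j` with polynomials in the `ξ_i²`. -/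
def xiElt (j k : Fin n) : SDaHa X n u v :=
  (gen X n u v (.xi j) - gen X n u v (.xi k)) *
    (u • mk X n u v (bra X j k) + u • mk X n u v (bar X j k))

theorem OddRefl.mul_xi_minus {j k : Fin n} (hjk : j ≠ k) {g : SDaHa X n u v}
    (h : OddRefl u v (minusRoot j k) g) :
    g * gen X n u v (.xi j) = -(gen X n u v (.xi k) * g) := by
  rw [h.mul_xi (isSigned_minusRoot hjk), Equiv.swap_apply_left]

theorem OddRefl.mul_xi_plus {j k : Fin n} (hjk : j ≠ k) {g : SDaHa X n u v}
    (h : OddRefl u v (plusRoot j k) g) :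
    g * gen X n u v (.xi j) = -(gen X n u v (.xi k) * g) := by
  rw [h.mul_xi (isSigned_plusRoot hjk), Equiv.swap_apply_left]

/-- Expand `[ξ_i², y_j]` through `[y_j, ξ_i]`: each odd reflection `θ` in `e_i ± e_k` contributes `θ
ξ_i + ξ_i θ = (ξ_i - ξ_k) θ`, and the one in `e_i` contributes nothing. Both signs share the divided
difference of `e_j - e_k`, as both transpose `ξ_j²` and `ξ_k²`. -/
theorem xiSq_mul_y_eq_sum (hn : Admissible X n) (j i : Fin n) :
    xiSqHom X n u v (MvPolynomial.X i) * gen X n u v (.y j) -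
      gen X n u v (.y j) * xiSqHom X n u v (MvPolynomial.X i) =
    ∑ k ∈ Finset.univ.erase j, xiSqHom X n u v (divDiff (minusRoot j k) (MvPolynomial.X i)) *
      (-rt • xiElt j k) := by
  have hd : ∀ k ∈ Finset.univ.erase j,
      xiSqHom X n u v (divDiff (minusRoot j k) (MvPolynomial.X i)) * (-rt • xiElt j k) =
      (-2 * rt * minusRoot j k i) • xiElt (u := u) (v := v) j k := by
    intro k hk
    have hjk := (Finset.ne_of_mem_erase hk).symm
    rw [← lin_single, divDiff_lin (ne_zero_of_unit (isSigned_minusRoot hjk).unit), ← algebraMap_eq,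
      AlgHom.commutes, ← Algebra.smul_def, smul_smul]
    congr 1
    simp
    ring
  have hr : 2 * rt * rt = 1 := by linear_combination 2 * rt_mul_rt
  have hx : ∀ a b : SDaHa X n u v, b ^ 2 * a - a * b ^ 2 =
      -((a * b - b * a) * b + b * (a * b - b * a)) := by
    intro a b; noncomm_ring
  rw [Finset.sum_congr rfl hd, xiSqHom_X, hx]
  by_cases hij : i = j
  · subst hij
    have hs := (oddRefl_shortElt (u := u) (v := v) hn i).mul_xi (isSigned_shortRoot i) i
    rw [Equiv.Perm.one_apply] at hs
    rw [y_mul_xi_self, add_mul, mul_add, add_add_add_comm, smul_mul_assoc, mul_smul_comm, hs,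
      smul_neg, neg_add_cancel, add_zero, Finset.sum_mul, Finset.mul_sum, ← Finset.sum_add_distrib,
      ← Finset.sum_neg_distrib]
    refine Finset.sum_congr rfl fun k hk => ?_
    have hik := (Finset.ne_of_mem_erase hk).symm
    have hc : -2 * rt * minusRoot i k i = -1 := by
      simp [minusRoot, hik]
      exact hr
    rw [hc, neg_one_smul, xiElt, add_mul, smul_mul_assoc, smul_mul_assoc,
      (oddRefl_bra hik).mul_xi_minus hik, (oddRefl_bar hn hik).mul_xi_plus hik, smul_neg, smul_neg,
      ← smul_mul_assoc, ← smul_mul_assoc]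
    simp only [mul_add, sub_mul, smul_mul_assoc, mul_smul_comm, smul_sub]
    abel
  · rw [y_mul_xi hij, Finset.sum_eq_single i]
    · have hc : -2 * rt * minusRoot j i i = 1 := by
        simp [minusRoot, hij]
        exact hr
      rw [hc, one_smul, xiElt, bra_swap hij, bar_swap hij, map_neg, add_mul, neg_mul,
        smul_mul_assoc, smul_mul_assoc, (oddRefl_bra hij).mul_xi_minus hij,
        (oddRefl_bar hn hij).mul_xi_plus hij]
      simp only [mul_add, sub_mul, mul_smul_comm, smul_neg, mul_neg, smul_sub]
      abel
    · intro k hk hki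
      simp [minusRoot, hij, Ne.symm hki]
    · intro hj
      exact absurd (Finset.mem_erase.2 ⟨hij, Finset.mem_univ i⟩) hj

theorem xiElt_mul_xiSqHom (hn : Admissible X n) {j k : Fin n} (hjk : j ≠ k)
    (f : MvPolynomial (Fin n) ℂ) :
    xiElt (u := u) (v := v) j k * xiSqHom X n u v f =
      xiSqHom X n u v (rename (Equiv.swap j k) f) * xiElt j k := by
  have h1 := (oddRefl_bra (X := X) (u := u) (v := v) hjk).mul_xiSqHom (isSigned_minusRoot hjk) f
  have h2 := (oddRefl_bar (u := u) (v := v) hn hjk).mul_xiSqHom (isSigned_plusRoot hjk) f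
  have h3 := ((commute_xi_xiSqHom (X := X) (u := u) (v := v) j (rename (Equiv.swap j k) f)).sub_left
    (commute_xi_xiSqHom k _)).eq
  rw [xiElt, mul_assoc, add_mul, smul_mul_assoc, smul_mul_assoc, h1, h2, ← mul_smul_comm,
    ← mul_smul_comm, ← mul_add, ← mul_assoc, h3, mul_assoc]

theorem commute_xiSqHom_y (hn : Admissible X n) {f : MvPolynomial (Fin n) ℂ}
    (hf : f ∈ squareInvariants X n) (j : Fin n) :
    Commute (xiSqHom X n u v f) (gen X n u v (.y j)) := by
  refine commute_of_invariant (Finset.univ.erase j) (minusRoot j) (fun k => -rt • xiElt j k) _ _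
    ?_ ?_ (xiSq_mul_y_eq_sum hn j) f ?_
  · exact fun k hk => ne_zero_of_unit (isSigned_minusRoot (Finset.ne_of_mem_erase hk).symm).unit
  · intro k hk f
    have hjk := (Finset.ne_of_mem_erase hk).symm
    rw [smul_mul_assoc, mul_smul_comm, xiElt_mul_xiSqHom hn hjk, polyRefl_minusRoot hjk]
  · intro k hk
    rw [polyRefl_minusRoot (Finset.ne_of_mem_erase hk).symm]
    exact Or.inl (rename_of_mem hf _)

theorem xiSqHom_mem_evenCenter (hn : Admissible X n) {f : MvPolynomial (Fin n) ℂ}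
    (hf : f ∈ squareInvariants X n) : xiSqHom X n u v f ∈ evenCenter X n u v := by
  refine ⟨xiSqHom_mem_evenPart f, mem_center_of_commute fun g => ?_⟩
  cases g with
  | y i => exact commute_xiSqHom_y hn hf i
  | xi i => exact (commute_xi_xiSqHom i f).symm
  | t k =>
    obtain ⟨α, h, -⟩ := oddRefl_t (u := u) (v := v) hn k
    obtain ⟨σ, ε, hα, -⟩ := h.exists_signed
    have := h.mul_xiSqHom hα f
    rw [rename_of_mem hf] at this
    exact this.symm

end Center

end SpinDaHa

namespace SpinDaHa

/-! ### Finiteness of algebras over central subrings -/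

section Finiteness

variable {Z H : Type} [CommRing Z] [Ring H] [Algebra Z H]

theorem adjoin_le_of_mul_mem {s : Set H} {N : Submodule Z H} (h1 : (1 : H) ∈ N)
    (h : ∀ g ∈ s, ∀ x ∈ N, g * x ∈ N) : Subalgebra.toSubmodule (Algebra.adjoin Z s) ≤ N := by
  rw [Algebra.adjoin_eq_span, Submodule.span_le]
  intro x hx
  induction hx using Submonoid.closure_induction_left with
  | one => exact h1
  | mul_left x hx y hy ih => exact h x hx y ih

/-- An element that commutes with `x` up to sign normalizes `Z[x]`. Therefore `Z[x] Z[s]` is stable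
under left multiplication by `x` and by `s`, and equals the subalgebra generated by both. -/
theorem fg_adjoin_of_commute_up_to_sign (s : Finset H) (hint : ∀ x ∈ s, IsIntegral Z x)
    (hcomm : ∀ x ∈ s, ∀ y ∈ s, x * y = y * x ∨ x * y = -(y * x)) :
    (Subalgebra.toSubmodule (Algebra.adjoin Z (s : Set H))).FG := by
  classical
  induction s using Finset.induction_on with
  | empty =>
    rw [Finset.coe_empty, Algebra.adjoin_empty, Algebra.toSubmodule_bot]
    rw [Submodule.one_eq_span]
    exact Submodule.fg_span_singleton _
  | insert x s hx ih =>
    have ih := ih (fun y hy => hint y (Finset.mem_insert_of_mem hy)) fun y hy z hz =>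
      hcomm y (Finset.mem_insert_of_mem hy) z (Finset.mem_insert_of_mem hz)
    have hfg := (hint x (Finset.mem_insert_self x s)).fg_adjoin_singleton.mul ih
    convert hfg using 1
    have hle1 : Algebra.adjoin Z {x} ≤ Algebra.adjoin Z ((insert x s : Finset H) : Set H) :=
      Algebra.adjoin_mono (by simp)
    have hle2 : Algebra.adjoin Z (s : Set H) ≤ Algebra.adjoin Z ((insert x s : Finset H) : Set H) :=
      Algebra.adjoin_mono (by simp)
    refine le_antisymm (adjoin_le_of_mul_mem ?_ ?_) ?_
    · rw [← mul_one (1 : H)]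
      exact Submodule.mul_mem_mul (one_mem (Algebra.adjoin Z {x}))
        (one_mem (Algebra.adjoin Z (s : Set H)))
    · intro g hg a ha
      rw [Finset.coe_insert, Set.mem_insert_iff] at hg
      refine Submodule.mul_induction_on ha (fun p hp q hq => ?_) fun a b ha hb => ?_
      · rcases hg with rfl | hg
        · rw [← mul_assoc]
          exact Submodule.mul_mem_mul
            (mul_mem (S := Subalgebra Z H) (Algebra.subset_adjoin rfl) hp) hq
        · have key : ∃ p' ∈ Algebra.adjoin Z {x}, g * p = p' * g := by
            refine Algebra.adjoin_induction (hx := hp) ?_ ?_ ?_ ?_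
            · rintro y rfl
              rcases hcomm g (Finset.mem_insert_of_mem hg) y (Finset.mem_insert_self y s) with h | h
              · exact ⟨y, Algebra.subset_adjoin rfl, h⟩
              · exact ⟨-y, neg_mem (Algebra.subset_adjoin rfl), by rw [h, neg_mul]⟩
            · exact fun r => ⟨_, algebraMap_mem _ r, (Algebra.commutes r g).symm⟩
            · rintro a b - - ⟨a', ha', ha⟩ ⟨b', hb', hb⟩
              exact ⟨a' + b', add_mem ha' hb', by rw [mul_add, add_mul, ha, hb]⟩
            · rintro a b - - ⟨a', ha', ha⟩ ⟨b', hb', hb⟩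
              exact ⟨a' * b', mul_mem ha' hb', by rw [← mul_assoc, ha, mul_assoc, hb, mul_assoc]⟩
          obtain ⟨p', hp', h⟩ := key
          rw [← mul_assoc, h, mul_assoc]
          exact Submodule.mul_mem_mul hp'
            (mul_mem (S := Subalgebra Z H) (Algebra.subset_adjoin hg) hq)
      · rw [mul_add]
        exact add_mem ha hb
    · rw [Submodule.mul_le]
      exact fun p hp q hq => mul_mem (S := Subalgebra Z H) (hle1 hp) (hle2 hq)

/-- The sum of all products of the lines `Z t_k` is stable under left multiplication by the `t_k`
and contains `1`. It is a finite sum of finitely generated submodules. -/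
theorem fg_adjoin_of_finite_closure {t : ℕ → H} {m : ℕ}
    (hfin : (Submonoid.closure ((fun k => Submodule.span Z {t k}) '' Set.Iio m) :
      Set (Submodule Z H)).Finite) :
    (Subalgebra.toSubmodule (Algebra.adjoin Z (t '' Set.Iio m))).FG := by
  obtain ⟨L, hL⟩ : ∃ L, L = Submonoid.closure ((fun k => Submodule.span Z {t k}) '' Set.Iio m) :=
    ⟨_, rfl⟩
  rw [← hL] at hfin
  have hfin' : Finite L := hfin
  have hmem : ∀ k ∈ Set.Iio m, Submodule.span Z {t k} ∈ L := fun k hk =>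
    hL ▸ Submonoid.subset_closure ⟨k, hk, rfl⟩
  have hind : ∀ x ∈ L, x.FG ∧ x ≤ Subalgebra.toSubmodule (Algebra.adjoin Z (t '' Set.Iio m)) := by
    intro x hx
    rw [hL] at hx
    induction hx using Submonoid.closure_induction with
    | mem x hx =>
      obtain ⟨k, hk, rfl⟩ := hx
      exact ⟨Submodule.fg_span_singleton _, Submodule.span_le.2
        (Set.singleton_subset_iff.2 (Algebra.subset_adjoin ⟨k, hk, rfl⟩))⟩
    | one =>
      refine ⟨?_, Submodule.one_le.2 (one_mem (Algebra.adjoin Z (t '' Set.Iio m)))⟩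
      rw [Submodule.one_eq_span]
      exact Submodule.fg_span_singleton _
    | mul x y _ _ hx hy =>
      exact ⟨hx.1.mul hy.1, Submodule.mul_le.2 fun a ha b hb =>
        mul_mem (S := Subalgebra Z H) (hx.2 ha) (hy.2 hb)⟩
  have hfg : (⨆ x : L, (x : Submodule Z H)).FG := Submodule.fg_iSup _ fun x => (hind x x.2).1
  have hle : ∀ x ∈ L, x ≤ ⨆ x : L, (x : Submodule Z H) := fun x hx =>
    le_iSup (fun x : L => (x : Submodule Z H)) ⟨x, hx⟩
  convert hfg using 1
  refine le_antisymm (adjoin_le_of_mul_mem ?_ ?_) (iSup_le fun x => (hind x x.2).2)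
  · exact hle 1 (one_mem L) (Submodule.one_le.1 le_rfl)
  · rintro _ ⟨k, hk, rfl⟩ x hx
    have h1 := Submodule.mul_mem_mul (Submodule.mem_span_singleton_self (R := Z) (t k)) hx
    rw [Submodule.mul_iSup] at h1
    have h2 : ⨆ x : L, Submodule.span Z {t k} * (x : Submodule Z H) ≤
        ⨆ x : L, (x : Submodule Z H) :=
      iSup_le fun x => hle _ (mul_mem (hmem k hk) x.2)
    exact h2 h1

/-- Finiteness of an algebra with a triangular decomposition. -/
theorem finite_of_triangular {Y T Ξ : Set H} (hgen : Algebra.adjoin Z (Y ∪ T ∪ Ξ) = ⊤)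
    (hY : (Subalgebra.toSubmodule (Algebra.adjoin Z Y)).FG)
    (hT : (Subalgebra.toSubmodule (Algebra.adjoin Z T)).FG)
    (hΞ : (Subalgebra.toSubmodule (Algebra.adjoin Z Ξ)).FG)
    (hty : ∀ t ∈ T, ∀ y ∈ Y, ∃ y' ∈ Algebra.adjoin Z Y, t * y = y' * t)
    (hxt : ∀ x ∈ Ξ, ∀ t ∈ T, ∃ x' ∈ Submodule.span Z Ξ, x * t = t * x')
    (hxy : ∀ x ∈ Ξ, ∀ y ∈ Y, x * y - y * x ∈ Algebra.adjoin Z T) : Module.Finite Z H := by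
  set P := Subalgebra.toSubmodule (Algebra.adjoin Z Y) with hP
  set S := Subalgebra.toSubmodule (Algebra.adjoin Z T) with hS
  set Q := Subalgebra.toSubmodule (Algebra.adjoin Z Ξ) with hQ
  -- Generators from `Ξ` are moved across `P` and `S` one at a time, so exchange rules for their
  -- span `V` suffice; none is needed for `Q`.
  set V := Submodule.span Z Ξ with hV
  have hPP : P * P ≤ P := Subalgebra.mul_toSubmodule_le _ _ |>.trans (by rw [sup_idem])
  have hSS : S * S ≤ S := Subalgebra.mul_toSubmodule_le _ _ |>.trans (by rw [sup_idem])
  have hQQ : Q * Q ≤ Q := Subalgebra.mul_toSubmodule_le _ _ |>.trans (by rw [sup_idem])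
  have hVQ : V ≤ Q := Submodule.span_le.2 Algebra.subset_adjoin
  have htP : ∀ t ∈ T, ∀ p ∈ P, ∃ p' ∈ P, t * p = p' * t := by
    intro t ht p hp
    refine Algebra.adjoin_induction (hx := hp) (hty t ht) ?_ ?_ ?_
    · exact fun r => ⟨_, algebraMap_mem (Algebra.adjoin Z Y) r, (Algebra.commutes r t).symm⟩
    · rintro a b - - ⟨a', ha', ha⟩ ⟨b', hb', hb⟩
      exact ⟨a' + b', add_mem ha' hb', by rw [mul_add, add_mul, ha, hb]⟩
    · rintro a b - - ⟨a', ha', ha⟩ ⟨b', hb', hb⟩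
      exact ⟨a' * b', mul_mem (S := Subalgebra Z H) ha' hb',
        by rw [← mul_assoc, ha, mul_assoc, hb, mul_assoc]⟩
  have hSP : S * P ≤ P * S := by
    refine Submodule.mul_le.2 fun s hs => ?_
    refine Algebra.adjoin_induction (hx := hs) ?_ ?_ ?_ ?_
    · intro t ht p hp
      obtain ⟨p', hp', h⟩ := htP t ht p hp
      rw [h]
      exact Submodule.mul_mem_mul hp' (Algebra.subset_adjoin ht)
    · intro r p hp
      rw [Algebra.commutes]
      exact Submodule.mul_mem_mul hp (algebraMap_mem (Algebra.adjoin Z T) r)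
    · intro a b _ _ ha hb p hp
      rw [add_mul]
      exact add_mem (ha p hp) (hb p hp)
    · intro a b _ _ ha hb p hp
      rw [mul_assoc]
      refine Submodule.mul_induction_on (hb p hp) (fun p' hp' s' hs' => ?_) fun x y hx hy => ?_
      · rw [← mul_assoc]
        have h1 := Submodule.mul_mem_mul (ha p' hp') hs'
        rw [mul_assoc] at h1
        exact mul_le_mul' le_rfl hSS h1
      · rw [mul_add]
        exact add_mem hx hy
  have hVS : V * S ≤ S * V := by
    suffices hs : ∀ s ∈ S, ∀ x ∈ V, x * s ∈ S * V from
      Submodule.mul_le.2 fun x hx s h => hs s h x hx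
    intro s hs
    refine Algebra.adjoin_induction (hx := hs) ?_ ?_ ?_ ?_
    · intro t ht x hx
      refine Submodule.span_induction ?_ ?_ ?_ ?_ hx
      · intro x hx
        obtain ⟨x', hx', h⟩ := hxt x hx t ht
        rw [h]
        exact Submodule.mul_mem_mul (Algebra.subset_adjoin ht) hx'
      · rw [zero_mul]; exact zero_mem _
      · intro a b _ _ ha hb
        rw [add_mul]; exact add_mem ha hb
      · intro c a _ ha
        rw [smul_mul_assoc]; exact Submodule.smul_mem _ c ha
    · intro r x hx
      rw [← Algebra.commutes]
      exact Submodule.mul_mem_mul (algebraMap_mem (Algebra.adjoin Z T) r) hx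
    · intro a b _ _ ha hb x hx
      rw [mul_add]
      exact add_mem (ha x hx) (hb x hx)
    · intro a b _ _ ha hb x hx
      rw [← mul_assoc]
      refine Submodule.mul_induction_on (ha x hx) (fun s' hs' x' hx' => ?_) fun x y hx hy => ?_
      · rw [mul_assoc]
        have h1 := Submodule.mul_mem_mul hs' (hb x' hx')
        rw [← mul_assoc] at h1
        exact mul_le_mul' hSS le_rfl h1
      · rw [add_mul]
        exact add_mem hx hy
  have hVP : V * P ≤ P * V ⊔ P * S := by
    -- The commutator with `x` is a derivation; the terms with `S` left of `P` are reordered by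
    -- `hSP`.
    have h : ∀ x ∈ Ξ, ∀ p ∈ P, x * p - p * x ∈ P * S := by
      intro x hx p hp
      refine Algebra.adjoin_induction (hx := hp) ?_ ?_ ?_ ?_
      · intro y hy
        rw [← one_mul (x * y - y * x)]
        exact Submodule.mul_mem_mul (one_mem (Algebra.adjoin Z Y)) (hxy x hx y hy)
      · intro r
        rw [Algebra.commutes, sub_self]
        exact zero_mem _
      · intro a b _ _ ha hb
        have : x * (a + b) - (a + b) * x = (x * a - a * x) + (x * b - b * x) := by noncomm_ring
        rw [this]
        exact add_mem ha hb
      · intro a b ha' hb' ha hb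
        have : x * (a * b) - a * b * x = (x * a - a * x) * b + a * (x * b - b * x) := by
          noncomm_ring
        rw [this]
        refine add_mem ?_ ?_
        · have h1 := Submodule.mul_mem_mul ha (show b ∈ P from hb')
          rw [mul_assoc] at h1
          have h2 := mul_le_mul' (le_refl P) hSP h1
          rw [← mul_assoc] at h2
          exact mul_le_mul' hPP le_rfl h2
        · have h1 := Submodule.mul_mem_mul (show a ∈ P from ha') hb
          rw [← mul_assoc] at h1
          exact mul_le_mul' hPP le_rfl h1
    refine Submodule.mul_le.2 fun x hx p hp => ?_
    refine Submodule.span_induction ?_ ?_ ?_ ?_ hx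
    · intro x hx
      rw [← sub_add_cancel (x * p) (p * x), add_comm]
      exact Submodule.add_mem_sup (Submodule.mul_mem_mul hp (Submodule.subset_span hx))
        (h x hx p hp)
    · rw [zero_mul]; exact zero_mem _
    · intro a b _ _ ha hb
      rw [add_mul]; exact add_mem ha hb
    · intro c a _ ha
      rw [smul_mul_assoc]; exact Submodule.smul_mem _ c ha
  have hN1 : P * (P * S * Q) ≤ P * S * Q := by
    rw [← mul_assoc, ← mul_assoc]
    exact mul_le_mul' (mul_le_mul' hPP le_rfl) le_rfl
  have hN2 : S * (P * S * Q) ≤ P * S * Q :=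
    calc S * (P * S * Q) = (S * P) * S * Q := by simp only [mul_assoc]
      _ ≤ (P * S) * S * Q := mul_le_mul' (mul_le_mul' hSP le_rfl) le_rfl
      _ = P * (S * S) * Q := by simp only [mul_assoc]
      _ ≤ P * S * Q := mul_le_mul' (mul_le_mul' le_rfl hSS) le_rfl
  have hN3 : V * (P * S * Q) ≤ P * S * Q :=
    calc V * (P * S * Q) = (V * P) * S * Q := by simp only [mul_assoc]
      _ ≤ (P * V ⊔ P * S) * S * Q := mul_le_mul' (mul_le_mul' hVP le_rfl) le_rfl
      _ = P * (V * S) * Q ⊔ P * (S * S) * Q := by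
        rw [Submodule.sup_mul, Submodule.sup_mul]; simp only [mul_assoc]
      _ ≤ P * (S * V) * Q ⊔ P * S * Q :=
        sup_le_sup (mul_le_mul' (mul_le_mul' le_rfl hVS) le_rfl)
          (mul_le_mul' (mul_le_mul' le_rfl hSS) le_rfl)
      _ = P * S * (V * Q) ⊔ P * S * Q := by simp only [mul_assoc]
      _ ≤ P * S * Q := sup_le (mul_le_mul' le_rfl ((mul_le_mul' hVQ le_rfl).trans hQQ)) le_rfl
  have htop : Subalgebra.toSubmodule (Algebra.adjoin Z (Y ∪ T ∪ Ξ)) ≤ P * S * Q := by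
    refine adjoin_le_of_mul_mem ?_ ?_
    · have h : (1 : H) * 1 * 1 ∈ P * S * Q := Submodule.mul_mem_mul (Submodule.mul_mem_mul
        (show (1 : H) ∈ P from one_mem (Algebra.adjoin Z Y))
        (show (1 : H) ∈ S from one_mem (Algebra.adjoin Z T)))
        (show (1 : H) ∈ Q from one_mem (Algebra.adjoin Z Ξ))
      rwa [mul_one, mul_one] at h
    · rintro g ((hg | hg) | hg) x hx
      · exact hN1 (Submodule.mul_mem_mul (Algebra.subset_adjoin hg) hx)
      · exact hN2 (Submodule.mul_mem_mul (Algebra.subset_adjoin hg) hx)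
      · exact hN3 (Submodule.mul_mem_mul (Submodule.subset_span hg) hx)
  rw [hgen, Algebra.top_toSubmodule, top_le_iff] at htop
  refine ⟨?_⟩
  rw [← htop]
  exact (hY.mul hT).mul hΞ

end Finiteness

end SpinDaHa

namespace SpinDaHa

variable {X : ClassicalType} {n : ℕ} {u v : ℂ}

/-! ### Integrality of the generators -/

theorem isIntegral_of_coeff_mem {A : Type} [CommRing A] [Algebra ℂ A] {S : Subalgebra ℂ A}
    {p : Polynomial A} (hp : p.Monic) (hc : ∀ k, p.coeff k ∈ S) {a : A} (ha : p.eval a = 0) :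
    IsIntegral S a := by
  have hl : p ∈ Polynomial.lifts (algebraMap S A) :=
    (Polynomial.lifts_iff_coeff_lifts p).2 fun k => ⟨⟨_, hc k⟩, rfl⟩
  obtain ⟨q, hq, -, hm⟩ := Polynomial.lifts_and_natDegree_eq_and_monic hl hp
  exact ⟨q, hm, by rw [← Polynomial.eval_map, hq, ha]⟩

/-- The polynomial with roots `X_j²`. -/
def sqPoly (n : ℕ) : Polynomial (MvPolynomial (Fin n) ℂ) :=
  ∏ j, (Polynomial.X - Polynomial.C (MvPolynomial.X j ^ 2))

/-- Every signed permutation permutes the squares `X_j²`, so the coefficients are invariant in all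
three types at once. -/
theorem sqPoly_coeff_mem (k : ℕ) : (sqPoly n).coeff k ∈ invariants X n := by
  refine mem_invariants fun w => ?_
  have h : (sqPoly n).map (polyAct w : MvPolynomial (Fin n) ℂ →+* _) = sqPoly n := by
    rw [sqPoly, Polynomial.map_prod, ← Equiv.prod_comp w.right fun j =>
      (Polynomial.X - Polynomial.C (MvPolynomial.X j ^ 2 : MvPolynomial (Fin n) ℂ))]
    refine Finset.prod_congr rfl fun j _ => ?_
    have h1 : ((w.left (w.right j) : ℤ) : ℂ) * ((w.left (w.right j) : ℤ) : ℂ) = 1 := by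
      rw [← Int.cast_mul, ← Units.val_mul, Int.units_mul_self]
      simp
    rw [Polynomial.map_sub, Polynomial.map_X, Polynomial.map_C]
    congr 2
    rw [RingHom.coe_coe, map_pow, polyAct, aeval_X, mul_pow, ← map_pow, pow_two, h1, map_one,
      one_mul]
  have h2 := congrArg (fun p => Polynomial.coeff p k) h
  rwa [Polynomial.coeff_map] at h2

theorem isIntegral_X_invariants (i : Fin n) :
    IsIntegral (invariants X n) (MvPolynomial.X i : MvPolynomial (Fin n) ℂ) := by
  refine IsIntegral.of_pow two_pos (isIntegral_of_coeff_mem (p := sqPoly n)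
    (Polynomial.monic_prod_of_monic _ _ fun j _ => Polynomial.monic_X_sub_C _) sqPoly_coeff_mem ?_)
  rw [sqPoly, Polynomial.eval_prod]
  exact Finset.prod_eq_zero (Finset.mem_univ i) (by simp)

theorem isIntegral_X_squareInvariants (i : Fin n) :
    IsIntegral (squareInvariants X n) (MvPolynomial.X i : MvPolynomial (Fin n) ℂ) := by
  refine isIntegral_of_coeff_mem
    (p := ∏ j, (Polynomial.X - Polynomial.C (MvPolynomial.X j : MvPolynomial (Fin n) ℂ)))
    (Polynomial.monic_prod_of_monic _ _ fun j _ => Polynomial.monic_X_sub_C _) (fun k => ?_) ?_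
  -- Substituting squares turns the polynomial with roots `X_j` into `sqPoly`, whose coefficients
  -- are known to be invariant.
  · have h : (∏ j, (Polynomial.X - Polynomial.C (MvPolynomial.X j : MvPolynomial (Fin n) ℂ))).map
        (expand 2 : MvPolynomial (Fin n) ℂ →ₐ[ℂ] _).toRingHom = sqPoly n := by
      rw [sqPoly, Polynomial.map_prod]
      refine Finset.prod_congr rfl fun j _ => ?_
      rw [Polynomial.map_sub, Polynomial.map_X, Polynomial.map_C]
      congr 2
      exact expand_X 2 j
    have h2 := congrArg (fun p => Polynomial.coeff p k) h
    rw [Polynomial.coeff_map] at h2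
    rw [squareInvariants, Subalgebra.mem_comap]
    have h3 := sqPoly_coeff_mem (X := X) (n := n) k
    rw [← h2] at h3
    exact h3
  · rw [Polynomial.eval_prod]
    exact Finset.prod_eq_zero (Finset.mem_univ i) (by simp)

/-! ### Finiteness over the even center -/

theorem commute_of_mem_evenCenter {z : SDaHa X n u v} (hz : z ∈ evenCenter X n u v)
    (b : SDaHa X n u v) : z * b = b * z :=
  (Subalgebra.mem_center_iff.1 hz.2 b).symm

instance : IsMulCommutative (evenCenter X n u v) :=
  ⟨⟨fun a b => Subtype.ext (commute_of_mem_evenCenter a.2 b)⟩⟩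

instance algebraEvenCenter : Algebra (evenCenter X n u v) (SDaHa X n u v) where
  algebraMap := (evenCenter X n u v).val.toRingHom
  commutes' z b := commute_of_mem_evenCenter z.2 b
  smul_def' _ _ := rfl

/-- Integrality is transported from the commutative polynomial ring along `yHom`, which sends
invariants into the even center. -/
theorem isIntegral_y (hn : Admissible X n) (i : Fin n) :
    IsIntegral (evenCenter X n u v) (gen X n u v (.y i)) := by
  rw [← yHom_X]
  exact (isIntegral_X_invariants (X := X) i).map_of_comp_eq
    ((((yHom X n u v).comp (invariants X n).val).codRestrict (evenCenter X n u v)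
      fun f => yHom_mem_evenCenter hn f.2 : invariants X n →ₐ[ℂ] evenCenter X n u v) :
      invariants X n →+* evenCenter X n u v)
    (yHom X n u v : MvPolynomial (Fin n) ℂ →+* SDaHa X n u v) rfl

theorem isIntegral_xi (hn : Admissible X n) (i : Fin n) :
    IsIntegral (evenCenter X n u v) (gen X n u v (.xi i)) := by
  refine IsIntegral.of_pow two_pos ?_
  rw [← xiSqHom_X]
  exact (isIntegral_X_squareInvariants (X := X) i).map_of_comp_eq
    ((((xiSqHom X n u v).comp (squareInvariants X n).val).codRestrict (evenCenter X n u v)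
      fun f => xiSqHom_mem_evenCenter hn f.2 : squareInvariants X n →ₐ[ℂ] evenCenter X n u v) :
      squareInvariants X n →+* evenCenter X n u v)
    (xiSqHom X n u v : MvPolynomial (Fin n) ℂ →+* SDaHa X n u v) rfl

theorem adjoin_subset_adjoin_evenCenter {s : Set (SDaHa X n u v)} {x : SDaHa X n u v}
    (hx : x ∈ Algebra.adjoin ℂ s) : x ∈ Algebra.adjoin (evenCenter X n u v) s := by
  induction hx using Algebra.adjoin_induction with
  | mem x hx => exact Algebra.subset_adjoin hx
  | algebraMap r =>
    exact algebraMap_mem (Algebra.adjoin (evenCenter X n u v) s)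
      (algebraMap ℂ (evenCenter X n u v) r)
  | add x y _ _ hx hy => exact add_mem hx hy
  | mul x y _ _ hx hy => exact mul_mem hx hy

end SpinDaHa

namespace SpinDaHa

variable {X : ClassicalType} {n : ℕ} {u v : ℂ}

/-! ### Coxeter relations for the lines spanned by the generators `t_k` -/

theorem anticommute_of_sq {R : Type} [Ring R] {a b : R} (ha : a * a = 1) (hb : b * b = 1)
    (h : (a * b) ^ 2 = -1) : a * b = -(b * a) := by
  have h1 : a * (a * b) ^ 2 * b = b * a := by
    calc a * (a * b) ^ 2 * b = (a * a) * (b * a) * (b * b) := by rw [pow_two]; noncomm_ring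
      _ = b * a := by rw [ha, hb, one_mul, mul_one]
  rw [← h1, h]
  noncomm_ring

/-- The inverse of `a b` is `b a`, so `(ab)^4 = -1` reads `(ba)^2 = -(ab)^2`: on lines, the braid
relation of length four. -/
theorem sq_eq_neg_of_pow_four {R : Type} [Ring R] {a b : R} (ha : a * a = 1) (hb : b * b = 1)
    (h : (a * b) ^ 4 = -1) : b * a * b * a = -(a * b * a * b) := by
  have h1 : (a * b) * (b * a) = 1 := by
    rw [mul_assoc, ← mul_assoc b, hb, one_mul, ha]
  have h2 : (a * b) ^ 4 * ((b * a) * (b * a)) = (a * b) ^ 2 := by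
    rw [pow_succ _ 3, mul_assoc, ← mul_assoc (a * b) (b * a), h1, one_mul, pow_succ _ 2, mul_assoc,
      h1, mul_one]
  rw [h, neg_one_mul, pow_two] at h2
  simp only [← mul_assoc] at h2
  rw [← h2, neg_neg]

section SpanSingleton

variable {Z H : Type} [CommRing Z] [Ring H] [Algebra Z H]

theorem span_singleton_mul_span_singleton (a b : H) :
    Submodule.span Z {a} * Submodule.span Z {b} = Submodule.span Z {a * b} := by
  rw [Submodule.span_mul_span, Set.singleton_mul_singleton]

theorem span_singleton_neg (a : H) : Submodule.span Z {-a} = Submodule.span Z {a} := by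
  rw [← Set.neg_singleton, Submodule.span_neg]

end SpanSingleton

/-- The line over the even center spanned by the generator `t_k`. -/
def tLine (X : ClassicalType) (n : ℕ) (u v : ℂ) (k : ℕ) :
    Submodule (evenCenter X n u v) (SDaHa X n u v) :=
  Submodule.span (evenCenter X n u v) {mk X n u v (ft X n k)}

theorem tLine_sq {k : ℕ} (hk : k < rank X n) : tLine X n u v k * tLine X n u v k = 1 := by
  rw [tLine, span_singleton_mul_span_singleton, mk_ft_sq hk, Submodule.one_eq_span]

theorem tLine_comm {k l : ℕ} (hk : k < rank X n) (hl : l < rank X n)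
    (h : Rel u v X n ((ft X n k * ft X n l) ^ 2) (-1)) :
    tLine X n u v k * tLine X n u v l = tLine X n u v l * tLine X n u v k := by
  have h1 := mk_rel X n u v h
  rw [map_pow, map_mul, map_neg, map_one] at h1
  rw [tLine, tLine, span_singleton_mul_span_singleton, span_singleton_mul_span_singleton,
    anticommute_of_sq (mk_ft_sq hk) (mk_ft_sq hl) h1, span_singleton_neg]

theorem tLine_braid {k l : ℕ}
    (h : Rel u v X n (ft X n k * ft X n l * ft X n k) (ft X n l * ft X n k * ft X n l)) :
    tLine X n u v k * tLine X n u v l * tLine X n u v k =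
      tLine X n u v l * tLine X n u v k * tLine X n u v l := by
  have h1 := mk_rel X n u v h
  simp only [map_mul] at h1
  simp only [tLine, span_singleton_mul_span_singleton, h1]

theorem coxeterA_tLine {m : ℕ} (hm : m + 1 ≤ n) : CoxeterA (tLine X n u v) m where
  sq k hk := tLine_sq (lt_rank (by omega))
  far i j hij hj := tLine_comm (lt_rank (by omega)) (lt_rank (by omega))
    (Rel.t_far i j (by omega) (by omega) (Or.inl hij))
  braid k hk := tLine_braid (Rel.t_braid k (by omega))

theorem finite_closure_tLine (hn : Admissible X n) :
    (Submonoid.closure (tLine X n u v '' Set.Iio (rank X n)) :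
      Set (Submodule (evenCenter X n u v) (SDaHa X n u v))).Finite := by
  cases X with
  | A =>
    have h1 : 1 ≤ n := hn
    exact finite_closure_of_coxeterA (coxeterA_tLine (by simp only [rank]; omega))
  | B =>
    have h2 : 2 ≤ n := hn
    obtain ⟨m, rfl⟩ : ∃ m, n = m + 2 := ⟨n - 2, by omega⟩
    refine finite_closure_of_coxeterB (m := m + 1) (coxeterA_tLine le_rfl)
      (tLine_sq (by simp [rank])) (fun i hi => ?_) fun _ => ?_
    · exact (tLine_comm (by simp [rank]; omega) (by simp [rank])
        (Rel.t_far_B (n := m + 2) i (by omega))).symm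
    · have h := mk_rel .B _ u v (Rel.t_braid_B h2)
      simp only [map_pow, map_mul, map_neg, map_one] at h
      have h3 := sq_eq_neg_of_pow_four (mk_ft_sq (by simp [rank])) (mk_ft_sq (by simp [rank])) h
      simp only [tLine, span_singleton_mul_span_singleton]
      exact (congrArg (fun x => Submodule.span _ {x}) h3).trans (span_singleton_neg _)
  | D =>
    have h4 : 4 ≤ n := hn
    obtain ⟨m, rfl⟩ : ∃ m, n = m + 3 := ⟨n - 3, by omega⟩
    -- With `n = m + 3` the two branch generators are `t_{m+1}` and `t_{m+2}`, both attached to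
    -- `t_m`.
    refine finite_closure_of_coxeterD (m := m + 1) (coxeterA_tLine le_rfl)
      (tLine_sq (by simp [rank])) (fun i hi => ?_) ?_ fun _ => ?_
    · exact tLine_comm (by simp [rank]; omega) (by simp [rank])
        (Rel.t_far_D (n := m + 3) i (by omega) (by omega))
    · exact tLine_comm (by simp [rank]) (by simp [rank])
        (Rel.t_far_D (n := m + 3) (m + 1) (by omega) (by omega))
    · exact tLine_braid (Rel.t_braid_D (n := m + 3) (by omega))

/-! ### The triangular decomposition over the even center -/

theorem fg_adjoin_t (hn : Admissible X n) :
    (Subalgebra.toSubmodule (Algebra.adjoin (evenCenter X n u v)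
      (Set.range fun k => gen X n u v (.t k)))).FG := by
  have h : (Set.range fun k => gen X n u v (.t k)) =
      (fun k => mk X n u v (ft X n k)) '' Set.Iio (rank X n) := by
    ext x
    constructor
    · rintro ⟨k, rfl⟩
      exact ⟨k, k.2, (gen_t_eq k).symm⟩
    · rintro ⟨k, hk, rfl⟩
      exact ⟨⟨k, hk⟩, gen_t_eq _⟩
  rw [h]
  exact fg_adjoin_of_finite_closure (finite_closure_tLine hn)

theorem fg_adjoin_y (hn : Admissible X n) :
    (Subalgebra.toSubmodule (Algebra.adjoin (evenCenter X n u v)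
      (Set.range fun i => gen X n u v (.y i)))).FG := by
  classical
  have h := fg_adjoin_of_commute_up_to_sign (Z := evenCenter X n u v)
    (Finset.univ.image fun i => gen X n u v (.y i)) (by simpa using isIntegral_y hn) (by
      simp only [Finset.mem_image, Finset.mem_univ, true_and, forall_exists_index,
        forall_apply_eq_imp_iff]
      exact fun i j => Or.inl (y_mul_y X n u v i j))
  rwa [Finset.coe_image, Finset.coe_univ, Set.image_univ] at h

theorem fg_adjoin_xi (hn : Admissible X n) :
    (Subalgebra.toSubmodule (Algebra.adjoin (evenCenter X n u v)
      (Set.range fun i => gen X n u v (.xi i)))).FG := by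
  classical
  have h := fg_adjoin_of_commute_up_to_sign (Z := evenCenter X n u v)
    (Finset.univ.image fun i => gen X n u v (.xi i)) (by simpa using isIntegral_xi hn) (by
      simp only [Finset.mem_image, Finset.mem_univ, true_and, forall_exists_index,
        forall_apply_eq_imp_iff]
      intro i j
      by_cases hij : i = j
      · exact Or.inl (by rw [hij])
      · exact Or.inr (xi_mul_xi X n u v hij))
  rwa [Finset.coe_image, Finset.coe_univ, Set.image_univ] at h

theorem commutator_mem_tAlg (hn : Admissible X n) (i j : Fin n) :
    gen X n u v (.xi i) * gen X n u v (.y j) - gen X n u v (.y j) * gen X n u v (.xi i) ∈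
      tAlg X n u v := by
  rw [← neg_sub]
  refine neg_mem ?_
  by_cases hij : i = j
  · subst hij
    rw [y_mul_xi_self]
    refine add_mem (sum_mem fun k hk => ?_)
      (Subalgebra.smul_mem _ (oddRefl_shortElt hn i).mem v)
    have hik := (Finset.ne_of_mem_erase hk).symm
    exact add_mem (Subalgebra.smul_mem _ (oddRefl_bra hik).mem u)
      (Subalgebra.smul_mem _ (oddRefl_bar hn hik).mem u)
  · rw [y_mul_xi hij]
    exact add_mem (neg_mem (Subalgebra.smul_mem _ (oddRefl_bra hij).mem u))
      (Subalgebra.smul_mem _ (oddRefl_bar hn hij).mem u)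

theorem finite_evenCenter (hn : Admissible X n) :
    Module.Finite (evenCenter X n u v) (SDaHa X n u v) := by
  refine finite_of_triangular (Y := Set.range fun i => gen X n u v (.y i))
    (T := Set.range fun k => gen X n u v (.t k)) (Ξ := Set.range fun i => gen X n u v (.xi i))
    ?_ (fg_adjoin_y hn) (fg_adjoin_t hn) (fg_adjoin_xi hn) ?_ ?_ ?_
  · rw [eq_top_iff]
    rintro x -
    have hx : x ∈ Algebra.adjoin ℂ (Set.range (gen X n u v)) := by rw [adjoin_gen]; trivial
    refine Algebra.adjoin_mono ?_ (adjoin_subset_adjoin_evenCenter hx)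
    rintro _ ⟨g, rfl⟩
    cases g with
    | y i => exact Or.inl (Or.inl ⟨i, rfl⟩)
    | xi i => exact Or.inr ⟨i, rfl⟩
    | t k => exact Or.inl (Or.inr ⟨k, rfl⟩)
  · rintro _ ⟨k, rfl⟩ _ ⟨i, rfl⟩
    obtain ⟨α, h, -⟩ := oddRefl_t (u := u) (v := v) hn k
    obtain ⟨σ, ε, -, h⟩ := h.exists_signed
    refine ⟨ε i • gen X n u v (.y (σ i)), adjoin_subset_adjoin_evenCenter
      (Subalgebra.smul_mem _ (Algebra.subset_adjoin (Set.mem_range_self (σ i))) _), ?_⟩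
    exact (h i).1.trans (smul_mul_assoc _ _ _).symm
  · rintro _ ⟨i, rfl⟩ _ ⟨k, rfl⟩
    obtain ⟨α, h, -⟩ := oddRefl_t (u := u) (v := v) hn k
    obtain ⟨σ, ε, hα, h⟩ := h.exists_signed
    -- The rule `t ξ_k = -ξ_{σ k} t` is read backwards at `k = σ i`; the permutation `σ` is an
    -- involution.
    refine ⟨-gen X n u v (.xi (σ i)), Submodule.neg_mem _
      (Submodule.subset_span (Set.mem_range_self (σ i))), ?_⟩
    have h1 := (h (σ i)).2
    rw [(hα.apply_apply i).1] at h1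
    simp only [mul_neg, h1, neg_neg]
  · rintro _ ⟨i, rfl⟩ _ ⟨j, rfl⟩
    exact adjoin_subset_adjoin_evenCenter (commutator_mem_tAlg hn i j)

end SpinDaHa

end

theorem mainTheorem7 (X : SpinDaHa.ClassicalType) (n : ℕ) (hn : SpinDaHa.Admissible X n)
    (u v : ℂ) :
    (Set.InjOn (SpinDaHa.yHom X n u v) (SpinDaHa.invariants X n) ∧
      (SpinDaHa.invariants X n).map (SpinDaHa.yHom X n u v) ≤ SpinDaHa.evenCenter X n u v) ∧
    (Set.InjOn (SpinDaHa.xiSqHom X n u v) (SpinDaHa.squareInvariants X n) ∧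
      (SpinDaHa.squareInvariants X n).map (SpinDaHa.xiSqHom X n u v) ≤
        SpinDaHa.evenCenter X n u v) ∧
    Module.Finite (SpinDaHa.evenCenter X n u v) (SpinDaHa.SDaHa X n u v) := by
  refine ⟨⟨(SpinDaHa.yHom_injective X u v hn).injOn, ?_⟩,
    ⟨(SpinDaHa.xiSqHom_injective X u v hn).injOn, ?_⟩, SpinDaHa.finite_evenCenter hn⟩
  · rintro _ ⟨f, hf, rfl⟩
    exact SpinDaHa.yHom_mem_evenCenter hn hf
  · rintro _ ⟨f, hf, rfl⟩
    exact SpinDaHa.xiSqHom_mem_evenCenter hn hf
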